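/- Let $\nu>0$, and let $u_0,f\in H^1(\mathbb{R}^3;\mathbb{R}^3)$ be divergence-free vector fields ($f$ does not depend on time). For $\alpha>0$ write $(\varphi)_\alpha=(-\alpha^2\Delta+\mathrm{Id})^{-1}\varphi$, the operator acting in the Fourier variable as multiplication by $(\alpha^2|\xi|^2+1)^{-1}$. Let $\alpha,\beta>0$ and consider the damped Navier–Stokes–Bardina system on $[0,+\infty)\times\mathbb{R}^3$, $$\partial_t u+\operatorname{div}\big((u\otimes u)_\alpha\big)-\nu\Delta u+\nabla p=f-\beta u,\qquad \operatorname{div}u=0,\qquad u(0,\cdot)=u_0 ,$$ where a weak solution satisfies the system in the sense of distributions, the initial datum being taken into account by test functions that need not vanish at $t=0$. Then there exist $$u\in L^\infty([0,+\infty),H^1(\mathbb{R}^3))\cap L^2_{loc}([0,+\infty),\dot H^2(\mathbb{R}^3)),\qquad p\in L^2_{loc}([0,+\infty),H^3(\mathbb{R}^3)),$$ such that $(u,p)$ is a weak solution. It is unique: if $(v,q)$ is a weak solution with the same $u_0$ and $f$, with $v\in L^\infty_{loc}([0,+\infty),H^1)\cap L^2_{loc}([0,+\infty),\dot H^2)$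 and $q\in L^2_{loc}([0,+\infty),H^3)$, then $v(t)=u(t)$ and $q(t)=p(t)$ for almost every $t\ge 0$. Moreover, $u$ has a representative which is continuous from $[0,+\infty)$ to $L^2(\mathbb{R}^3)$, with $u(0,\cdot)=u_0$ and $u(t,\cdot)\in H^1(\mathbb{R}^3)$ for all $t\ge0$, and which satisfies, for all $t\ge 0$, the energy equality $$\begin{aligned}&\|u(t)\|_{L^2}^2+\alpha^2\|u(t)\|_{\dot H^1}^2+2\nu\int_0^t\|u(s)\|_{\dot H^1}^2\,ds+2\nu\alpha^2\int_0^t\|u(s)\|_{\dot H^2}^2\,ds\\&\quad=\|u_0\|_{L^2}^2+\alpha^2\|u_0\|_{\dot H^1}^2+2\int_0^t\Big(\langle f,u(s)\rangle_{L^2}+\alpha^2\langle\nabla\otimes f,\nabla\otimes u(s)\rangle_{L^2}\Big)ds-2\beta\int_0^t\Big(\|u(s)\|_{L^2}^2+\alpha^2\|u(s)\|_{\dot H^1}^2\Big)ds .\end{aligned}$$ -/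

import Mathlib

open MeasureTheory Set Filter
open scoped ENNReal ContDiff SchwartzMap FourierTransform LineDeriv Laplacian

noncomputable section

namespace Bardina

/-- Physical space `ℝ³`. -/
abbrev Space : Type := EuclideanSpace ℝ (Fin 3)

/-- The standard basis vectors of `ℝ³`. -/
def e (j : Fin 3) : Space := EuclideanSpace.single j (1 : ℝ)

/-- Real-valued square integrable functions on `ℝ³`. -/
abbrev L2 : Type := Lp ℝ 2 (volume : Measure Space)

/-- Square integrable vector fields on `ℝ³`, given by their three components. -/
abbrev VecL2 : Type := Fin 3 → L2

/-- The (complexified) tempered distribution `ψ ↦ ∫ ψ(x) g(x) dx` defined by a real `L^q`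
function `g`. -/
def toDist {q : ℝ≥0∞} [Fact (1 ≤ q)] (g : Lp ℝ q (volume : Measure Space)) : 𝓢'(Space, ℂ) :=
  Lp.toTemperedDistribution (Complex.ofRealCLM.compLp g)

/-- The Fourier transform of a real square integrable function, with the normalisation
`ĝ(ξ) = ∫ exp(-2πi x·ξ) g(x) dx`; the frequency in the convention `exp(-i x·η)` is `η = 2πξ`. -/
def fourierL2 (g : L2) : Lp ℂ 2 (volume : Measure Space) := 𝓕 (Complex.ofRealCLM.compLp g)

/-- The pointwise product `g h ∈ L¹` of two square integrable functions. -/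
def mulL1 (g h : L2) : Lp ℝ 1 (volume : Measure Space) :=
  ((Lp.memLp h).mul (p := 2) (q := 2) (r := 1) (Lp.memLp g)).toLp (fun x => g x * h x)

/-! ### Sobolev norms -/

/-- `‖g‖²` in the homogeneous space `Ḣᵏ(ℝ³)`, as an extended number. -/
def homSobolevSq (k : ℕ) (g : L2) : ℝ≥0∞ :=
  ∫⁻ ξ : Space, ENNReal.ofReal ((2 * Real.pi * ‖ξ‖) ^ (2 * k)) * ‖fourierL2 g ξ‖ₑ ^ 2

/-- `‖g‖²` in the inhomogeneous space `Hᵏ(ℝ³)`, as an extended number. -/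
def sobolevSq (k : ℕ) (g : L2) : ℝ≥0∞ :=
  ∫⁻ ξ : Space, ENNReal.ofReal ((1 + (2 * Real.pi * ‖ξ‖) ^ 2) ^ k) * ‖fourierL2 g ξ‖ₑ ^ 2

/-- `g ∈ Hᵏ(ℝ³)`. -/
def MemH (k : ℕ) (g : L2) : Prop := TemperedDistribution.MemSobolev (k : ℝ) 2 (toDist g)

/-- `‖v‖²` in `L²(ℝ³)` for a vector field. -/
def vecL2Sq (v : VecL2) : ℝ := ∑ i, ‖v i‖ ^ 2

/-- `‖v‖²` in `Ḣᵏ(ℝ³)` for a vector field (the value is meaningful where it is finite). -/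
def vecHomSq (k : ℕ) (v : VecL2) : ℝ := (∑ i, homSobolevSq k (v i)).toReal

/-! ### Weak derivatives -/

open Classical in
/-- The distributional derivative `∂ⱼ g`, if it is represented by a square integrable function
(and `0` otherwise). -/
def weakPartial (j : Fin 3) (g : L2) : L2 :=
  if h : ∃ g' : L2, toDist g' = ∂_{e j} (toDist g) then h.choose else 0

/-- `⟨g, v⟩` in `L²` for vector fields. -/
def vecInner (g v : VecL2) : ℝ := ∑ i, inner ℝ (g i) (v i)

/-- `⟨∇ ⊗ g, ∇ ⊗ v⟩` in `L²` for vector fields in `H¹`. -/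
def gradInner (g v : VecL2) : ℝ :=
  ∑ i, ∑ j, inner ℝ (weakPartial j (g i)) (weakPartial j (v i))

/-- `div v = 0` in the sense of distributions. -/
def DivFree (v : VecL2) : Prop := ∑ i, ∂_{e i} (toDist (v i)) = 0

/-! ### The filter and the equation -/

/-- The filtering operator `(-α² Δ + Id)⁻¹`, i.e. the Fourier multiplier whose symbol is
`(α² |η|² + 1)⁻¹` at the frequency `η = 2πξ`. -/
def filtering (α : ℝ) : 𝓢'(Space, ℂ) →L[ℂ] 𝓢'(Space, ℂ) :=
  TemperedDistribution.fourierMultiplierCLM ℂ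
    (fun ξ : Space => (((α ^ 2 * (2 * Real.pi * ‖ξ‖) ^ 2 + 1)⁻¹ : ℝ) : ℂ))

/-- The `i`-th component of
`ν Δ u + f - β u - ∇ p - div ((u ⊗ u)_α)` as a tempered distribution on `ℝ³`. -/
def rhs (ν α β : ℝ) (f u : VecL2) (p : L2) (i : Fin 3) : 𝓢'(Space, ℂ) :=
  (ν : ℂ) • Δ (toDist (u i)) + toDist (f i) - (β : ℂ) • toDist (u i) - ∂_{e i} (toDist p)
    - ∑ j, ∂_{e j} (filtering α (toDist (mulL1 (u i) (u j))))

/-- `u ∈ L^∞_loc([0,∞), H¹)`. -/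
def MemLinftyLocH1 (u : ℝ → VecL2) : Prop :=
  AEStronglyMeasurable u (volume.restrict (Ici 0)) ∧
    ∀ T : ℝ, 0 < T → ∃ C : ℝ, ∀ᵐ t ∂volume.restrict (Icc 0 T),
      ∑ i, sobolevSq 1 (u t i) ≤ ENNReal.ofReal C

/-- `u ∈ L^∞([0,∞), H¹)`. -/
def MemLinftyH1 (u : ℝ → VecL2) : Prop :=
  AEStronglyMeasurable u (volume.restrict (Ici 0)) ∧
    ∃ C : ℝ, ∀ᵐ t ∂volume.restrict (Ici 0), ∑ i, sobolevSq 1 (u t i) ≤ ENNReal.ofReal C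

/-- `u ∈ L²_loc([0,∞), Ḣ²)`. -/
def MemL2LocHom2 (u : ℝ → VecL2) : Prop :=
  AEStronglyMeasurable u (volume.restrict (Ici 0)) ∧
    ∀ T : ℝ, 0 < T → ∫⁻ t in Icc 0 T, ∑ i, homSobolevSq 2 (u t i) < ⊤

/-- `p ∈ L²_loc([0,∞), H³)`. -/
def MemL2LocH3 (p : ℝ → L2) : Prop :=
  AEStronglyMeasurable p (volume.restrict (Ici 0)) ∧
    ∀ T : ℝ, 0 < T → ∫⁻ t in Icc 0 T, sobolevSq 3 (p t) < ⊤

/-- `(u, p)` is a weak solution on `[0,∞) × ℝ³` of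
`∂ₜ u + div ((u ⊗ u)_α) - ν Δ u + ∇ p = f - β u`, `div u = 0`, `u(0) = u₀`.
The equation is tested with the products `θ(t) ψ(x)`, where `θ` is smooth and compactly
supported (and need not vanish at `t = 0`) and `ψ` is a Schwartz function. -/
def IsWeakSolution (ν α β : ℝ) (f u₀ : VecL2) (u : ℝ → VecL2) (p : ℝ → L2) : Prop :=
  (∀ᵐ t ∂volume.restrict (Ici 0), DivFree (u t)) ∧
    ∀ (i : Fin 3) (ψ : 𝓢(Space, ℂ)) (θ : ℝ → ℝ), ContDiff ℝ ∞ θ → HasCompactSupport θ →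
      -(∫ t in Ioi (0 : ℝ), ((deriv θ t : ℝ) : ℂ) * toDist (u t i) ψ)
          - ((θ 0 : ℝ) : ℂ) * toDist (u₀ i) ψ
        = ∫ t in Ioi (0 : ℝ), ((θ t : ℝ) : ℂ) * rhs ν α β f (u t) (p t) i ψ

/-- The energy equality at time `t`. -/
def EnergyEquality (ν α β : ℝ) (f u₀ : VecL2) (u : ℝ → VecL2) (t : ℝ) : Prop :=
  vecL2Sq (u t) + α ^ 2 * vecHomSq 1 (u t)
      + 2 * ν * (∫ s in (0 : ℝ)..t, vecHomSq 1 (u s))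
      + 2 * ν * α ^ 2 * (∫ s in (0 : ℝ)..t, vecHomSq 2 (u s))
    = vecL2Sq u₀ + α ^ 2 * vecHomSq 1 u₀
      + 2 * (∫ s in (0 : ℝ)..t, (vecInner f (u s) + α ^ 2 * gradInner f (u s)))
      - 2 * β * (∫ s in (0 : ℝ)..t, (vecL2Sq (u s) + α ^ 2 * vecHomSq 1 (u s)))

end Bardina

end

open MeasureTheory Set Filter
open scoped ENNReal ContDiff SchwartzMap FourierTransform LineDeriv Laplacian

noncomputable section

namespace Bardina

/-! Put `Λ = (1 - α²Δ)^{1/2}` and `U = Λu`. The filter is `Λ⁻²`, so `u ∈ H¹` means `U ∈ L²`, and the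
energy `‖u‖² + α²‖∇u‖²` is exactly `‖U‖²`. Applying `Λ` to the system gives `U' + AU = F - B(U,U)`
with `A = β - νΔ` and `F = Λf`. Here `B` is built from the products `Q(Uᵢ,Uⱼ) = uᵢuⱼ`, followed by
Riesz-type multipliers and by `∂ⱼΛ⁻¹`. Since `H¹` embeds in `L⁴` in dimension three
(`eLpNorm_four_mult_lamInv_le`), `Q` is bounded from `L² × L²` to `L²`, hence so is `B`: the problem
is a locally Lipschitz perturbation of a contraction semigroup.

Existence. Composing `B` with a radial retraction onto a ball makes it globally Lipschitz, and
Duhamel's formula has a global fixed point (`exists_mild`). Integration by parts (`inner_Q_cyclic`)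
gives `⟨U, B(U,U)⟩ = 0` for divergence-free `U` (`sum_inner_nlB`). This survives the cut-off, which
only multiplies `U` by a scalar. The damping `β` then confines the energy below a constant fixed by
the data, so with a large enough radius the cut-off is never active.

Energy equality. The operators `(1 + A/(n+1))⁻¹` regularise the equation so that `‖·‖²` can be
differentiated. Monotone convergence passes to the limit and shows that the dissipation is finite,
which is the `Ḣ²` regularity (`energy_equality`, `genSq_eq`). The product rule then puts the
pressure in `H³` (`exists_sobolevSq_pres_le`).

Weak solutions and uniqueness. The test functions `Λ(1+A)⁻¹ψ` exhaust the Schwartz space, so the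
weak form is equivalent to an identity in which only bounded operators act on `L²`
(`isWeakSolution_iff`); note `A(1+A)⁻¹ = 1 - (1+A)⁻¹`. For any weak solution, the divergence of this
identity determines the pressure (`pres_ae_eq`). Linear uniqueness (`ae_eq_zero_of_res`) then turns
it into a solution of Duhamel's formula, and a Gronwall argument identifies it with `U`. -/

/-! ### Bounded Hermitian symbols and the real Fourier multipliers they define -/

/-- Square integrable complex functions on `ℝ³`. -/
abbrev CL2 : Type := Lp ℂ 2 (volume : Measure Space)

/-- The real algebra of bounded measurable symbols with `m (-ξ) = conj (m ξ)`. -/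
def symbolAlgebra : Subalgebra ℝ (Space → ℂ) where
  carrier := {m | Measurable m ∧ (∃ C : ℝ, ∀ ξ, ‖m ξ‖ ≤ C) ∧ ∀ ξ, m (-ξ) = starRingEnd ℂ (m ξ)}
  mul_mem' := by
    rintro m n ⟨hm, ⟨C, hC⟩, hm'⟩ ⟨hn, ⟨D, hD⟩, hn'⟩
    refine ⟨hm.mul hn, ⟨C * D, fun ξ => ?_⟩, fun ξ => by simp [hm', hn']⟩
    rw [Pi.mul_apply, norm_mul]
    exact mul_le_mul (hC ξ) (hD ξ) (norm_nonneg _) ((norm_nonneg _).trans (hC ξ))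
  add_mem' := by
    rintro m n ⟨hm, ⟨C, hC⟩, hm'⟩ ⟨hn, ⟨D, hD⟩, hn'⟩
    exact ⟨hm.add hn, ⟨C + D, fun ξ => norm_add_le_of_le (hC ξ) (hD ξ)⟩,
      fun ξ => by simp [hm', hn']⟩
  algebraMap_mem' r := by
    refine ⟨measurable_const, ⟨|r|, fun ξ => ?_⟩, fun ξ => ?_⟩ <;>
      simp [Pi.algebraMap_apply]

/-- Bounded measurable symbols with `m (-ξ) = conj (m ξ)`. -/
abbrev Symbol : Type := symbolAlgebra

instance : CoeFun Symbol (fun _ => Space → ℂ) := ⟨fun m => m.1⟩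

namespace Symbol

theorem measurable (m : Symbol) : Measurable m := m.2.1

theorem bounded (m : Symbol) : ∃ C : ℝ, ∀ ξ, ‖m ξ‖ ≤ C := m.2.2.1

theorem apply_neg (m : Symbol) (ξ : Space) : m (-ξ) = starRingEnd ℂ (m ξ) := m.2.2.2 ξ

@[ext] theorem ext' {m n : Symbol} (h : ∀ ξ, m ξ = n ξ) : m = n := Subtype.ext (funext h)

@[simp] theorem mul_apply (m n : Symbol) (ξ : Space) : (m * n) ξ = m ξ * n ξ := rfl
@[simp] theorem add_apply (m n : Symbol) (ξ : Space) : (m + n) ξ = m ξ + n ξ := rfl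
@[simp] theorem sub_apply (m n : Symbol) (ξ : Space) : (m - n) ξ = m ξ - n ξ := rfl
@[simp] theorem neg_apply (m : Symbol) (ξ : Space) : (-m) ξ = -m ξ := rfl
@[simp] theorem one_apply (ξ : Space) : (1 : Symbol) ξ = 1 := rfl
@[simp] theorem smul_apply (r : ℝ) (m : Symbol) (ξ : Space) : (r • m) ξ = r * m ξ := rfl

/-- A bounded even real function is a symbol. -/
def ofEven (m : Space → ℝ) (hm : Measurable m) (hb : ∃ C : ℝ, ∀ ξ, |m ξ| ≤ C)
    (he : ∀ ξ, m (-ξ) = m ξ) : Symbol :=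
  ⟨fun ξ => (m ξ : ℂ), Complex.measurable_ofReal.comp hm,
    hb.imp fun C h ξ => by simpa using h ξ, fun ξ => by simp [he]⟩

/-- A bounded odd real function is a symbol after multiplication by `i`. -/
def ofOdd (m : Space → ℝ) (hm : Measurable m) (hb : ∃ C : ℝ, ∀ ξ, |m ξ| ≤ C)
    (ho : ∀ ξ, m (-ξ) = -m ξ) : Symbol :=
  ⟨fun ξ => Complex.I * (m ξ : ℂ), (Complex.measurable_ofReal.comp hm).const_mul _,
    hb.imp fun C h ξ => by simpa using h ξ, fun ξ => by simp [ho]⟩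

@[simp] theorem ofEven_apply {m : Space → ℝ} (hm hb he) (ξ : Space) :
    ofEven m hm hb he ξ = (m ξ : ℂ) := rfl

end Symbol

/-! ### Real and complex square integrable functions, and multipliers preserving reality. -/

/-- The embedding of real into complex square integrable functions. -/
def toCL2 : L2 →L[ℝ] CL2 := Complex.ofRealCLM.compLpL 2 volume

/-- The real part of a complex square integrable function. -/
def reL2 : CL2 →L[ℝ] L2 := Complex.reCLM.compLpL 2 volume

/-- Complex conjugation of square integrable functions. -/
def conjL2 : CL2 →L[ℝ] CL2 := (Complex.conjCLE : ℂ →L[ℝ] ℂ).compLpL 2 volume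

theorem coeFn_toCL2 (g : L2) : toCL2 g =ᵐ[volume] fun x => (g x : ℂ) :=
  Complex.ofRealCLM.coeFn_compLp g

theorem coeFn_reL2 (g : CL2) : reL2 g =ᵐ[volume] fun x => (g x).re :=
  Complex.reCLM.coeFn_compLp g

theorem coeFn_conjL2 (g : CL2) : conjL2 g =ᵐ[volume] fun x => starRingEnd ℂ (g x) :=
  (Complex.conjCLE : ℂ →L[ℝ] ℂ).coeFn_compLp g

@[simp] theorem reL2_toCL2 (g : L2) : reL2 (toCL2 g) = g := by
  apply Lp.ext
  filter_upwards [coeFn_reL2 (toCL2 g), coeFn_toCL2 g] with x h1 h2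
  rw [h1, h2, Complex.ofReal_re]

@[simp] theorem conjL2_toCL2 (g : L2) : conjL2 (toCL2 g) = toCL2 g := by
  apply Lp.ext
  filter_upwards [coeFn_conjL2 (toCL2 g), coeFn_toCL2 g] with x h1 h2
  rw [h1, h2, Complex.conj_ofReal]

theorem toCL2_reL2_of_conj {g : CL2} (h : conjL2 g = g) : toCL2 (reL2 g) = g := by
  apply Lp.ext
  filter_upwards [coeFn_toCL2 (reL2 g), coeFn_reL2 g, coeFn_conjL2 g] with x h1 h2 h3
  rw [h1, h2]
  rw [h] at h3
  exact Complex.conj_eq_iff_re.mp h3.symm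

theorem norm_toCL2 (g : L2) : ‖toCL2 g‖ = ‖g‖ := by
  apply le_antisymm
  · simpa using Lp.norm_le_mul_norm_of_ae_le_mul (c := 1)
      (by filter_upwards [coeFn_toCL2 g] with x hx; simp [hx])
  · simpa using Lp.norm_le_mul_norm_of_ae_le_mul (c := 1)
      (by filter_upwards [coeFn_toCL2 g] with x hx; simp [hx])

/-- The reflection `ξ ↦ -ξ` on square integrable functions. -/
def reflL2 : CL2 →ₗᵢ[ℝ] CL2 :=
  Lp.compMeasurePreservingₗᵢ ℝ (fun ξ : Space => -ξ) (Measure.measurePreserving_neg volume)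

theorem coeFn_reflL2 (g : CL2) : reflL2 g =ᵐ[volume] fun x => g (-x) :=
  Lp.coeFn_compMeasurePreserving g (Measure.measurePreserving_neg volume)

theorem ae_comp_neg {p : Space → Prop} (h : ∀ᵐ x : Space, p x) : ∀ᵐ x : Space, p (-x) :=
  (Measure.measurePreserving_neg (volume : Measure Space)).quasiMeasurePreserving.ae h

theorem conj_fourierInv_schwartz (φ : 𝓢(Space, ℂ)) (x : Space) :
    starRingEnd ℂ ((𝓕⁻ φ) x) = (𝓕 (φ.postcompCLM (Complex.conjCLE : ℂ →L[ℝ] ℂ))) x := by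
  rw [SchwartzMap.fourierInv_coe, SchwartzMap.fourier_coe, Real.fourierInv_eq, Real.fourier_eq,
    ← integral_conj]
  congr 1
  ext ξ
  simp [Circle.smul_def, ← Circle.coe_inv_eq_conj, AddChar.map_neg_eq_inv]

/-- On the Fourier side conjugation becomes conjugation composed with `ξ ↦ -ξ`. This is checked on
Schwartz functions and extended by density and continuity. -/
theorem conj_fourierInv (G : CL2) : conjL2 (𝓕⁻ G) = 𝓕⁻ (conjL2 (reflL2 G)) := by
  have hcont : Continuous (fun G : CL2 => (𝓕⁻ G : CL2)) :=
    (Lp.fourierTransformₗᵢ Space ℂ).symm.continuous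
  refine DenseRange.induction_on
    (SchwartzMap.denseRange_toLpCLM (E := Space) (F := ℂ) (p := 2) (by norm_num)
      (μ := volume)) G ?_ ?_
  · exact isClosed_eq (conjL2.continuous.comp hcont)
      (hcont.comp (conjL2.continuous.comp reflL2.continuous))
  · intro φ
    rw [SchwartzMap.toLpCLM_apply]
    have hφ : ∀ᵐ x : Space, (φ.toLp 2 volume : Space → ℂ) x = φ x := φ.coeFn_toLp 2 volume
    have h1 : conjL2 (reflL2 (φ.toLp 2)) =
        (((SchwartzMap.compCLMOfContinuousLinearEquiv ℝ (ContinuousLinearEquiv.neg ℝ (M := Space)))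
          φ).postcompCLM (Complex.conjCLE : ℂ →L[ℝ] ℂ)).toLp 2 := by
      apply Lp.ext
      filter_upwards [coeFn_conjL2 (reflL2 (φ.toLp 2)), coeFn_reflL2 (φ.toLp 2),
        ae_comp_neg hφ, SchwartzMap.coeFn_toLp
        (((SchwartzMap.compCLMOfContinuousLinearEquiv ℝ (ContinuousLinearEquiv.neg ℝ (M := Space)))
          φ).postcompCLM (Complex.conjCLE : ℂ →L[ℝ] ℂ)) 2] with x a b c d
      rw [a, b, c, d]
      simp
    rw [h1, SchwartzMap.toLp_fourierInv_eq, SchwartzMap.toLp_fourierInv_eq]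
    apply Lp.ext
    filter_upwards [coeFn_conjL2 ((𝓕⁻ φ).toLp 2), (𝓕⁻ φ).coeFn_toLp 2,
      SchwartzMap.coeFn_toLp (𝓕⁻ (((SchwartzMap.compCLMOfContinuousLinearEquiv ℝ
        (ContinuousLinearEquiv.neg ℝ (M := Space))) φ).postcompCLM
          (Complex.conjCLE : ℂ →L[ℝ] ℂ))) 2] with x a b c
    rw [a, b, c, conj_fourierInv_schwartz, SchwartzMap.fourierInv_coe, SchwartzMap.fourier_coe,
      Real.fourierInv_eq, Real.fourier_eq, ← integral_neg_eq_self]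
    congr 1
    ext ξ
    simp

/-- Multiplication by a symbol on the Fourier side. -/
def pmul (m : Symbol) (G : CL2) : CL2 :=
  ((Lp.memLp G).of_le_mul (f := fun ξ => m ξ * G ξ) (c := m.bounded.choose)
    (m.measurable.aestronglyMeasurable.mul (Lp.aestronglyMeasurable G))
    (.of_forall fun ξ => by
      rw [norm_mul]
      exact mul_le_mul_of_nonneg_right (m.bounded.choose_spec ξ) (norm_nonneg _))).toLp _

theorem coeFn_pmul (m : Symbol) (G : CL2) : pmul m G =ᵐ[volume] fun ξ => m ξ * G ξ :=
  MemLp.coeFn_toLp _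

theorem fourierL2_eq (g : L2) : fourierL2 g = 𝓕 (toCL2 g) := rfl

theorem fourierL2_add (g h : L2) : fourierL2 (g + h) = fourierL2 g + fourierL2 h := by
  simp [fourierL2_eq, FourierTransform.fourier_add]

theorem fourierL2_smul (r : ℝ) (g : L2) : fourierL2 (r • g) = r • fourierL2 g := by
  simp only [fourierL2_eq, map_smul]
  exact ((Lp.fourierTransformₗᵢ Space ℂ).toLinearIsometry.toLinearMap.restrictScalars ℝ).map_smul
    r (toCL2 g)

theorem norm_fourierL2 (g : L2) : ‖fourierL2 g‖ = ‖g‖ := by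
  rw [fourierL2_eq, Lp.norm_fourier_eq, norm_toCL2]

/-- The Fourier transform on real functions, as a real linear isometry. -/
def fourierIso : L2 →ₗᵢ[ℝ] CL2 where
  toFun := fourierL2
  map_add' := fourierL2_add
  map_smul' := fourierL2_smul
  norm_map' := norm_fourierL2

theorem fourierL2_injective : Function.Injective fourierL2 := fourierIso.injective

/-- The symmetry `m (-ξ) = conj (m ξ)` acts here: it makes the multiplier commute with complex
conjugation. -/
theorem conj_refl_pmul (m : Symbol) (G : CL2) :
    conjL2 (reflL2 (pmul m G)) = pmul m (conjL2 (reflL2 G)) := by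
  apply Lp.ext
  filter_upwards [coeFn_conjL2 (reflL2 (pmul m G)), coeFn_reflL2 (pmul m G),
    ae_comp_neg (coeFn_pmul m G), coeFn_pmul m (conjL2 (reflL2 G)), coeFn_conjL2 (reflL2 G),
    coeFn_reflL2 G] with x a b c d e f
  rw [a, b, c, d, e, f, m.apply_neg]
  simp

/-- The Fourier multiplier with a given symbol on complex functions. -/
def cmult (m : Symbol) (A : CL2) : CL2 := 𝓕⁻ (pmul m (𝓕 A))

theorem conj_cmult (m : Symbol) (A : CL2) : conjL2 (cmult m A) = cmult m (conjL2 A) := by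
  have h := conj_fourierInv (𝓕 A)
  rw [FourierTransform.fourierInv_fourier_eq] at h
  rw [cmult, conj_fourierInv, conj_refl_pmul, cmult, h, FourierTransform.fourier_fourierInv_eq]

theorem fourier_cmult (m : Symbol) (A : CL2) : 𝓕 (cmult m A) = pmul m (𝓕 A) :=
  FourierTransform.fourier_fourierInv_eq _

theorem pmul_add (m : Symbol) (G H : CL2) : pmul m (G + H) = pmul m G + pmul m H := by
  apply Lp.ext
  filter_upwards [coeFn_pmul m (G + H), coeFn_pmul m G, coeFn_pmul m H, Lp.coeFn_add G H,
    Lp.coeFn_add (pmul m G) (pmul m H)] with x a b c d e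
  rw [a, e, Pi.add_apply, b, c, d, Pi.add_apply, mul_add]

theorem pmul_smul (m : Symbol) (r : ℝ) (G : CL2) : pmul m (r • G) = r • pmul m G := by
  apply Lp.ext
  filter_upwards [coeFn_pmul m (r • G), coeFn_pmul m G, Lp.coeFn_smul r G,
    Lp.coeFn_smul r (pmul m G)] with x a b c d
  rw [a, d, Pi.smul_apply, b, c, Pi.smul_apply, mul_smul_comm]

theorem norm_pmul_le (m : Symbol) {C : ℝ} (hC : ∀ ξ, ‖m ξ‖ ≤ C) (G : CL2) :
    ‖pmul m G‖ ≤ C * ‖G‖ :=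
  Lp.norm_le_mul_norm_of_ae_le_mul (by
    filter_upwards [coeFn_pmul m G] with x hx
    rw [hx, norm_mul]
    exact mul_le_mul_of_nonneg_right (hC x) (norm_nonneg _))

/-- A real input has a real output, so the real part taken in `multFun` discards nothing. -/
theorem toCL2_re_cmult (m : Symbol) (g : L2) :
    toCL2 (reL2 (cmult m (toCL2 g))) = cmult m (toCL2 g) :=
  toCL2_reL2_of_conj (by rw [conj_cmult, conjL2_toCL2])

/-- The linear map underlying `mult`. -/
def multFun (m : Symbol) (g : L2) : L2 := reL2 (cmult m (toCL2 g))

theorem fourierL2_multFun (m : Symbol) (g : L2) :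
    fourierL2 (multFun m g) = pmul m (fourierL2 g) := by
  rw [fourierL2_eq, multFun, toCL2_re_cmult, fourier_cmult, fourierL2_eq]

theorem norm_multFun_le (m : Symbol) {C : ℝ} (hC : ∀ ξ, ‖m ξ‖ ≤ C) (g : L2) :
    ‖multFun m g‖ ≤ C * ‖g‖ := by
  rw [← norm_fourierL2, fourierL2_multFun, ← norm_fourierL2 g]
  exact norm_pmul_le m hC _

/-- The Fourier multiplier with symbol `m` on a real function. -/
def multL (m : Symbol) : L2 →L[ℝ] L2 :=
  LinearMap.mkContinuousOfExistsBound
    { toFun := multFun m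
      map_add' := fun g h => fourierL2_injective (by
        simp only [fourierL2_add, fourierL2_multFun, pmul_add])
      map_smul' := fun r g => fourierL2_injective (by
        simp only [fourierL2_smul, fourierL2_multFun, pmul_smul, RingHom.id_apply]) }
    (m.bounded.imp fun _ hC => norm_multFun_le m hC)

theorem fourierL2_multL (m : Symbol) (g : L2) :
    fourierL2 (multL m g) =ᵐ[volume] fun ξ => m ξ * fourierL2 g ξ := by
  have : fourierL2 (multL m g) = pmul m (fourierL2 g) := fourierL2_multFun m g
  rw [this]
  exact coeFn_pmul m _

theorem multL_add (m n : Symbol) : multL (m + n) = multL m + multL n := by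
  refine ContinuousLinearMap.ext fun g => fourierL2_injective (Lp.ext ?_)
  rw [add_apply, fourierL2_add]
  filter_upwards [fourierL2_multL (m + n) g, fourierL2_multL m g, fourierL2_multL n g,
    Lp.coeFn_add (fourierL2 (multL m g)) (fourierL2 (multL n g))] with x a b c d
  rw [a, d, Pi.add_apply, b, c, Symbol.add_apply, add_mul]

theorem multL_smul (r : ℝ) (m : Symbol) : multL (r • m) = r • multL m := by
  refine ContinuousLinearMap.ext fun g => fourierL2_injective (Lp.ext ?_)
  rw [smul_apply, fourierL2_smul]
  filter_upwards [fourierL2_multL (r • m) g, fourierL2_multL m g,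
    Lp.coeFn_smul r (fourierL2 (multL m g))] with x a b c
  rw [a, c, Pi.smul_apply, b, Symbol.smul_apply, Complex.real_smul, mul_assoc]

theorem multL_one : multL 1 = 1 := by
  refine ContinuousLinearMap.ext fun g => fourierL2_injective (Lp.ext ?_)
  filter_upwards [fourierL2_multL 1 g] with x a
  rw [a, Symbol.one_apply, one_mul, one_apply_eq_self]

theorem multL_mul (m n : Symbol) : multL (m * n) = multL m * multL n := by
  refine ContinuousLinearMap.ext fun g => fourierL2_injective (Lp.ext ?_)
  rw [mul_apply_eq_comp]
  filter_upwards [fourierL2_multL (m * n) g, fourierL2_multL m (multL n g),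
    fourierL2_multL n g] with x a b c
  rw [a, b, c, Symbol.mul_apply, mul_assoc]

/-- Fourier multipliers on real functions, as a homomorphism from the algebra of symbols. -/
def mult : Symbol →ₐ[ℝ] (L2 →L[ℝ] L2) :=
  AlgHom.ofLinearMap ⟨⟨multL, multL_add⟩, multL_smul⟩ multL_one multL_mul

theorem fourierL2_mult (m : Symbol) (g : L2) :
    fourierL2 (mult m g) =ᵐ[volume] fun ξ => m ξ * fourierL2 g ξ := fourierL2_multL m g

theorem norm_mult_apply_le (m : Symbol) {C : ℝ} (hC : ∀ ξ, ‖m ξ‖ ≤ C) (g : L2) :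
    ‖mult m g‖ ≤ C * ‖g‖ := norm_multFun_le m hC g

theorem toCL2_mult (m : Symbol) (g : L2) : toCL2 (mult m g) = cmult m (toCL2 g) :=
  toCL2_re_cmult m g

theorem mult_mul_apply (m n : Symbol) (g : L2) : mult (m * n) g = mult m (mult n g) := by
  rw [map_mul]; rfl

theorem mult_comm (m n : Symbol) (g : L2) : mult m (mult n g) = mult n (mult m g) := by
  rw [← mult_mul_apply, mul_comm, mult_mul_apply]

theorem mult_one_apply (g : L2) : mult 1 g = g := by rw [map_one]; rfl

theorem mult_sub_apply (m n : Symbol) (g : L2) : mult (m - n) g = mult m g - mult n g := by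
  rw [map_sub]; rfl

theorem mult_add_apply (m n : Symbol) (g : L2) : mult (m + n) g = mult m g + mult n g := by
  rw [map_add]; rfl

theorem mult_neg_apply (m : Symbol) (g : L2) : mult (-m) g = -mult m g := by
  rw [map_neg]; rfl

theorem mult_smul_apply (r : ℝ) (m : Symbol) (g : L2) : mult (r • m) g = r • mult m g := by
  rw [map_smul]; rfl

theorem mult_sum_apply {ι : Type*} (s : Finset ι) (m : ι → Symbol) (g : L2) :
    mult (∑ i ∈ s, m i) g = ∑ i ∈ s, mult (m i) g := by
  rw [map_sum]; simp

theorem mult_injective {m : Symbol} (hm : ∀ᵐ ξ : Space, m ξ ≠ 0) :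
    Function.Injective (mult m) := by
  refine (injective_iff_map_eq_zero (mult m)).mpr fun g hg => fourierL2_injective ?_
  have h0 : fourierL2 0 = 0 := fourierIso.map_zero
  rw [h0]
  apply Lp.ext
  have h1 := fourierL2_mult m g
  rw [hg, h0] at h1
  filter_upwards [h1, hm, Lp.coeFn_zero ℂ 2 (volume : Measure Space)] with x a b c
  rw [c, Pi.zero_apply] at a ⊢
  exact (mul_eq_zero.mp a.symm).resolve_left b

/-! ### Adjoints, norms and strong limits of multipliers. -/

/-- The symbol of the adjoint operator. -/
def Symbol.conj (m : Symbol) : Symbol :=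
  ⟨fun ξ => starRingEnd ℂ (m ξ), Complex.continuous_conj.measurable.comp m.measurable,
    m.bounded.imp fun C h ξ => by simpa using h ξ, fun ξ => by simp [m.apply_neg]⟩

@[simp] theorem Symbol.conj_apply (m : Symbol) (ξ : Space) : m.conj ξ = starRingEnd ℂ (m ξ) := rfl

theorem inner_eq_fourier (g h : L2) :
    inner ℝ g h = ∫ ξ : Space, inner ℝ (fourierL2 g ξ) (fourierL2 h ξ) := by
  have := fourierIso.inner_map_map g h
  rw [← this]
  exact L2.inner_def _ _

theorem inner_mult_left (m : Symbol) (g h : L2) :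
    inner ℝ (mult m g) h = inner ℝ g (mult m.conj h) := by
  rw [inner_eq_fourier, inner_eq_fourier]
  apply integral_congr_ae
  filter_upwards [fourierL2_mult m g, fourierL2_mult m.conj h] with x a b
  rw [a, b, Complex.inner, Complex.inner]
  simp only [map_mul, Symbol.conj_apply]
  ring_nf

theorem lintegral_enorm_sq_fourierL2 (g : L2) :
    ∫⁻ ξ : Space, ‖fourierL2 g ξ‖ₑ ^ 2 = ENNReal.ofReal (‖g‖ ^ 2) := by
  rw [← norm_fourierL2, ENNReal.ofReal_pow (norm_nonneg _), ofReal_norm, Lp.enorm_def,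
    eLpNorm_eq_lintegral_rpow_enorm_toReal (by norm_num) (by norm_num), ← ENNReal.rpow_natCast,
    ← ENNReal.rpow_mul]
  simp

theorem lintegral_enorm_sq_mult (m : Symbol) (g : L2) :
    ∫⁻ ξ : Space, ‖m ξ‖ₑ ^ 2 * ‖fourierL2 g ξ‖ₑ ^ 2 = ENNReal.ofReal (‖mult m g‖ ^ 2) := by
  rw [← lintegral_enorm_sq_fourierL2]
  apply lintegral_congr_ae
  filter_upwards [fourierL2_mult m g] with x a
  rw [a, enorm_mul, mul_pow]

/-- Dominated convergence on the Fourier side, with majorant `(C + D)² |ĝ|²`. Pointwise convergence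
of uniformly bounded symbols suffices. This gives the strong continuity of the semigroup, its
derivative after smoothing, and the convergence of the resolvents. -/
theorem tendsto_mult {ι : Type*} {l : Filter ι} [l.IsCountablyGenerated] {m : ι → Symbol}
    {n : Symbol} {C : ℝ} (hC : ∀ i ξ, ‖m i ξ‖ ≤ C)
    (h : ∀ ξ, Tendsto (fun i => m i ξ) l (nhds (n ξ))) (g : L2) :
    Tendsto (fun i => mult (m i) g) l (nhds (mult n g)) := by
  obtain ⟨D, hD⟩ := n.bounded
  have key : Tendsto (fun i => ∫⁻ ξ : Space, ‖(m i - n) ξ‖ₑ ^ 2 * ‖fourierL2 g ξ‖ₑ ^ 2) l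
      (nhds (∫⁻ _ : Space, 0)) := by
    refine tendsto_lintegral_filter_of_dominated_convergence
      (fun ξ => ENNReal.ofReal (C + D) ^ 2 * ‖fourierL2 g ξ‖ₑ ^ 2) ?_ ?_ ?_ ?_
    · refine .of_forall fun i => ?_
      exact ((m i - n).measurable.enorm.pow_const 2).mul
        ((Lp.stronglyMeasurable _).measurable.enorm.pow_const 2)
    · refine .of_forall fun i => .of_forall fun ξ => ?_
      gcongr
      rw [← ofReal_norm]
      exact ENNReal.ofReal_le_ofReal (norm_sub_le_of_le (hC i ξ) (hD ξ))
    · rw [lintegral_const_mul' _ _ (by simp), lintegral_enorm_sq_fourierL2]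
      exact ENNReal.mul_ne_top (by simp) (by simp)
    · refine .of_forall fun ξ => ?_
      have h1 : Tendsto (fun i => ‖(m i - n) ξ‖ₑ) l (nhds 0) := by
        have := ((h ξ).sub_const (n ξ)).enorm
        simpa using this
      have h2 := ENNReal.Tendsto.mul_const (ENNReal.Tendsto.pow (n := 2) h1)
        (b := ‖fourierL2 g ξ‖ₑ ^ 2) (Or.inr (by simp))
      simpa using h2
  simp only [lintegral_enorm_sq_mult, lintegral_zero] at key
  rw [tendsto_iff_norm_sub_tendsto_zero]
  have h3 := (ENNReal.tendsto_toReal ENNReal.zero_ne_top).comp key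
  simp only [Function.comp_def, ENNReal.toReal_ofReal (sq_nonneg _), ENNReal.toReal_zero] at h3
  have h4 := h3.sqrt
  simpa [mult_sub_apply] using h4

/-! ### The parameters and the basic symbols -/

/-- The parameters of the system. -/
structure Params where
  /-- viscosity -/
  ν : ℝ
  /-- filter length -/
  α : ℝ
  /-- damping -/
  β : ℝ
  hν : 0 < ν
  hα : 0 < α
  hβ : 0 < β

/-- The modulus `|η| = 2π|ξ|` of the frequency. -/
def eta (ξ : Space) : ℝ := 2 * Real.pi * ‖ξ‖

theorem eta_nonneg (ξ : Space) : 0 ≤ eta ξ := by unfold eta; positivity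

@[simp] theorem eta_neg (ξ : Space) : eta (-ξ) = eta ξ := by simp [eta]

theorem continuous_eta : Continuous eta := by unfold eta; fun_prop

theorem abs_coord_le_eta (ξ : Space) (j : Fin 3) : |2 * Real.pi * ξ j| ≤ eta ξ := by
  rw [abs_mul, abs_of_pos (by positivity : 0 < 2 * Real.pi)]
  exact mul_le_mul_of_nonneg_left (by simpa using PiLp.norm_apply_le ξ j) (by positivity)

theorem continuous_coord (j : Fin 3) : Continuous (fun ξ : Space => ξ j) := by fun_prop

theorem sum_coord_sq (ξ : Space) : ∑ j, (2 * Real.pi * ξ j) ^ 2 = eta ξ ^ 2 := by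
  simp only [eta, mul_pow, EuclideanSpace.norm_sq_eq, Real.norm_eq_abs, sq_abs, Finset.mul_sum]

theorem inner_e (ξ : Space) (j : Fin 3) : inner ℝ ξ (e j) = ξ j := by
  simp [e, EuclideanSpace.inner_single_right]

theorem hasTemperateGrowth_quadratic_rpow {p q : ℝ} (hp : 0 < p) (hq : 0 < q) (r : ℝ) :
    (fun ξ : Space => (p + q * eta ξ ^ 2) ^ r).HasTemperateGrowth := by
  -- The dilation for which `q * eta ξ ^ 2 / p = ‖c • ξ‖ ^ 2`.
  set c : ℝ := 2 * Real.pi * √(q / p)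
  have h : (fun ξ : Space => (p + q * eta ξ ^ 2) ^ r) =
      fun ξ => p ^ r * (1 + ‖(c • ContinuousLinearMap.id ℝ Space) ξ‖ ^ 2) ^ r := by
    ext ξ
    rw [← Real.mul_rpow hp.le (by positivity)]
    congr 1
    have : c ^ 2 = (2 * Real.pi) ^ 2 * (q / p) := by
      rw [mul_pow, Real.sq_sqrt (by positivity)]
    simp only [smul_apply, ContinuousLinearMap.id_apply, norm_smul, mul_pow, eta]
    rw [Real.norm_eq_abs, sq_abs, this]
    field_simp
  rw [h]
  refine (Function.HasTemperateGrowth.const _).mul ?_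
  exact (Function.hasTemperateGrowth_one_add_norm_sq_rpow Space r).comp
    (ContinuousLinearMap.hasTemperateGrowth (c • ContinuousLinearMap.id ℝ Space))

theorem hasTemperateGrowth_quadratic_inv {p q : ℝ} (hp : 0 < p) (hq : 0 < q) :
    (fun ξ : Space => (p + q * eta ξ ^ 2)⁻¹).HasTemperateGrowth := by
  simpa only [Real.rpow_neg_one] using hasTemperateGrowth_quadratic_rpow hp hq (-1)

theorem hasTemperateGrowth_quadratic {p q : ℝ} (hp : 0 < p) (hq : 0 < q) :
    (fun ξ : Space => (p + q * eta ξ ^ 2)).HasTemperateGrowth := by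
  simpa only [Real.rpow_one] using hasTemperateGrowth_quadratic_rpow hp hq 1

theorem hasTemperateGrowth_quadratic_sqrt {p q : ℝ} (hp : 0 < p) (hq : 0 < q) :
    (fun ξ : Space => √(p + q * eta ξ ^ 2)).HasTemperateGrowth := by
  simpa only [Real.sqrt_eq_rpow] using hasTemperateGrowth_quadratic_rpow hp hq (1 / 2)

theorem hasTemperateGrowth_quadratic_sqrt_inv {p q : ℝ} (hp : 0 < p) (hq : 0 < q) :
    (fun ξ : Space => (√(p + q * eta ξ ^ 2))⁻¹).HasTemperateGrowth := by
  have := hasTemperateGrowth_quadratic_rpow hp hq (-(1 / 2))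
  convert this using 2 with ξ
  rw [Real.rpow_neg (by positivity), Real.sqrt_eq_rpow]

theorem hasTemperateGrowth_ofReal_comp {m : Space → ℝ} (hm : m.HasTemperateGrowth) :
    (fun ξ => (m ξ : ℂ)).HasTemperateGrowth :=
  Function.Complex.hasTemperateGrowth_ofReal.comp hm

namespace Params

variable (P : Params)

/-- The symbol of `Λ = (1 - α² Δ)^{1/2}`. -/
def lam (ξ : Space) : ℝ := √(1 + P.α ^ 2 * eta ξ ^ 2)

/-- The symbol of `A = β - ν Δ`. -/
def gen (ξ : Space) : ℝ := P.β + P.ν * eta ξ ^ 2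

theorem lam_sq (ξ : Space) : P.lam ξ ^ 2 = 1 + P.α ^ 2 * eta ξ ^ 2 :=
  Real.sq_sqrt (by positivity)

theorem one_le_lam (ξ : Space) : 1 ≤ P.lam ξ :=
  Real.one_le_sqrt.mpr (le_add_of_nonneg_right (by positivity))

theorem lam_pos (ξ : Space) : 0 < P.lam ξ := one_pos.trans_le (P.one_le_lam ξ)

theorem lam_ne (ξ : Space) : P.lam ξ ≠ 0 := (P.lam_pos ξ).ne'

@[simp] theorem lam_neg (ξ : Space) : P.lam (-ξ) = P.lam ξ := by simp [lam]

theorem continuous_lam : Continuous P.lam := by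
  have := continuous_eta
  unfold lam; fun_prop

theorem alpha_eta_le_lam (ξ : Space) : P.α * eta ξ ≤ P.lam ξ :=
  Real.le_sqrt_of_sq_le (by nlinarith)

theorem gen_pos (ξ : Space) : 0 < P.gen ξ := by
  have := P.hν; have := P.hβ; unfold gen; positivity

theorem beta_le_gen (ξ : Space) : P.β ≤ P.gen ξ := by
  have := P.hν; unfold gen; exact le_add_of_nonneg_right (by positivity)

@[simp] theorem gen_neg (ξ : Space) : P.gen (-ξ) = P.gen ξ := by simp [gen]

theorem continuous_gen : Continuous P.gen := by
  have := continuous_eta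
  unfold gen; fun_prop

/-- `Λ⁻¹`. -/
def lamInv : Symbol :=
  Symbol.ofEven (fun ξ => (P.lam ξ)⁻¹) (P.continuous_lam.measurable.inv)
    ⟨1, fun ξ => by
      rw [abs_of_pos (inv_pos.mpr (P.lam_pos ξ))]; exact inv_le_one_of_one_le₀ (P.one_le_lam ξ)⟩
    (by simp)

/-- `∂ⱼ Λ⁻¹`. -/
def dLamInv (j : Fin 3) : Symbol :=
  Symbol.ofOdd (fun ξ => 2 * Real.pi * ξ j * (P.lam ξ)⁻¹)
    (((continuous_coord j).measurable.const_mul _).mul P.continuous_lam.measurable.inv)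
    ⟨P.α⁻¹, fun ξ => by
      rw [abs_mul, abs_of_pos (inv_pos.mpr (P.lam_pos ξ)), ← div_eq_mul_inv,
        div_le_iff₀ (P.lam_pos ξ), inv_mul_eq_div, le_div_iff₀ P.hα, mul_comm]
      exact (mul_le_mul_of_nonneg_left (abs_coord_le_eta ξ j) P.hα.le).trans
        (P.alpha_eta_le_lam ξ)⟩
    (by intro ξ; simp)

/-- The resolvent `(1 + A)⁻¹`. -/
def res : Symbol :=
  Symbol.ofEven (fun ξ => (1 + P.gen ξ)⁻¹) ((P.continuous_gen.measurable.const_add 1).inv)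
    ⟨1, fun ξ => by
      have := P.gen_pos ξ
      rw [abs_of_pos (by positivity)]; exact inv_le_one_of_one_le₀ (by linarith)⟩
    (by simp)

/-- Both sides have order two in the frequency, which makes `∂ⱼ Λ (1 + A)⁻¹` bounded. The product is
at most `(lam² + eta²) / 2 = (1 + (α² + 1) eta²) / 2`, and `ν eta² ≤ 1 + gen`. -/
theorem eta_mul_lam_le (ξ : Space) :
    eta ξ * P.lam ξ ≤ (1 + (P.α ^ 2 + 1) * P.ν⁻¹) * (1 + P.gen ξ) := by
  have h1 := P.lam_sq ξ
  have h2 : eta ξ * P.lam ξ ≤ (P.lam ξ ^ 2 + eta ξ ^ 2) / 2 := by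
    nlinarith [sq_nonneg (eta ξ - P.lam ξ)]
  have h3 : P.ν⁻¹ * (P.ν * eta ξ ^ 2) = eta ξ ^ 2 := by rw [inv_mul_cancel_left₀ P.hν.ne']
  have h4 : P.ν * eta ξ ^ 2 ≤ 1 + P.gen ξ := by
    unfold gen; linarith [P.hβ]
  have h5 : eta ξ ^ 2 ≤ P.ν⁻¹ * (1 + P.gen ξ) := by
    rw [← h3]; exact mul_le_mul_of_nonneg_left h4 (inv_pos.mpr P.hν).le
  have h6 := mul_le_mul_of_nonneg_left h5 (by positivity : 0 ≤ P.α ^ 2 + 1)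
  have := P.gen_pos ξ
  nlinarith [sq_nonneg (eta ξ), sq_nonneg P.α, mul_nonneg (sq_nonneg P.α) (sq_nonneg (eta ξ))]

/-- `∂ⱼ Λ (1 + A)⁻¹`. -/
def dLamRes (j : Fin 3) : Symbol :=
  Symbol.ofOdd (fun ξ => 2 * Real.pi * ξ j * P.lam ξ * (1 + P.gen ξ)⁻¹)
    ((((continuous_coord j).measurable.const_mul _).mul P.continuous_lam.measurable).mul
      ((P.continuous_gen.measurable.const_add 1).inv))
    ⟨1 + (P.α ^ 2 + 1) * P.ν⁻¹, fun ξ => by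
      have h := P.gen_pos ξ
      rw [abs_mul, abs_mul, abs_of_pos (P.lam_pos ξ),
        abs_of_pos (by positivity : 0 < (1 + P.gen ξ)⁻¹), ← div_eq_mul_inv,
        div_le_iff₀ (by positivity)]
      exact (mul_le_mul_of_nonneg_right (abs_coord_le_eta ξ j) (P.lam_pos ξ).le).trans
        (P.eta_mul_lam_le ξ)⟩
    (by intro ξ; simp)

/-- The contraction semigroup `exp (-t A)` (constant for `t ≤ 0`). -/
def sgp (t : ℝ) : Symbol :=
  Symbol.ofEven (fun ξ => Real.exp (-(max t 0) * P.gen ξ))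
    (Real.measurable_exp.comp (P.continuous_gen.measurable.const_mul _))
    ⟨1, fun ξ => by
      rw [Real.abs_exp, Real.exp_le_one_iff, neg_mul, neg_nonpos]
      exact mul_nonneg (le_max_right _ _) (P.gen_pos ξ).le⟩
    (by simp)

/-- The resolvents `(1 + A / (n + 1))⁻¹`. -/
def resN (n : ℕ) : Symbol :=
  Symbol.ofEven (fun ξ => (1 + P.gen ξ / (n + 1))⁻¹)
    ((P.continuous_gen.measurable.div_const _).const_add 1).inv
    ⟨1, fun ξ => by
      have := P.gen_pos ξ
      rw [abs_of_pos (by positivity)]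
      exact inv_le_one_of_one_le₀ (le_add_of_nonneg_right (by positivity))⟩
    (by simp)

@[simp] theorem lamInv_apply (ξ : Space) : P.lamInv ξ = ((P.lam ξ)⁻¹ : ℝ) := rfl
@[simp] theorem dLamInv_apply (j : Fin 3) (ξ : Space) :
    P.dLamInv j ξ = Complex.I * ((2 * Real.pi * ξ j * (P.lam ξ)⁻¹ : ℝ) : ℂ) := rfl
@[simp] theorem res_apply (ξ : Space) : P.res ξ = ((1 + P.gen ξ)⁻¹ : ℝ) := rfl
@[simp] theorem dLamRes_apply (j : Fin 3) (ξ : Space) :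
    P.dLamRes j ξ = Complex.I * ((2 * Real.pi * ξ j * P.lam ξ * (1 + P.gen ξ)⁻¹ : ℝ) : ℂ) := rfl
@[simp] theorem sgp_apply (t : ℝ) (ξ : Space) :
    P.sgp t ξ = (Real.exp (-(max t 0) * P.gen ξ) : ℝ) := rfl
@[simp] theorem resN_apply (n : ℕ) (ξ : Space) :
    P.resN n ξ = ((1 + P.gen ξ / (n + 1))⁻¹ : ℝ) := rfl

end Params

/-! ### Riesz-type symbols and the algebra behind the pressure. -/

/-- Minus the product of two Riesz transforms, `-ξⱼ ξₖ / |ξ|²`. -/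
def riesz (j k : Fin 3) : Symbol :=
  Symbol.ofEven (fun ξ => -(ξ j * ξ k / ‖ξ‖ ^ 2))
    (((continuous_coord j).measurable.mul (continuous_coord k).measurable).div
      (continuous_norm.measurable.pow_const 2)).neg
    ⟨1, fun ξ => by
      rw [abs_neg, abs_div, abs_of_nonneg (sq_nonneg ‖ξ‖), abs_mul, sq]
      refine div_le_one_of_le₀ ?_ (by positivity)
      exact mul_le_mul (by simpa using PiLp.norm_apply_le ξ j)
        (by simpa using PiLp.norm_apply_le ξ k) (abs_nonneg _) (norm_nonneg _)⟩
    (by simp)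

@[simp] theorem riesz_apply (j k : Fin 3) (ξ : Space) :
    riesz j k ξ = ((-(ξ j * ξ k / ‖ξ‖ ^ 2) : ℝ) : ℂ) := rfl

/-- At `ξ = 0` the division by zero returns `0`, and both sides vanish. -/
theorem norm_sq_mul_riesz (j k : Fin 3) (ξ : Space) :
    ‖ξ‖ ^ 2 * -(ξ j * ξ k / ‖ξ‖ ^ 2) = -(ξ j * ξ k) := by
  rcases eq_or_ne ξ 0 with rfl | h
  · simp
  · have : ‖ξ‖ ≠ 0 := norm_ne_zero_iff.mpr h
    field_simp

namespace Params

variable (P : Params)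

/-- The identity that eliminates the pressure: the Laplacian of the Riesz term is minus the double
divergence of the product, so the two cancel in `dvg_nlB`. -/
theorem sum_dLamInv_sq_mul_riesz (j k : Fin 3) :
    (∑ i, P.dLamInv i * P.dLamInv i) * riesz j k = -(P.dLamInv j * P.dLamInv k) := by
  ext ξ
  have h := norm_sq_mul_riesz j k ξ
  rw [EuclideanSpace.norm_sq_eq] at h
  simp only [Fin.sum_univ_three, Real.norm_eq_abs, sq_abs] at h
  have h2 : ((ξ 0 : ℂ) ^ 2 + (ξ 1 : ℂ) ^ 2 + (ξ 2 : ℂ) ^ 2) * (riesz j k ξ) = -(ξ j * ξ k) := by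
    rw [riesz_apply, EuclideanSpace.norm_sq_eq]
    simp only [Fin.sum_univ_three, Real.norm_eq_abs, sq_abs]
    exact_mod_cast h
  simp only [Fin.sum_univ_three, Symbol.mul_apply, Symbol.add_apply, Symbol.neg_apply,
    dLamInv_apply]
  push_cast
  linear_combination (2 * Real.pi * (P.lam ξ : ℂ)⁻¹ * Complex.I) ^ 2 * h2

/-- Used to recognise the gradient of the pressure `Λ⁻² P(U,U)` inside the nonlinearity after
smoothing, in `rhsRes_pres`. -/
theorem res_mul_dLamInv (j : Fin 3) :
    P.res * P.dLamInv j = P.lamInv * P.lamInv * P.dLamRes j := by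
  ext ξ
  have h : (P.lam ξ : ℂ) ≠ 0 := by exact_mod_cast P.lam_ne ξ
  simp only [Symbol.mul_apply, dLamInv_apply, dLamRes_apply, res_apply, lamInv_apply]
  push_cast
  field_simp

end Params

/-! ### Tempered distributions defined by square integrable functions -/

theorem toDist_eq_CLM (g : L2) :
    toDist g = Lp.toTemperedDistributionCLM ℂ volume 2 (toCL2 g) := rfl

theorem toDist_add (g h : L2) : toDist (g + h) = toDist g + toDist h := by
  simp only [toDist_eq_CLM, map_add]

theorem toDist_zero : toDist (0 : L2) = 0 := by
  simp only [toDist_eq_CLM, map_zero]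

theorem toDist_smul (r : ℝ) (g : L2) : toDist (r • g) = (r : ℂ) • toDist g := by
  have h : toCL2 (r • g) = (r : ℂ) • toCL2 g := by
    rw [map_smul]; exact (algebraMap_smul ℂ r (toCL2 g)).symm
  rw [toDist_eq_CLM, h, map_smul, toDist_eq_CLM]

theorem toDist_sum {ι : Type*} (s : Finset ι) (g : ι → L2) :
    toDist (∑ i ∈ s, g i) = ∑ i ∈ s, toDist (g i) := by
  simp only [toDist_eq_CLM, map_sum]

theorem toDist_injective : Function.Injective (toDist (q := 2)) := by
  intro g h hgh
  have h1 : toCL2 g = toCL2 h := by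
    have hk := Lp.ker_toTemperedDistributionCLM_eq_bot (E := Space) (F := ℂ) (μ := volume) (p := 2)
    exact LinearMap.ker_eq_bot.mp hk hgh
  rw [← reL2_toCL2 g, h1, reL2_toCL2]

theorem toDist_apply (g : L2) (ψ : 𝓢(Space, ℂ)) :
    toDist g ψ = ∫ ξ : Space, (𝓕⁻ ψ) ξ * fourierL2 g ξ := by
  have h := Lp.fourier_toTemperedDistribution_eq (toCL2 g)
  have h2 : toDist g ψ = (𝓕 (toDist g)) (𝓕⁻ ψ) := by
    rw [TemperedDistribution.fourier_apply, FourierTransform.fourier_fourierInv_eq]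
  rw [h2]
  have h3 : 𝓕 (toDist g) = Lp.toTemperedDistribution (fourierL2 g) := h
  rw [h3, Lp.toTemperedDistribution_apply]
  rfl

/-- Evaluation of the distribution defined by a square integrable function. -/
def distL (ψ : 𝓢(Space, ℂ)) : L2 →L[ℝ] ℂ :=
  { toFun := fun g => toDist g ψ
    map_add' := fun g h => by rw [toDist_add]; rfl
    map_smul' := fun r g => by rw [toDist_smul]; rfl
    cont := by
      have h := (Lp.toTemperedDistributionCLM ℂ (volume : Measure Space) 2).continuous.comp
        toCL2.continuous
      exact (PointwiseConvergenceCLM.evalCLM (RingHom.id ℂ) ℂ ψ).continuous.comp h }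

@[simp] theorem distL_apply (ψ : 𝓢(Space, ℂ)) (g : L2) : distL ψ g = toDist g ψ := rfl

theorem eq_of_distL_eq {g h : L2} (H : ∀ ψ, distL ψ g = distL ψ h) : g = h :=
  toDist_injective (by ext ψ; exact H ψ)

-- The multiplier `n` may be unbounded: it suffices that its product with `m₁` is a bounded symbol,
-- so that it acts on functions already smoothed by `m₁`.
open TemperedDistribution in
theorem fourierMultiplier_toDist_mult {n : Space → ℂ} (hn : n.HasTemperateGrowth) {m₁ m₂ : Symbol}
    (h : ∀ ξ, n ξ * m₁ ξ = m₂ ξ) (g : L2) :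
    fourierMultiplierCLM ℂ n (toDist (mult m₁ g)) = toDist (mult m₂ g) := by
  ext ψ
  rw [fourierMultiplierCLM_apply_apply, toDist_apply, toDist_apply,
    FourierTransform.fourierInv_fourier_eq]
  apply integral_congr_ae
  filter_upwards [fourierL2_mult m₁ g, fourierL2_mult m₂ g] with ξ a b
  rw [a, b, SchwartzMap.smulLeftCLM_apply_apply hn, smul_eq_mul, ← h]
  ring

open TemperedDistribution in
theorem fourierMultiplier_toDist {n : Space → ℂ} (hn : n.HasTemperateGrowth) {m : Symbol}
    (h : ∀ ξ, n ξ = m ξ) (g : L2) :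
    fourierMultiplierCLM ℂ n (toDist g) = toDist (mult m g) := by
  have := fourierMultiplier_toDist_mult hn (m₁ := 1) (m₂ := m) (by simpa using h) g
  rwa [mult_one_apply] at this

theorem lineDeriv_toDist_mult (j : Fin 3) {m₁ m₂ : Symbol}
    (h : ∀ ξ : Space, Complex.I * ((2 * Real.pi * ξ j : ℝ) : ℂ) * m₁ ξ = m₂ ξ) (g : L2) :
    ∂_{e j} (toDist (mult m₁ g)) = toDist (mult m₂ g) := by
  rw [TemperedDistribution.lineDeriv_eq_fourierMultiplierCLM]
  have hc : (fun ξ : Space => ((inner ℝ ξ (e j) : ℝ) : ℂ)).HasTemperateGrowth := by fun_prop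
  ext ψ
  rw [smul_apply, TemperedDistribution.fourierMultiplierCLM_apply_apply, toDist_apply,
    toDist_apply, FourierTransform.fourierInv_fourier_eq, smul_eq_mul, ← integral_const_mul]
  apply integral_congr_ae
  filter_upwards [fourierL2_mult m₁ g, fourierL2_mult m₂ g] with ξ a b
  rw [a, b, SchwartzMap.smulLeftCLM_apply_apply hc, smul_eq_mul, ← h, inner_e]
  push_cast
  ring

theorem toDist_mulL1_apply (g h : L2) (ψ : 𝓢(Space, ℂ)) :
    toDist (mulL1 g h) ψ = ∫ x, ψ x * ((g x * h x : ℝ) : ℂ) := by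
  rw [toDist, Lp.toTemperedDistribution_apply]
  apply integral_congr_ae
  have hm : mulL1 g h =ᵐ[volume] fun x => g x * h x := MemLp.coeFn_toLp _
  filter_upwards [Complex.ofRealCLM.coeFn_compLp (mulL1 g h), hm] with x a b
  rw [a, b]
  rfl

theorem toDist_apply' (g : L2) (ψ : 𝓢(Space, ℂ)) :
    toDist g ψ = ∫ x, ψ x * ((g x : ℝ) : ℂ) := by
  rw [toDist, Lp.toTemperedDistribution_apply]
  apply integral_congr_ae
  filter_upwards [Complex.ofRealCLM.coeFn_compLp g] with x a
  rw [a]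
  rfl

/-! ### The embedding of `H¹` into `L⁴` -/

theorem sq_lintegral_mul_le {X : Type*} [MeasurableSpace X] {μ : Measure X} {f g : X → ℝ≥0∞}
    (hf : AEMeasurable f μ) (hg : AEMeasurable g μ) :
    (∫⁻ x, f x * g x ∂μ) ^ 2 ≤ (∫⁻ x, f x ^ 2 ∂μ) * ∫⁻ x, g x ^ 2 ∂μ := by
  have h := ENNReal.lintegral_mul_le_Lp_mul_Lq μ Real.HolderConjugate.two_two hf hg
  simp only [ENNReal.rpow_ofNat, Pi.mul_apply] at h
  refine (pow_le_pow_left' h 2).trans (le_of_eq ?_)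
  rw [mul_pow, ← ENNReal.rpow_natCast, ← ENNReal.rpow_natCast, ← ENNReal.rpow_mul,
    ← ENNReal.rpow_mul]
  norm_num

/-- Inserting `w⁻¹ w` at `ζ` and at `ξ - ζ`, Cauchy–Schwarz splits the inner integral into a weight
factor and a convolution of `(w f)²` with itself. The latter integrates by Tonelli to the square of
`∫ (w f)²`. -/
theorem lintegral_convolution_sq_le {f w : Space → ℝ≥0∞} (hf : Measurable f) (hw : Measurable w)
    (hw0 : ∀ ξ, w ξ ≠ 0) (hwt : ∀ ξ, w ξ ≠ ⊤) :
    ∫⁻ ξ : Space, (∫⁻ ζ : Space, f ζ * f (ξ - ζ)) ^ 2 ≤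
      (∫⁻ ξ : Space, ((w ξ)⁻¹) ^ 4) * (∫⁻ ξ : Space, (w ξ * f ξ) ^ 2) ^ 2 := by
  set K := ∫⁻ ξ : Space, ((w ξ)⁻¹) ^ 4
  have hwi : ∀ ξ, (w ξ)⁻¹ * w ξ = 1 := fun ξ => ENNReal.inv_mul_cancel (hw0 ξ) (hwt ξ)
  -- A second Cauchy–Schwarz, with translation and reflection invariance, bounds the square of the
  -- left side by `K * K`.
  have hK : ∀ ξ : Space, ∫⁻ ζ : Space, ((w ζ)⁻¹ * (w (ξ - ζ))⁻¹) ^ 2 ≤ K := by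
    intro ξ
    have h1 := sq_lintegral_mul_le (μ := (volume : Measure Space)) (f := fun ζ => ((w ζ)⁻¹) ^ 2)
      (g := fun ζ => ((w (ξ - ζ))⁻¹) ^ 2) (by fun_prop) (by fun_prop)
    simp only [← pow_mul, ← mul_pow, Nat.reduceMul] at h1
    rw [lintegral_sub_left_eq_self (fun ζ => ((w ζ)⁻¹) ^ 4) ξ] at h1
    have h2 : (∫⁻ ζ : Space, ((w ζ)⁻¹ * (w (ξ - ζ))⁻¹) ^ 2) ^ 2 ≤ K ^ 2 := by
      rw [sq K]; exact h1
    exact (ENNReal.pow_le_pow_left_iff (by norm_num)).mp h2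
  have hpt : ∀ ξ : Space, (∫⁻ ζ : Space, f ζ * f (ξ - ζ)) ^ 2 ≤
      K * ∫⁻ ζ : Space, (w ζ * f ζ) ^ 2 * (w (ξ - ζ) * f (ξ - ζ)) ^ 2 := by
    intro ξ
    have h1 : ∀ ζ, f ζ * f (ξ - ζ) =
        ((w ζ)⁻¹ * (w (ξ - ζ))⁻¹) * ((w ζ * f ζ) * (w (ξ - ζ) * f (ξ - ζ))) := by
      intro ζ
      calc f ζ * f (ξ - ζ) = ((w ζ)⁻¹ * w ζ) * ((w (ξ - ζ))⁻¹ * w (ξ - ζ)) * (f ζ * f (ξ - ζ)) := by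
            rw [hwi, hwi, one_mul, one_mul]
        _ = _ := by ring
    simp_rw [h1]
    refine (sq_lintegral_mul_le (by fun_prop) (by fun_prop)).trans ?_
    simp_rw [← mul_pow]
    gcongr
    exact hK ξ
  refine (lintegral_mono hpt).trans ?_
  rw [lintegral_const_mul K (by fun_prop)]
  gcongr
  rw [lintegral_lintegral_swap (by fun_prop)]
  have h4 : ∀ ζ : Space, ∫⁻ ξ : Space, (w ζ * f ζ) ^ 2 * (w (ξ - ζ) * f (ξ - ζ)) ^ 2 =
      (w ζ * f ζ) ^ 2 * ∫⁻ ξ : Space, (w ξ * f ξ) ^ 2 := fun ζ => by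
    rw [lintegral_const_mul _ (by fun_prop),
      lintegral_sub_right_eq_self (fun x : Space => (w x * f x) ^ 2)]
  simp_rw [h4]
  rw [lintegral_mul_const _ (by fun_prop), sq]

theorem enorm_toLp_sq (χ : 𝓢(Space, ℂ)) :
    ‖χ.toLp 2 (volume : Measure Space)‖ₑ ^ 2 = ∫⁻ x : Space, ‖χ x‖ₑ ^ 2 := by
  rw [Lp.enorm_def, eLpNorm_congr_ae (χ.coeFn_toLp 2 volume),
    eLpNorm_eq_lintegral_rpow_enorm_toReal (by norm_num) (by norm_num), ← ENNReal.rpow_natCast,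
    ← ENNReal.rpow_mul]
  simp

theorem continuous_fourierInv_CL2 : Continuous (fun G : CL2 => (𝓕⁻ G : CL2)) :=
  (Lp.fourierTransformₗᵢ Space ℂ).symm.continuous

theorem lintegral_enorm_sq_fourierInv (φ : 𝓢(Space, ℂ)) :
    ∫⁻ x : Space, ‖(𝓕⁻ φ) x‖ₑ ^ 2 = ∫⁻ x : Space, ‖φ x‖ₑ ^ 2 := by
  rw [← enorm_toLp_sq, ← enorm_toLp_sq, ← SchwartzMap.toLp_fourierInv_eq, ← ofReal_norm,
    ← ofReal_norm, ← Lp.norm_fourier_eq, FourierTransform.fourier_fourierInv_eq]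

/-- `‖φ‖₄⁴ = ‖φ²‖₂²`, which by Plancherel is the squared norm of the self-convolution of the
transform of `φ`. With `w = lam` this is the embedding of `H¹` into `L⁴`. -/
theorem lintegral_enorm_pow_four_le (φ : 𝓢(Space, ℂ)) {w : Space → ℝ≥0∞} (hw : Measurable w)
    (hw0 : ∀ ξ, w ξ ≠ 0) (hwt : ∀ ξ, w ξ ≠ ⊤) (hwe : ∀ ξ, w (-ξ) = w ξ) :
    ∫⁻ x : Space, ‖φ x‖ₑ ^ 4 ≤
      (∫⁻ ξ : Space, ((w ξ)⁻¹) ^ 4) * (∫⁻ ξ : Space, (w ξ * ‖(𝓕 φ) ξ‖ₑ) ^ 2) ^ 2 := by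
  set B := ContinuousLinearMap.mul ℂ ℂ
  set ψ := SchwartzMap.pairing B φ φ
  have h1 : ∫⁻ x : Space, ‖φ x‖ₑ ^ 4 = ∫⁻ x : Space, ‖(𝓕⁻ ψ) x‖ₑ ^ 2 := by
    rw [lintegral_enorm_sq_fourierInv]
    congr 1; ext x
    rw [SchwartzMap.pairing_apply_apply, ContinuousLinearMap.mul_apply', enorm_mul]
    ring
  have h2 : 𝓕⁻ ψ = SchwartzMap.convolution B (𝓕⁻ φ) (𝓕⁻ φ) := by
    have := SchwartzMap.fourier_convolution B (𝓕⁻ φ) (𝓕⁻ φ)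
    rw [FourierTransform.fourier_fourierInv_eq] at this
    exact (congrArg _ this.symm).trans (FourierTransform.fourierInv_fourier_eq
      (F := 𝓢(Space, ℂ)) (SchwartzMap.convolution B (𝓕⁻ φ) (𝓕⁻ φ)))
  -- The two transforms differ by a reflection, under which `w` is invariant.
  have h3 : ∫⁻ ξ : Space, (w ξ * ‖(𝓕 φ) ξ‖ₑ) ^ 2 = ∫⁻ ξ : Space, (w ξ * ‖(𝓕⁻ φ) ξ‖ₑ) ^ 2 := by
    rw [← lintegral_neg_eq_self]
    congr 1; ext ξ
    rw [hwe, SchwartzMap.fourierInv_coe, SchwartzMap.fourier_coe, Real.fourierInv_eq_fourier_neg]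
  rw [h1, h3]
  refine le_trans (lintegral_mono fun ξ => ?_)
    (lintegral_convolution_sq_le (f := fun ξ => ‖(𝓕⁻ φ) ξ‖ₑ) (𝓕⁻ φ).continuous.enorm.measurable
      hw hw0 hwt)
  gcongr
  rw [h2, SchwartzMap.convolution_apply, convolution_def]
  refine (enorm_integral_le_lintegral_enorm _).trans (le_of_eq ?_)
  congr 1; ext ζ
  rw [ContinuousLinearMap.mul_apply', enorm_mul]

namespace Params

variable (P : Params)

/-- The integrand decays like `‖ξ‖⁻⁴`, which is integrable at infinity in dimension three. -/
theorem lintegral_lam_inv_pow_four :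
    ∫⁻ ξ : Space, ((ENNReal.ofReal (P.lam ξ))⁻¹) ^ 4 ≠ ⊤ := by
  have h := integrable_rpow_neg_one_add_norm_sq (E := Space) (μ := volume) (r := 4)
    (by simp [finrank_euclideanSpace]; norm_num)
  set c := P.α ^ 2 * (2 * Real.pi) ^ 2
  have hc : 0 < c := by have := P.hα; positivity
  -- Chosen so that `C ≥ 1` and `C * c ≥ 1`, whence `1 + ‖ξ‖ ^ 2 ≤ C * P.lam ξ ^ 2`.
  set C := max 1 c⁻¹
  have hC : ∀ ξ : Space, (P.lam ξ)⁻¹ ^ 4 ≤ C ^ 2 * (1 + ‖ξ‖ ^ 2) ^ (-(4 : ℝ) / 2) := by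
    intro ξ
    have h0 : 1 + ‖ξ‖ ^ 2 ≤ C * P.lam ξ ^ 2 := by
      rw [lam_sq, eta]
      have h1 : 1 ≤ C := le_max_left _ _
      have h2 : 1 ≤ C * c := by
        have := mul_le_mul_of_nonneg_right (le_max_right 1 c⁻¹) hc.le
        rwa [inv_mul_cancel₀ hc.ne'] at this
      have h3 := mul_le_mul_of_nonneg_right h2 (sq_nonneg ‖ξ‖)
      have h4 : C * (1 + P.α ^ 2 * (2 * Real.pi * ‖ξ‖) ^ 2) = C + C * c * ‖ξ‖ ^ 2 := by
        simp only [c]; ring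
      rw [h4]; linarith
    have h5 : (1 + ‖ξ‖ ^ 2) ^ (-(4 : ℝ) / 2) = ((1 + ‖ξ‖ ^ 2) ^ 2)⁻¹ := by
      rw [show (-(4 : ℝ) / 2) = -((2 : ℕ) : ℝ) by norm_num, Real.rpow_neg (by positivity),
        Real.rpow_natCast]
    have hl := P.lam_pos ξ
    rw [h5, inv_pow, ← div_eq_mul_inv, inv_eq_one_div, div_le_div_iff₀ (by positivity)
      (by positivity), one_mul]
    calc (1 + ‖ξ‖ ^ 2) ^ 2 ≤ (C * P.lam ξ ^ 2) ^ 2 := by gcongr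
      _ = _ := by ring
  refine ne_top_of_le_ne_top (h.const_mul (C ^ 2)).lintegral_lt_top.ne (lintegral_mono fun ξ => ?_)
  rw [← ENNReal.ofReal_inv_of_pos (P.lam_pos ξ), ← ENNReal.ofReal_pow
    (inv_pos.mpr (P.lam_pos ξ)).le]
  exact ENNReal.ofReal_le_ofReal (hC ξ)

/-- Schwartz functions approximate in `H¹`. -/
theorem exists_schwartz_approx (A : CL2) : ∃ (φ : ℕ → 𝓢(Space, ℂ)) (a : ℕ → CL2),
    Tendsto a atTop (nhds A) ∧ (∀ n, cmult P.lamInv (a n) = (φ n).toLp 2) ∧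
    (∀ n j, cmult (P.dLamInv j) (a n) = (∂_{e j} (φ n)).toLp 2) ∧
    ∀ n, ∫⁻ ξ : Space, (ENNReal.ofReal (P.lam ξ) * ‖(𝓕 (φ n)) ξ‖ₑ) ^ 2 = ‖a n‖ₑ ^ 2 := by
  have hd := SchwartzMap.denseRange_toLpCLM (E := Space) (F := ℂ) (p := 2) (by norm_num)
      (μ := volume)
  obtain ⟨s, hs, hlim⟩ := mem_closure_iff_seq_limit.mp (hd (𝓕 A))
  choose χ hχ using hs
  have hli : (fun ξ => (((P.lam ξ)⁻¹ : ℝ) : ℂ)).HasTemperateGrowth :=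
    hasTemperateGrowth_ofReal_comp
      (hasTemperateGrowth_quadratic_sqrt_inv one_pos (by have := P.hα; positivity))
  have hF : ∀ n, 𝓕 (𝓕⁻ (s n)) = (χ n).toLp 2 := fun n => by
    rw [FourierTransform.fourier_fourierInv_eq, ← hχ n, SchwartzMap.toLpCLM_apply]
  have key : ∀ (m : Symbol) (n : ℕ) (θ : 𝓢(Space, ℂ)),
      (∀ ξ, m ξ * χ n ξ = θ ξ) → cmult m (𝓕⁻ (s n)) = (𝓕⁻ θ).toLp 2 := by
    intro m n θ h
    rw [cmult, hF, ← SchwartzMap.toLp_fourierInv_eq]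
    congr 1
    apply Lp.ext
    filter_upwards [coeFn_pmul m ((χ n).toLp 2), (χ n).coeFn_toLp 2, θ.coeFn_toLp 2] with x a b c
    rw [a, b, c, h]
  -- `χ n` approximates the transform of `A`. Dividing it by `lam` keeps it in the Schwartz class,
  -- and the weight `lam` in the last claim undoes that division.
  refine ⟨fun n => 𝓕⁻ (SchwartzMap.smulLeftCLM ℂ (fun ξ => (((P.lam ξ)⁻¹ : ℝ) : ℂ)) (χ n)),
    fun n => 𝓕⁻ (s n), ?_, fun n => key _ _ _ fun ξ => ?_, fun n j => ?_, fun n => ?_⟩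
  · have := (continuous_fourierInv_CL2.tendsto _).comp hlim
    rwa [FourierTransform.fourierInv_fourier_eq] at this
  · rw [SchwartzMap.smulLeftCLM_apply_apply hli]; rfl
  · refine (key _ _ (𝓕 (∂_{e j} (𝓕⁻ (SchwartzMap.smulLeftCLM ℂ
      (fun ξ => (((P.lam ξ)⁻¹ : ℝ) : ℂ)) (χ n))))) fun ξ => ?_).trans
      (by rw [FourierTransform.fourierInv_fourier_eq])
    rw [SchwartzMap.fourier_lineDerivOp_eq, FourierTransform.fourier_fourierInv_eq, smul_apply,
      SchwartzMap.smulLeftCLM_apply_apply (by fun_prop), SchwartzMap.smulLeftCLM_apply_apply hli,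
      inner_e, dLamInv_apply]
    simp only [smul_eq_mul, Complex.real_smul]
    push_cast
    ring
  · rw [FourierTransform.fourier_fourierInv_eq]
    have h1 : ‖𝓕⁻ (s n)‖ₑ = ‖(χ n).toLp 2‖ₑ := by
      rw [← ofReal_norm, ← ofReal_norm, ← hF n, Lp.norm_fourier_eq]
    rw [h1, enorm_toLp_sq]
    congr 1; ext ξ
    rw [SchwartzMap.smulLeftCLM_apply_apply hli, smul_eq_mul, enorm_mul, ← mul_assoc,
      ← ofReal_norm (((P.lam ξ)⁻¹ : ℝ) : ℂ), Complex.norm_real, Real.norm_of_nonneg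
      (inv_pos.mpr (P.lam_pos ξ)).le, ← ENNReal.ofReal_mul (P.lam_pos ξ).le,
      mul_inv_cancel₀ (P.lam_ne ξ), ENNReal.ofReal_one, one_mul]

end Params

theorem cmult_add (m : Symbol) (A B : CL2) : cmult m (A + B) = cmult m A + cmult m B := by
  rw [cmult, FourierTransform.fourier_add, pmul_add, FourierTransform.fourierInv_add]; rfl

theorem norm_cmult_le (m : Symbol) {C : ℝ} (hC : ∀ ξ, ‖m ξ‖ ≤ C) (A : CL2) :
    ‖cmult m A‖ ≤ C * ‖A‖ := by
  rw [← Lp.norm_fourier_eq (cmult m A), fourier_cmult, ← Lp.norm_fourier_eq A]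
  exact norm_pmul_le m hC _

/-- Fourier multipliers on complex functions as additive maps. -/
def cmultHom (m : Symbol) : CL2 →+ CL2 := AddMonoidHom.mk' (cmult m) (cmult_add m)

theorem continuous_cmult (m : Symbol) : Continuous (cmult m) := by
  obtain ⟨C, hC⟩ := m.bounded
  exact AddMonoidHomClass.continuous_of_bound (cmultHom m) C (norm_cmult_le m hC)

theorem toCL2_injective : Function.Injective toCL2 := fun g h hgh => by
  rw [← reL2_toCL2 g, hgh, reL2_toCL2]

theorem two_smul_toCL2_reL2 (B : CL2) : (2 : ℕ) • toCL2 (reL2 B) = B + conjL2 B := by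
  rw [two_smul]
  apply Lp.ext
  filter_upwards [coeFn_toCL2 (reL2 B), coeFn_reL2 B, coeFn_conjL2 B,
    Lp.coeFn_add (toCL2 (reL2 B)) (toCL2 (reL2 B)), Lp.coeFn_add B (conjL2 B)] with x a b c d e
  rw [d, e, Pi.add_apply, Pi.add_apply, a, b, c, Complex.add_conj]
  push_cast; ring

/-- Multipliers commute with conjugation, and twice the real part is `B + conj B`. Keeping the
factor two makes additivity of `cmult` enough. -/
theorem reL2_cmult (m : Symbol) (B : CL2) : reL2 (cmult m B) = mult m (reL2 B) := by
  apply toCL2_injective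
  have h : (2 : ℕ) • toCL2 (reL2 (cmult m B)) = (2 : ℕ) • toCL2 (mult m (reL2 B)) := by
    rw [two_smul_toCL2_reL2, conj_cmult, ← cmult_add, ← two_smul_toCL2_reL2, toCL2_mult]
    exact map_nsmul (cmultHom m) 2 _
  have h2 : (2 : ℝ) • toCL2 (reL2 (cmult m B)) = (2 : ℝ) • toCL2 (mult m (reL2 B)) := by
    rw [two_smul, two_smul, ← two_nsmul, ← two_nsmul, h]
  exact smul_right_injective _ (two_ne_zero) h2

namespace Params

variable (P : Params)

/-- The embedding constant of `H¹` into `L⁴`. -/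
def embConst : ℝ≥0∞ := (∫⁻ ξ : Space, ((ENNReal.ofReal (P.lam ξ))⁻¹) ^ 4) ^ (1 / 4 : ℝ)

theorem embConst_ne_top : P.embConst ≠ ⊤ :=
  ENNReal.rpow_ne_top_of_nonneg (by norm_num) P.lintegral_lam_inv_pow_four

/-- The bound for Schwartz functions passes to the limit by Fatou's lemma along an almost everywhere
convergent subsequence. -/
theorem eLpNorm_four_cmult_lamInv_le (A : CL2) :
    eLpNorm (cmult P.lamInv A) 4 volume ≤ P.embConst * ‖A‖ₑ := by
  obtain ⟨φ, a, ha, h1, -, h3⟩ := P.exists_schwartz_approx A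
  have hlim : Tendsto (fun n => cmult P.lamInv (a n)) atTop (nhds (cmult P.lamInv A)) :=
    ((continuous_cmult P.lamInv).tendsto A).comp ha
  have hbound : ∀ n, eLpNorm (cmult P.lamInv (a n)) 4 volume ≤ P.embConst * ‖a n‖ₑ := by
    intro n
    rw [h1, eLpNorm_congr_ae ((φ n).coeFn_toLp 2 volume),
      eLpNorm_eq_lintegral_rpow_enorm_toReal (by norm_num) (by norm_num)]
    have h4 := lintegral_enorm_pow_four_le (φ n) (w := fun ξ => ENNReal.ofReal (P.lam ξ))
      P.continuous_lam.measurable.ennreal_ofReal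
      (fun ξ => (ENNReal.ofReal_pos.mpr (P.lam_pos ξ)).ne') (fun ξ => ENNReal.ofReal_ne_top)
      (fun ξ => by rw [P.lam_neg])
    rw [h3] at h4
    simp only [ENNReal.toReal_ofNat, ENNReal.rpow_ofNat]
    refine (ENNReal.rpow_le_rpow h4 (by norm_num)).trans (le_of_eq ?_)
    rw [ENNReal.mul_rpow_of_nonneg _ _ (by norm_num), embConst, ← pow_mul, ← ENNReal.rpow_natCast,
      ← ENNReal.rpow_mul]
    norm_num
  obtain ⟨ns, hns, hae⟩ := (tendstoInMeasure_of_tendsto_Lp hlim).exists_seq_tendsto_ae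
  have hfatou := Lp.eLpNorm_lim_le_liminf_eLpNorm (p := 4)
    (fun n => Lp.aestronglyMeasurable (cmult P.lamInv (a (ns n)))) _ hae
  refine hfatou.trans ?_
  have hlim2 : Tendsto (fun n => P.embConst * ‖a (ns n)‖ₑ) atTop (nhds (P.embConst * ‖A‖ₑ)) :=
    ENNReal.Tendsto.const_mul (ha.comp hns.tendsto_atTop).enorm (Or.inr P.embConst_ne_top)
  rw [← hlim2.liminf_eq]
  exact liminf_le_liminf (.of_forall fun n => hbound _)

theorem eLpNorm_four_mult_lamInv_le (A : L2) :
    eLpNorm (mult P.lamInv A) 4 volume ≤ P.embConst * ‖A‖ₑ := by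
  have h := P.eLpNorm_four_cmult_lamInv_le (toCL2 A)
  rw [← toCL2_mult] at h
  have h1 : eLpNorm (toCL2 (mult P.lamInv A)) 4 volume = eLpNorm (mult P.lamInv A) 4 volume := by
    apply eLpNorm_congr_norm_ae
    filter_upwards [coeFn_toCL2 (mult P.lamInv A)] with x a
    rw [a, Complex.norm_real]
  have h2 : ‖toCL2 A‖ₑ = ‖A‖ₑ := by rw [← ofReal_norm, ← ofReal_norm, norm_toCL2]
  rwa [h1, h2] at h

theorem memLp_four_mult_lamInv (A : L2) : MemLp (mult P.lamInv A) 4 volume :=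
  ⟨Lp.aestronglyMeasurable _, (P.eLpNorm_four_mult_lamInv_le A).trans_lt
    (ENNReal.mul_lt_top P.embConst_ne_top.lt_top (by simp))⟩

/-! ### The product of two `H¹` functions as a bounded bilinear map. -/

instance : Fact ((1 : ℝ≥0∞) ≤ 4) := ⟨by norm_num⟩

instance : ENNReal.HolderTriple 4 4 2 := ⟨by
  rw [← ENNReal.toReal_eq_toReal_iff' (by simp) (by simp), ENNReal.toReal_add (by simp) (by simp)]
  norm_num⟩

/-- `Λ⁻¹` as an operator from `L²` to `L⁴`. -/
def emb : L2 →L[ℝ] Lp ℝ 4 (volume : Measure Space) :=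
  LinearMap.mkContinuous
    { toFun := fun A => (P.memLp_four_mult_lamInv A).toLp _
      map_add' := fun A B => by
        apply Lp.ext
        filter_upwards [(P.memLp_four_mult_lamInv (A + B)).coeFn_toLp,
          (P.memLp_four_mult_lamInv A).coeFn_toLp, (P.memLp_four_mult_lamInv B).coeFn_toLp,
          Lp.coeFn_add ((P.memLp_four_mult_lamInv A).toLp _)
            ((P.memLp_four_mult_lamInv B).toLp _),
          Lp.coeFn_add (mult P.lamInv A) (mult P.lamInv B)] with x a b c d f
        rw [a, d, Pi.add_apply, b, c, map_add, f, Pi.add_apply]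
      map_smul' := fun r A => by
        apply Lp.ext
        filter_upwards [(P.memLp_four_mult_lamInv (r • A)).coeFn_toLp,
          (P.memLp_four_mult_lamInv A).coeFn_toLp,
          Lp.coeFn_smul r ((P.memLp_four_mult_lamInv A).toLp _),
          Lp.coeFn_smul r (mult P.lamInv A)] with x a b c d
        rw [a, RingHom.id_apply, c, Pi.smul_apply, b, map_smul, d, Pi.smul_apply] }
    P.embConst.toReal (fun A => by
      change ‖(P.memLp_four_mult_lamInv A).toLp _‖ ≤ _
      rw [Lp.norm_toLp, ← toReal_enorm A, ← ENNReal.toReal_mul]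
      exact ENNReal.toReal_mono (ENNReal.mul_ne_top P.embConst_ne_top (by simp))
        (P.eLpNorm_four_mult_lamInv_le A))

theorem coeFn_emb (A : L2) : P.emb A =ᵐ[volume] mult P.lamInv A :=
  (P.memLp_four_mult_lamInv A).coeFn_toLp

/-- The bilinear map `(A, B) ↦ (Λ⁻¹ A) (Λ⁻¹ B)` on `L²`. -/
def Q : L2 →L[ℝ] L2 →L[ℝ] L2 :=
  ((ContinuousLinearMap.mul ℝ ℝ).holderL volume 4 4 2).bilinearComp P.emb P.emb

theorem coeFn_Q (A B : L2) :
    P.Q A B =ᵐ[volume] fun x => mult P.lamInv A x * mult P.lamInv B x := by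
  have h := (ContinuousLinearMap.mul ℝ ℝ).coeFn_holder (r := 2) (P.emb A) (P.emb B)
  filter_upwards [h, P.coeFn_emb A, P.coeFn_emb B] with x a b c
  refine Eq.trans a ?_
  rw [b, c]; rfl

theorem Q_comm (A B : L2) : P.Q A B = P.Q B A := by
  apply Lp.ext
  filter_upwards [P.coeFn_Q A B, P.coeFn_Q B A] with x a b
  rw [a, b, mul_comm]

theorem toDist_mulL1_mult_lamInv (A B : L2) :
    toDist (mulL1 (mult P.lamInv A) (mult P.lamInv B)) = toDist (P.Q A B) := by
  ext ψ
  rw [toDist_mulL1_apply, toDist_apply']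
  apply integral_congr_ae
  filter_upwards [P.coeFn_Q A B] with x a
  rw [a]

/-- The functions `Λ a` with `a` a real Schwartz function. -/
def IsSchwartzLift (A : L2) : Prop := ∃ φ : 𝓢(Space, ℝ), mult P.lamInv A = φ.toLp 2 ∧
  ∀ j, mult (P.dLamInv j) A = (∂_{e j} φ).toLp 2

theorem dense_isSchwartzLift : Dense {A | P.IsSchwartzLift A} := by
  intro A
  obtain ⟨φ, a, ha, h1, h2, -⟩ := P.exists_schwartz_approx (toCL2 A)
  have hre : ∀ χ : 𝓢(Space, ℂ), reL2 (χ.toLp 2) =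
      ((χ.postcompCLM Complex.reCLM : 𝓢(Space, ℝ)).toLp 2 : L2) := by
    intro χ
    apply Lp.ext
    filter_upwards [coeFn_reL2 (χ.toLp 2), χ.coeFn_toLp 2 volume,
      (χ.postcompCLM Complex.reCLM).coeFn_toLp 2 volume] with x a b c
    rw [a, b, c]; rfl
  have hlim := (reL2.continuous.tendsto _).comp ha
  rw [reL2_toCL2] at hlim
  refine mem_closure_of_tendsto hlim (.of_forall fun n =>
    ⟨(φ n).postcompCLM Complex.reCLM, ?_, fun j => ?_⟩)
  · rw [Function.comp_apply, ← reL2_cmult, h1, hre]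
  · rw [Function.comp_apply, ← reL2_cmult, h2, hre]
    congr 1
    ext x
    rw [SchwartzMap.postcompCLM_apply, SchwartzMap.lineDerivOp_apply_eq_fderiv,
      SchwartzMap.lineDerivOp_apply_eq_fderiv]
    have h3 : ((φ n).postcompCLM Complex.reCLM : Space → ℝ) = Complex.reCLM ∘ φ n := rfl
    rw [h3, (Complex.reCLM.hasFDerivAt.comp x (φ n).differentiableAt.hasFDerivAt).fderiv]
    rfl

/-- Integration by parts for a product of three functions in `H¹`. -/
theorem inner_Q_cyclic (j : Fin 3) (A B C : L2) :
    inner ℝ (P.Q A B) (mult (P.dLamInv j) C) + inner ℝ (P.Q B C) (mult (P.dLamInv j) A)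
      + inner ℝ (P.Q C A) (mult (P.dLamInv j) B) = 0 := by
  have key : ∀ A B C, P.IsSchwartzLift A → P.IsSchwartzLift B → P.IsSchwartzLift C →
      inner ℝ (P.Q A B) (mult (P.dLamInv j) C) + inner ℝ (P.Q B C) (mult (P.dLamInv j) A)
      + inner ℝ (P.Q C A) (mult (P.dLamInv j) B) = 0 := by
    rintro A B C ⟨a, ha, ha'⟩ ⟨b, hb, hb'⟩ ⟨c, hc, hc'⟩
    have hint : ∀ {A B C : L2} {a b c : 𝓢(Space, ℝ)}, mult P.lamInv A = a.toLp 2 →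
        mult P.lamInv B = b.toLp 2 → mult (P.dLamInv j) C = (∂_{e j} c).toLp 2 →
        inner ℝ (P.Q A B) (mult (P.dLamInv j) C) = ∫ x, a x * b x * (∂_{e j} c) x := by
      intro A B C a b c hA hB hC
      rw [L2.inner_def]
      apply integral_congr_ae
      have hQ := P.coeFn_Q A B
      rw [hA, hB] at hQ
      rw [hC]
      filter_upwards [hQ, a.coeFn_toLp 2 volume, b.coeFn_toLp 2 volume,
        (∂_{e j} c).coeFn_toLp 2 volume] with x h1 h2 h3 h4
      rw [h1, h2, h3, h4]
      simp [mul_comm]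
    rw [hint ha hb (hc' j), hint hb hc (ha' j), hint hc ha (hb' j)]
    set M := ContinuousLinearMap.mul ℝ ℝ
    -- Integrating by parts moves `∂ⱼ` from `c` to the product `a b`, and the Leibniz rule produces
    -- the two other cyclic terms.
    have hpar := SchwartzMap.integral_mul_lineDerivOp_right_eq_neg_left (μ := volume)
      (SchwartzMap.pairing M a b) c (e j)
    have hleib : ∀ x, (∂_{e j} (SchwartzMap.pairing M a b)) x =
        a x * (∂_{e j} b) x + b x * (∂_{e j} a) x := by
      intro x
      have h3 : (SchwartzMap.pairing M a b : Space → ℝ) = fun x => a x * b x := rfl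
      simp only [SchwartzMap.lineDerivOp_apply_eq_fderiv]
      rw [h3, fderiv_fun_mul a.differentiableAt b.differentiableAt]
      simp
    have hi : ∀ a b c : 𝓢(Space, ℝ), Integrable (fun x => a x * b x * c x) :=
      fun a b c => (SchwartzMap.pairing M (SchwartzMap.pairing M a b) c).integrable
    have e1 : ∫ x, a x * b x * (∂_{e j} c) x =
        -∫ x, (b x * c x * (∂_{e j} a) x + c x * a x * (∂_{e j} b) x) := by
      refine hpar.trans ?_
      congr 2
      ext x
      rw [hleib]; ring
    rw [e1, integral_add (hi _ _ _) (hi _ _ _)]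
    ring
  -- The expression is continuous in each argument, so the three slots are released one at a time
  -- from the dense set.
  have hd := P.dense_isSchwartzLift
  have hcl : ∀ {F : L2 → ℝ}, Continuous F → (∀ A, P.IsSchwartzLift A → F A = 0) → ∀ A, F A = 0 :=
    fun hF h A => hd.induction h (isClosed_eq hF continuous_const) A
  have hQ2 : ∀ A : L2, Continuous (fun B => P.Q B A) := fun A => by fun_prop
  refine hcl (F := fun A => inner ℝ (P.Q A B) (mult (P.dLamInv j) C) +
    inner ℝ (P.Q B C) (mult (P.dLamInv j) A) + inner ℝ (P.Q C A) (mult (P.dLamInv j) B))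
    (by fun_prop) (fun A hA => ?_) A
  refine hcl (F := fun B => inner ℝ (P.Q A B) (mult (P.dLamInv j) C) +
    inner ℝ (P.Q B C) (mult (P.dLamInv j) A) + inner ℝ (P.Q C A) (mult (P.dLamInv j) B))
    (by fun_prop) (fun B hB => ?_) B
  exact hcl (F := fun C => inner ℝ (P.Q A B) (mult (P.dLamInv j) C) +
    inner ℝ (P.Q B C) (mult (P.dLamInv j) A) + inner ℝ (P.Q C A) (mult (P.dLamInv j) B))
    (by fun_prop) (fun C hC => key A B C hA hB hC) C

end Params

/-! ### Mild solutions -/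

theorem integral_exp_mul {k : ℝ} (hk : k ≠ 0) (τ : ℝ) :
    ∫ s in (0 : ℝ)..τ, Real.exp (k * s) = (Real.exp (k * τ) - 1) / k := by
  rw [intervalIntegral.integral_comp_mul_left (fun s => Real.exp s) hk, integral_exp]
  simp [div_eq_inv_mul]

section Mild

variable {E : Type*} [NormedAddCommGroup E] [NormedSpace ℝ E]

/-- The exponential weight turns integration over any time interval into a gain `1 / k`, uniformly
in `τ`. -/
theorem norm_exp_smul_integral_le {k C : ℝ} (hk : 0 < k) (hC : 0 ≤ C) {τ : ℝ} (hτ : 0 ≤ τ)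
    {f : ℝ → E} (hf : ∀ s ∈ Ioc 0 τ, ‖f s‖ ≤ C * Real.exp (k * s)) :
    ‖Real.exp (-(k * τ)) • ∫ s in (0 : ℝ)..τ, f s‖ ≤ C / k := by
  have h1 : ‖∫ s in (0 : ℝ)..τ, f s‖ ≤ ∫ s in (0 : ℝ)..τ, C * Real.exp (k * s) :=
    intervalIntegral.norm_integral_le_of_norm_le hτ (.of_forall hf)
      (by apply Continuous.intervalIntegrable; fun_prop)
  rw [intervalIntegral.integral_const_mul, integral_exp_mul hk.ne'] at h1
  rw [norm_smul, Real.norm_of_nonneg (Real.exp_pos _).le]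
  calc _ ≤ Real.exp (-(k * τ)) * (C * ((Real.exp (k * τ) - 1) / k)) := by gcongr
    _ = C / k * (1 - Real.exp (-(k * τ))) := by
        rw [Real.exp_neg]
        field_simp
    _ ≤ C / k * 1 := by
        gcongr
        linarith [Real.exp_pos (-(k * τ))]
    _ = C / k := mul_one _

/-- Banach's fixed point theorem for Duhamel's formula, written for `V t = exp (-k t) • U t` among
bounded continuous functions. A large `k` makes the map a contraction on the whole half-line at
once, so no gluing in time is needed. The truncation `max t 0` freezes the map at negative times. -/
theorem exists_mild [CompleteSpace E] (S : ℝ → E →L[ℝ] E) (hS : ∀ t x, ‖S t x‖ ≤ ‖x‖)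
    (hSc : Continuous fun p : ℝ × E => S p.1 p.2) {G : E → E} {K : NNReal}
    (hG : LipschitzWith K G) (x₀ : E) :
    ∃ U : ℝ → E, Continuous U ∧
      ∀ t, 0 ≤ t → U t = S t x₀ + ∫ s in (0 : ℝ)..t, S (t - s) (G (U s)) := by
  -- The extra `1` keeps `k` positive when `K = 0`; `2 * K ≤ k` yields the contraction ratio `1 /
  -- 2`.
  obtain ⟨k, hk, hkK⟩ : ∃ k : ℝ, 0 < k ∧ 2 * K ≤ k := ⟨2 * K + 1, by positivity, by simp⟩
  have hGc := hG.continuous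
  have hcont : ∀ V : ℝ → E, Continuous V → Continuous fun t : ℝ => Real.exp (-(k * max t 0)) •
      (S (max t 0) x₀ + ∫ s in (0 : ℝ)..max t 0,
        S (max t 0 - s) (G (Real.exp (k * s) • V s))) := by
    intro V hV
    have h1 : Continuous fun τ : ℝ => ∫ s in (0 : ℝ)..τ, S (τ - s) (G (Real.exp (k * s) • V s)) := by
      refine intervalIntegral.continuous_parametric_intervalIntegral_of_continuous ?_ continuous_id
      refine hSc.comp (Continuous.prodMk (by fun_prop) (hGc.comp ?_))
      fun_prop
    have h2 : Continuous fun τ : ℝ => S τ x₀ := hSc.comp (continuous_id.prodMk continuous_const)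
    have h3 : Continuous fun t : ℝ => max t 0 := by fun_prop
    exact (by fun_prop : Continuous fun t : ℝ => Real.exp (-(k * max t 0))).smul
      ((h2.comp h3).add (h1.comp h3))
  have hGb : ∀ x, ‖G x‖ ≤ ‖G 0‖ + K * ‖x‖ := by
    intro x
    have := hG.dist_le_mul x 0
    rw [dist_eq_norm, dist_zero_right] at this
    linarith [norm_le_norm_add_norm_sub' (G x) (G 0)]
  have hbdd : ∀ V : BoundedContinuousFunction ℝ E, ∀ t : ℝ, ‖Real.exp (-(k * max t 0)) •
      (S (max t 0) x₀ + ∫ s in (0 : ℝ)..max t 0,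
        S (max t 0 - s) (G (Real.exp (k * s) • V s)))‖ ≤ ‖x₀‖ + (‖G 0‖ + K * ‖V‖) / k := by
    intro V t
    have hτ : 0 ≤ max t 0 := le_max_right _ _
    rw [smul_add]
    refine norm_add_le_of_le ?_ (norm_exp_smul_integral_le hk (by positivity) hτ fun s hs => ?_)
    · rw [norm_smul, Real.norm_of_nonneg (Real.exp_pos _).le]
      refine (mul_le_of_le_one_left (norm_nonneg _) ?_).trans (hS _ _)
      rw [Real.exp_le_one_iff, neg_nonpos]
      positivity
    · refine (hS _ _).trans ((hGb _).trans ?_)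
      rw [norm_smul, Real.norm_of_nonneg (Real.exp_pos _).le, add_mul]
      have h1 : 1 ≤ Real.exp (k * s) := Real.one_le_exp (mul_nonneg hk.le hs.1.le)
      have h2 := V.norm_coe_le_norm s
      have h3 : ‖G 0‖ ≤ ‖G 0‖ * Real.exp (k * s) := le_mul_of_one_le_right (norm_nonneg _) h1
      have h4 : (K : ℝ) * (Real.exp (k * s) * ‖V s‖) ≤ K * ‖V‖ * Real.exp (k * s) := by
        rw [mul_assoc, mul_comm ‖V‖]; gcongr
      linarith
  let Φ : BoundedContinuousFunction ℝ E → BoundedContinuousFunction ℝ E := fun V =>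
    BoundedContinuousFunction.ofNormedAddCommGroup _ (hcont V V.continuous) _ (hbdd V)
  have hΦ : ∀ V t, Φ V t = Real.exp (-(k * max t 0)) • (S (max t 0) x₀ +
      ∫ s in (0 : ℝ)..max t 0, S (max t 0 - s) (G (Real.exp (k * s) • V s))) := fun _ _ => rfl
  have hint : ∀ (V : BoundedContinuousFunction ℝ E) (τ : ℝ), IntervalIntegrable
      (fun s => S (τ - s) (G (Real.exp (k * s) • V s))) volume 0 τ := by
    intro V τ
    apply Continuous.intervalIntegrable
    have hV := V.continuous
    exact hSc.comp (Continuous.prodMk (by fun_prop) (hGc.comp (by fun_prop)))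
  have hcontr : ContractingWith (1 / 2) Φ := by
    refine ⟨by rw [← NNReal.coe_lt_coe]; norm_num, LipschitzWith.of_dist_le_mul fun V W => ?_⟩
    rw [BoundedContinuousFunction.dist_le (by positivity)]
    intro t
    rw [dist_eq_norm, hΦ, hΦ, ← smul_sub, add_sub_add_left_eq_sub,
      ← intervalIntegral.integral_sub (hint _ _) (hint _ _)]
    have hτ : 0 ≤ max t 0 := le_max_right _ _
    refine (norm_exp_smul_integral_le (C := K * dist V W) hk (by positivity) hτ
      fun s _ => ?_).trans ?_
    · rw [← map_sub]
      refine (hS _ _).trans ?_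
      rw [← dist_eq_norm]
      refine (hG.dist_le_mul _ _).trans ?_
      rw [dist_smul₀, Real.norm_of_nonneg (Real.exp_pos _).le, mul_assoc, mul_comm (dist V W)]
      gcongr
      exact BoundedContinuousFunction.dist_coe_le_dist s
    · rw [div_le_iff₀ hk]
      have := dist_nonneg (x := V) (y := W)
      have hK : (0 : ℝ) ≤ K := K.2
      simp only [NNReal.coe_div, NNReal.coe_one, NNReal.coe_ofNat]
      nlinarith
  obtain ⟨V, hV⟩ : ∃ V, Φ V = V := ⟨_, hcontr.fixedPoint_isFixedPt⟩
  have hVc := V.continuous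
  refine ⟨fun t => Real.exp (k * t) • V t, by fun_prop, fun t ht => ?_⟩
  have h1 : V t = Φ V t := by rw [hV]
  rw [hΦ, max_eq_left ht] at h1
  beta_reduce
  conv_lhs => rw [h1, smul_smul, ← Real.exp_add, add_neg_cancel, Real.exp_zero, one_smul]

/-- Fubini's theorem on a triangle. -/
theorem integral_triangle_swap {f : ℝ → ℝ → E}
    (hf : StronglyMeasurable (Function.uncurry f)) {t C : ℝ} (ht : 0 ≤ t)
    (hC : ∀ s r, 0 < r → r ≤ s → s ≤ t → ‖f s r‖ ≤ C) :
    IntervalIntegrable (fun s => ∫ r in (0 : ℝ)..s, f s r) volume 0 t ∧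
    ∫ s in (0 : ℝ)..t, ∫ r in (0 : ℝ)..s, f s r = ∫ r in (0 : ℝ)..t, ∫ s in r..t, f s r := by
  set T : Set (ℝ × ℝ) := {p | p.2 ≤ p.1}
  have hT : MeasurableSet T := measurableSet_le measurable_snd measurable_fst
  set h : ℝ × ℝ → E := T.indicator (Function.uncurry f)
  set μ : Measure ℝ := volume.restrict (Ioc 0 t)
  have hint : Integrable h (μ.prod μ) := by
    refine Integrable.of_bound (C := max C 0) (hf.indicator hT).aestronglyMeasurable ?_
    rw [Measure.prod_restrict]
    filter_upwards [ae_restrict_mem (measurableSet_Ioc.prod measurableSet_Ioc)] with p hp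
    by_cases hpT : p ∈ T
    · simp only [h, indicator_of_mem hpT]
      exact (hC _ _ hp.2.1 hpT hp.1.2).trans (le_max_left _ _)
    · simp only [h, indicator_of_notMem hpT, norm_zero]
      exact le_max_right _ _
  have h1 : ∀ s ∈ Ioc 0 t, ∫ r, h (s, r) ∂μ = ∫ r in (0 : ℝ)..s, f s r := by
    intro s hs
    have e1 : (fun r => h (s, r)) = (Iic s).indicator (f s) := by
      ext r; simp only [h, T, indicator, mem_ofPred_eq, mem_Iic, Function.uncurry]
    rw [e1, setIntegral_indicator measurableSet_Iic, intervalIntegral.integral_of_le hs.1.le]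
    congr 2
    ext r; simp only [mem_inter_iff, mem_Ioc, mem_Iic]
    exact ⟨fun h => ⟨h.1.1, h.2⟩, fun h => ⟨⟨h.1, h.2.trans hs.2⟩, h.2⟩⟩
  have h2 : ∀ r ∈ Ioc 0 t, ∫ s, h (s, r) ∂μ = ∫ s in r..t, f s r := by
    intro r hr
    have e1 : (fun s => h (s, r)) = (Ici r).indicator (fun s => f s r) := by
      ext s; simp only [h, T, indicator, mem_ofPred_eq, mem_Ici, Function.uncurry]
    rw [e1, setIntegral_indicator measurableSet_Ici, intervalIntegral.integral_of_le hr.2,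
      ← integral_Icc_eq_integral_Ioc]
    congr 2
    ext s; simp only [mem_inter_iff, mem_Ioc, mem_Ici, mem_Icc]
    exact ⟨fun h => ⟨h.2, h.1.2⟩, fun h => ⟨⟨hr.1.trans_le h.1, h.2⟩, h.1⟩⟩
  constructor
  · rw [intervalIntegrable_iff_integrableOn_Ioc_of_le ht]
    refine hint.integral_prod_left.congr ?_
    filter_upwards [ae_restrict_mem measurableSet_Ioc] with s hs using h1 s hs
  · rw [intervalIntegral.integral_of_le ht, intervalIntegral.integral_of_le ht,
      ← setIntegral_congr_fun measurableSet_Ioc h1, ← setIntegral_congr_fun measurableSet_Ioc h2]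
    exact integral_integral_swap hint

end Mild

namespace Params

variable (P : Params)

/-! ### The semigroup and its resolvent -/

theorem norm_sgp_le (t : ℝ) (ξ : Space) : ‖P.sgp t ξ‖ ≤ 1 := by
  rw [sgp_apply, Complex.norm_real, Real.norm_of_nonneg (Real.exp_pos _).le, Real.exp_le_one_iff,
    neg_mul, neg_nonpos]
  exact mul_nonneg (le_max_right _ _) (P.gen_pos ξ).le

theorem norm_res_le (ξ : Space) : ‖P.res ξ‖ ≤ 1 := by
  have := P.gen_pos ξ
  rw [res_apply, Complex.norm_real, Real.norm_of_nonneg (by positivity)]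
  exact inv_le_one_of_one_le₀ (by linarith)

theorem norm_resN_le (n : ℕ) (ξ : Space) : ‖P.resN n ξ‖ ≤ 1 := by
  have := P.gen_pos ξ
  rw [resN_apply, Complex.norm_real, Real.norm_of_nonneg (by positivity)]
  exact inv_le_one_of_one_le₀ (le_add_of_nonneg_right (by positivity))

theorem norm_sgp_apply_le (t : ℝ) (g : L2) : ‖mult (P.sgp t) g‖ ≤ ‖g‖ := by
  simpa using norm_mult_apply_le (P.sgp t) (P.norm_sgp_le t) g

theorem norm_resN_apply_le (n : ℕ) (g : L2) : ‖mult (P.resN n) g‖ ≤ ‖g‖ := by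
  simpa using norm_mult_apply_le (P.resN n) (P.norm_resN_le n) g

theorem sgp_zero : P.sgp 0 = 1 := by
  ext ξ; simp

theorem res_injective : Function.Injective (mult P.res) := by
  refine mult_injective (.of_forall fun ξ => ?_)
  have := P.gen_pos ξ
  rw [res_apply, Complex.ofReal_ne_zero]
  positivity

theorem continuous_sgp_apply (g : L2) : Continuous fun t => mult (P.sgp t) g := by
  rw [continuous_iff_continuousAt]
  intro t
  refine tendsto_mult (C := 1) (fun i => P.norm_sgp_le i) (fun ξ => ?_) g
  have : Continuous fun t => P.sgp t ξ := by
    simp only [sgp_apply]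
    fun_prop
  exact this.tendsto t

theorem continuous_sgp : Continuous fun p : ℝ × L2 => mult (P.sgp p.1) p.2 := by
  rw [continuous_iff_continuousAt]
  rintro ⟨t, g⟩
  rw [ContinuousAt, tendsto_iff_norm_sub_tendsto_zero]
  have h1 : Tendsto (fun p : ℝ × L2 => ‖p.2 - g‖ + ‖mult (P.sgp p.1) g - mult (P.sgp t) g‖)
      (nhds (t, g)) (nhds 0) := by
    have hc : Continuous fun p : ℝ × L2 =>
        ‖p.2 - g‖ + ‖mult (P.sgp p.1) g - mult (P.sgp t) g‖ := by
      have := (P.continuous_sgp_apply g).comp (continuous_fst (X := ℝ) (Y := L2))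
      simp only [Function.comp_def] at this
      fun_prop
    simpa using hc.tendsto (t, g)
  refine squeeze_zero (fun _ => norm_nonneg _) (fun p => ?_) h1
  calc ‖mult (P.sgp p.1) p.2 - mult (P.sgp t) g‖
      = ‖mult (P.sgp p.1) (p.2 - g) + (mult (P.sgp p.1) g - mult (P.sgp t) g)‖ := by
        rw [map_sub]; abel_nf
    _ ≤ _ := norm_add_le_of_le (P.norm_sgp_apply_le _ _) le_rfl

/-- The formal derivative `-A (1 + A)⁻¹ exp (-tA)` has bounded symbol because `A (1 + A)⁻¹ = 1 - (1
+ A)⁻¹`. The symbols of the difference quotients are bounded by one, so `tendsto_mult` applies. -/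
theorem hasDerivAt_res_sgp {t : ℝ} (ht : 0 < t) (g : L2) :
    HasDerivAt (fun t => mult (P.res * P.sgp t) g) (-(mult (1 - P.res) (mult (P.sgp t) g))) t := by
  have hpt : ∀ (x y : ℝ) (ξ : Space), ‖(P.res * (P.sgp y - P.sgp x)) ξ‖ ≤ |y - x| := by
    intro x y ξ
    have ha := P.gen_pos ξ
    have h1 : |Real.exp (-(max y 0) * P.gen ξ) - Real.exp (-(max x 0) * P.gen ξ)| ≤
        |y - x| * P.gen ξ := by
      have key : ∀ u v : ℝ, 0 ≤ u → u ≤ v →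
          |Real.exp (-u * P.gen ξ) - Real.exp (-v * P.gen ξ)| ≤ (v - u) * P.gen ξ := by
        intro u v hu huv
        have e1 : Real.exp (-v * P.gen ξ) =
            Real.exp (-u * P.gen ξ) * Real.exp (-((v - u) * P.gen ξ)) := by
          rw [← Real.exp_add]; ring_nf
        have e2 := Real.add_one_le_exp (-((v - u) * P.gen ξ))
        have e3 : Real.exp (-u * P.gen ξ) ≤ 1 := by
          rw [Real.exp_le_one_iff, neg_mul, neg_nonpos]; positivity
        have e4 : 0 ≤ (v - u) * P.gen ξ := mul_nonneg (by linarith) ha.le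
        have e5 : Real.exp (-((v - u) * P.gen ξ)) ≤ 1 := by
          rw [Real.exp_le_one_iff]; linarith
        have e6 := Real.exp_pos (-u * P.gen ξ)
        rw [e1, ← mul_one_sub, abs_of_nonneg (mul_nonneg e6.le (by linarith))]
        nlinarith
      have hm : |max y 0 - max x 0| ≤ |y - x| := by
        simpa using abs_max_sub_max_le_abs y x 0
      refine le_trans ?_ (mul_le_mul_of_nonneg_right hm ha.le)
      rcases le_total (max y 0) (max x 0) with h | h
      · rw [abs_sub_comm (max y 0), abs_of_nonneg (sub_nonneg.mpr h)]
        exact key _ _ (le_max_right _ _) h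
      · rw [abs_sub_comm, abs_of_nonneg (sub_nonneg.mpr h)]
        exact key _ _ (le_max_right _ _) h
    rw [Symbol.mul_apply, Symbol.sub_apply, res_apply, sgp_apply, sgp_apply, ← Complex.ofReal_sub,
      ← Complex.ofReal_mul, Complex.norm_real, Real.norm_eq_abs, abs_mul,
      abs_of_pos (by positivity : 0 < (1 + P.gen ξ)⁻¹), inv_mul_le_iff₀ (by positivity)]
    refine h1.trans ?_
    have := abs_nonneg (y - x)
    nlinarith
  rw [hasDerivAt_iff_tendsto_slope, ← mult_mul_apply, ← mult_neg_apply]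
  have hs : slope (fun t => mult (P.res * P.sgp t) g) t =
      fun y => mult ((y - t)⁻¹ • (P.res * (P.sgp y - P.sgp t))) g := by
    ext1 y
    rw [slope_def_module, mult_smul_apply, mul_sub, mult_sub_apply]
  rw [hs]
  refine tendsto_mult (C := 1) (fun y ξ => ?_) (fun ξ => ?_) g
  · rw [Symbol.smul_apply, norm_mul, Complex.norm_real, norm_inv, Real.norm_eq_abs]
    rcases eq_or_ne y t with rfl | hy
    · simp
    · rw [inv_mul_le_iff₀ (abs_pos.mpr (sub_ne_zero.mpr hy)), mul_one]
      exact hpt t y ξ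
  · have ha := P.gen_pos ξ
    have h1 : HasDerivAt (fun y : ℝ => (1 + P.gen ξ)⁻¹ * Real.exp (-y * P.gen ξ))
        ((1 + P.gen ξ)⁻¹ * (Real.exp (-t * P.gen ξ) * (-1 * P.gen ξ))) t :=
      (((hasDerivAt_id t).neg.mul_const (P.gen ξ)).exp).const_mul _
    have h2 : HasDerivAt (fun y : ℝ => (P.res * P.sgp y) ξ)
        (((1 + P.gen ξ)⁻¹ * (Real.exp (-t * P.gen ξ) * (-1 * P.gen ξ)) : ℝ) : ℂ) t := by
      refine h1.ofReal_comp.congr_of_eventuallyEq ?_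
      filter_upwards [lt_mem_nhds ht] with y hy
      rw [Symbol.mul_apply, res_apply, sgp_apply, max_eq_left hy.le]
      push_cast; rfl
    rw [hasDerivAt_iff_tendsto_slope] at h2
    have h3 : (-((1 - P.res) * P.sgp t)) ξ =
        (((1 + P.gen ξ)⁻¹ * (Real.exp (-t * P.gen ξ) * (-1 * P.gen ξ)) : ℝ) : ℂ) := by
      rw [Symbol.neg_apply, Symbol.mul_apply, Symbol.sub_apply, Symbol.one_apply, res_apply,
        sgp_apply, max_eq_left ht.le]
      have : (1 + P.gen ξ)⁻¹ * P.gen ξ = 1 - (1 + P.gen ξ)⁻¹ := by field_simp; ring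
      rw [← Complex.ofReal_one, ← Complex.ofReal_sub, ← Complex.ofReal_mul, ← Complex.ofReal_neg,
        ← this]
      congr 1; ring
    rw [h3]
    refine h2.congr fun y => ?_
    rw [slope_def_module, Symbol.smul_apply, mul_sub, Symbol.sub_apply, ← Complex.real_smul]

theorem integral_one_sub_res_sgp {t : ℝ} (ht : 0 ≤ t) (g : L2) :
    ∫ s in (0 : ℝ)..t, mult (1 - P.res) (mult (P.sgp s) g) =
      mult P.res g - mult P.res (mult (P.sgp t) g) := by
  have hc := P.continuous_sgp_apply g
  have h := intervalIntegral.integral_eq_sub_of_hasDerivAt_of_le ht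
    (f := fun t => mult (P.res * P.sgp t) g) (f' := fun t => -(mult (1 - P.res) (mult (P.sgp t) g)))
    (by simp only [mult_mul_apply]; exact ((mult P.res).continuous.comp hc).continuousOn)
    (fun x hx => P.hasDerivAt_res_sgp hx.1 g)
    (((mult (1 - P.res)).continuous.comp hc).neg.intervalIntegrable _ _)
  rw [intervalIntegral.integral_neg, neg_eq_iff_eq_neg] at h
  rw [h, sgp_zero, mul_one, mult_mul_apply, neg_sub]

/-! ### Duhamel's formula and its resolvent form. -/

/-- The mild solution of `x' + A x = g`, `x(0) = x₀`. -/
def mild (x₀ : L2) (g : ℝ → L2) (t : ℝ) : L2 :=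
  mult (P.sgp t) x₀ + ∫ s in (0 : ℝ)..t, mult (P.sgp (t - s)) (g s)

theorem intervalIntegrable_sgp {g : ℝ → L2} (hg : StronglyMeasurable g) {t C : ℝ} (ht : 0 ≤ t)
    (hC : ∀ s ∈ Icc 0 t, ‖g s‖ ≤ C) :
    IntervalIntegrable (fun s => mult (P.sgp (t - s)) (g s)) volume 0 t := by
  rw [intervalIntegrable_iff_integrableOn_Ioc_of_le ht]
  refine Integrable.of_bound (C := C) (P.continuous_sgp.comp_stronglyMeasurable
    (f := fun s => (t - s, g s)) ((stronglyMeasurable_const.sub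
      stronglyMeasurable_id).prodMk hg)).aestronglyMeasurable ?_
  filter_upwards [ae_restrict_mem measurableSet_Ioc] with s hs
  exact (P.norm_sgp_apply_le _ _).trans (hC s ⟨hs.1.le, hs.2⟩)

theorem intervalIntegrable_of_bound {g : ℝ → L2} (hg : StronglyMeasurable g) {t C : ℝ} (ht : 0 ≤ t)
    (hC : ∀ s ∈ Icc 0 t, ‖g s‖ ≤ C) : IntervalIntegrable g volume 0 t := by
  rw [intervalIntegrable_iff_integrableOn_Ioc_of_le ht]
  refine Integrable.of_bound (C := C) hg.aestronglyMeasurable ?_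
  filter_upwards [ae_restrict_mem measurableSet_Ioc] with s hs
  exact hC s ⟨hs.1.le, hs.2⟩

/-- Duhamel's formula is never differentiated: the bounded operator `A (1 + A)⁻¹` is integrated
along it in time, and Fubini on the triangle `r ≤ s` reduces everything to
`integral_one_sub_res_sgp`. A bounded measurable `g` is allowed, as uniqueness requires. -/
theorem mild_res {x₀ : L2} {g : ℝ → L2} (hg : StronglyMeasurable g) {t C : ℝ} (ht : 0 ≤ t)
    (hC : ∀ s ∈ Icc 0 t, ‖g s‖ ≤ C) :
    IntervalIntegrable (P.mild x₀ g) volume 0 t ∧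
    mult P.res (P.mild x₀ g t) = mult P.res x₀ +
      ∫ s in (0 : ℝ)..t, (mult P.res (P.mild x₀ g s) - P.mild x₀ g s + mult P.res (g s)) := by
  have hmeas : StronglyMeasurable (Function.uncurry fun s r => mult (P.sgp (s - r)) (g r)) :=
    P.continuous_sgp.comp_stronglyMeasurable (f := fun p : ℝ × ℝ => (p.1 - p.2, g p.2))
      ((measurable_fst.sub measurable_snd).stronglyMeasurable.prodMk
        (hg.comp_measurable measurable_snd))
  have hbd : ∀ s r, 0 < r → r ≤ s → s ≤ t → ‖mult (P.sgp (s - r)) (g r)‖ ≤ C :=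
    fun s r h0 hr hs => (P.norm_sgp_apply_le _ _).trans (hC r ⟨h0.le, hr.trans hs⟩)
  obtain ⟨hi, hsw⟩ := integral_triangle_swap hmeas ht hbd
  have hlin : IntervalIntegrable (fun s => mult (P.sgp s) x₀) volume 0 t :=
    (P.continuous_sgp_apply x₀).intervalIntegrable _ _
  have hW : IntervalIntegrable (P.mild x₀ g) volume 0 t := hlin.add hi
  have hgi := intervalIntegrable_of_bound hg ht hC
  refine ⟨hW, ?_⟩
  have hcomp : ∀ (L : L2 →L[ℝ] L2) {f : ℝ → L2}, IntervalIntegrable f volume 0 t →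
      IntervalIntegrable (fun s => L (f s)) volume 0 t := fun L f hf =>
    ⟨L.integrable_comp hf.1, L.integrable_comp hf.2⟩
  have h1 : ∫ s in (0 : ℝ)..t, (mult P.res (P.mild x₀ g s) - P.mild x₀ g s + mult P.res (g s)) =
      -(∫ s in (0 : ℝ)..t, mult (1 - P.res) (P.mild x₀ g s))
        + ∫ s in (0 : ℝ)..t, mult P.res (g s) := by
    rw [← intervalIntegral.integral_neg]
    refine Eq.trans ?_ (intervalIntegral.integral_add
      (hcomp (mult (1 - P.res)) hW).neg (hcomp (mult P.res) hgi))
    congr 1; ext1 s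
    rw [mult_sub_apply, mult_one_apply, neg_sub]
  have h2 : ∫ s in (0 : ℝ)..t, mult (1 - P.res) (P.mild x₀ g s) =
      (mult P.res x₀ - mult P.res (mult (P.sgp t) x₀)) +
      ∫ r in (0 : ℝ)..t, (mult P.res (g r) - mult P.res (mult (P.sgp (t - r)) (g r))) := by
    rw [ContinuousLinearMap.intervalIntegral_comp_comm _ hW]
    have e1 : ∫ s in (0 : ℝ)..t, P.mild x₀ g s = (∫ s in (0 : ℝ)..t, mult (P.sgp s) x₀) +
        ∫ s in (0 : ℝ)..t, ∫ r in (0 : ℝ)..s, mult (P.sgp (s - r)) (g r) :=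
      intervalIntegral.integral_add hlin hi
    rw [e1, map_add, ← ContinuousLinearMap.intervalIntegral_comp_comm _ hlin,
      P.integral_one_sub_res_sgp ht, hsw]
    congr 1
    have e2 : ∀ r ∈ uIcc 0 t, ∫ s in r..t, mult (P.sgp (s - r)) (g r) =
        ∫ s in (0 : ℝ)..(t - r), mult (P.sgp s) (g r) := by
      intro r _
      rw [intervalIntegral.integral_comp_sub_right (fun s => mult (P.sgp s) (g r)) r, sub_self]
    rw [intervalIntegral.integral_congr e2]
    have hii : IntervalIntegrable (fun r => ∫ s in (0 : ℝ)..(t - r), mult (P.sgp s) (g r))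
        volume 0 t := by
      rw [intervalIntegrable_iff_integrableOn_Ioc_of_le ht]
      have hc : Continuous fun p : ℝ × L2 => ∫ s in (0 : ℝ)..(t - p.1), mult (P.sgp s) p.2 := by
        refine intervalIntegral.continuous_parametric_intervalIntegral_of_continuous
          (f := fun (p : ℝ × L2) s => mult (P.sgp s) p.2) ?_ (by fun_prop)
        exact P.continuous_sgp.comp (f := fun q : (ℝ × L2) × ℝ => (q.2, q.1.2)) (by fun_prop)
      refine Integrable.of_bound (C := C * |t|) (hc.comp_stronglyMeasurable (f := fun r => (r, g r))
        (stronglyMeasurable_id.prodMk hg)).aestronglyMeasurable ?_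
      filter_upwards [ae_restrict_mem measurableSet_Ioc] with r hr
      have hCr := hC r ⟨hr.1.le, hr.2⟩
      refine (intervalIntegral.norm_integral_le_of_norm_le_const
        (C := C) fun s _ => (P.norm_sgp_apply_le _ _).trans hCr).trans ?_
      refine mul_le_mul_of_nonneg_left ?_ ((norm_nonneg _).trans hCr)
      rw [sub_zero, abs_of_nonneg (by linarith [hr.2]), abs_of_nonneg ht]
      linarith [hr.1]
    rw [← ContinuousLinearMap.intervalIntegral_comp_comm _ hii]
    refine intervalIntegral.integral_congr fun r hr => ?_
    rw [uIcc_of_le ht] at hr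
    beta_reduce
    rw [← ContinuousLinearMap.intervalIntegral_comp_comm _
      ((P.continuous_sgp_apply _).intervalIntegrable _ _),
      P.integral_one_sub_res_sgp (sub_nonneg.mpr hr.2)]
  rw [h1, h2, intervalIntegral.integral_sub (hcomp _ hgi)
    (hcomp _ (P.intervalIntegrable_sgp hg ht hC)), ContinuousLinearMap.intervalIntegral_comp_comm _
    (P.intervalIntegrable_sgp hg ht hC), mild, map_add]
  abel

end Params

/-! ### Linear uniqueness and the energy equality -/

theorem integrable_inner_fourier (g h : L2) :
    Integrable (fun ξ : Space => (inner ℝ (fourierL2 g ξ) (fourierL2 h ξ) : ℝ)) :=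
  L2.integrable_inner (𝕜 := ℝ) (fourierL2 g) (fourierL2 h)

theorem inner_mult_mult_eq {m n : Symbol} {k : Space → ℝ}
    (hk : ∀ ξ, starRingEnd ℂ (m ξ) * n ξ = (k ξ : ℂ)) (g : L2) :
    inner ℝ (mult m g) (mult n g) = ∫ ξ : Space, k ξ * ‖fourierL2 g ξ‖ ^ 2 := by
  rw [inner_eq_fourier]
  apply integral_congr_ae
  filter_upwards [fourierL2_mult m g, fourierL2_mult n g] with ξ a b
  rw [a, b, Complex.inner, map_mul]
  have : n ξ * fourierL2 g ξ * (starRingEnd ℂ (m ξ) * starRingEnd ℂ (fourierL2 g ξ)) =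
      (starRingEnd ℂ (m ξ) * n ξ) * (starRingEnd ℂ (fourierL2 g ξ) * fourierL2 g ξ) := by ring
  rw [this, hk, Complex.conj_mul']
  norm_cast

theorem ofReal_inner_mult_mult {m n : Symbol} {k : Space → ℝ} (hk0 : ∀ ξ, 0 ≤ k ξ)
    (hk : ∀ ξ, starRingEnd ℂ (m ξ) * n ξ = (k ξ : ℂ)) (g : L2) :
    ENNReal.ofReal (inner ℝ (mult m g) (mult n g)) =
      ∫⁻ ξ : Space, ENNReal.ofReal (k ξ) * ‖fourierL2 g ξ‖ₑ ^ 2 := by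
  have hint : Integrable fun ξ : Space => k ξ * ‖fourierL2 g ξ‖ ^ 2 := by
    refine (integrable_inner_fourier (mult m g) (mult n g)).congr ?_
    filter_upwards [fourierL2_mult m g, fourierL2_mult n g] with ξ a b
    rw [a, b, Complex.inner, map_mul]
    have : n ξ * fourierL2 g ξ * (starRingEnd ℂ (m ξ) * starRingEnd ℂ (fourierL2 g ξ)) =
        (starRingEnd ℂ (m ξ) * n ξ) * (starRingEnd ℂ (fourierL2 g ξ) * fourierL2 g ξ) := by ring
    rw [this, hk, Complex.conj_mul']
    norm_cast
  rw [inner_mult_mult_eq hk, ofReal_integral_eq_lintegral_ofReal hint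
    (.of_forall fun ξ => mul_nonneg (hk0 ξ) (sq_nonneg _))]
  congr 1; ext ξ
  rw [ENNReal.ofReal_mul (hk0 ξ), ENNReal.ofReal_pow (norm_nonneg _), ofReal_norm]

theorem inner_mult_mult_nonneg {m n : Symbol} {k : Space → ℝ} (hk0 : ∀ ξ, 0 ≤ k ξ)
    (hk : ∀ ξ, starRingEnd ℂ (m ξ) * n ξ = (k ξ : ℂ)) (g : L2) :
    0 ≤ inner ℝ (mult m g) (mult n g) := by
  rw [inner_mult_mult_eq hk]
  exact integral_nonneg fun ξ => mul_nonneg (hk0 ξ) (sq_nonneg _)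

theorem hasDerivAt_of_integral_eq {E : Type*} [NormedAddCommGroup E] [NormedSpace ℝ E]
    [CompleteSpace E] {F f : ℝ → E} {x₀ : E} {T : ℝ}
    (h : ∀ t ∈ Ioo 0 T, F t = x₀ + ∫ s in (0 : ℝ)..t, f s) (hf : Continuous f) {t : ℝ}
    (ht : t ∈ Ioo 0 T) : HasDerivAt F (f t) t := by
  have h1 := (intervalIntegral.integral_hasDerivAt_right (hf.intervalIntegrable 0 t)
    (hf.stronglyMeasurableAtFilter _ _) hf.continuousAt).const_add x₀
  refine h1.congr_of_eventuallyEq ?_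
  filter_upwards [Ioo_mem_nhds ht.1 ht.2] with s hs using h s hs

namespace Params

variable (P : Params)

/-- Dissipativity of `-A`: with `a = gen ξ`, the Fourier density is `-(1 + a)⁻¹ (1 - (1 + a)⁻¹)
|ĝ|²`. -/
theorem inner_res_le (g : L2) :
    inner ℝ (mult P.res g) (mult P.res g - g) ≤ 0 := by
  have h : mult P.res g - g = -(mult (1 - P.res) g) := by
    rw [mult_sub_apply, mult_one_apply, neg_sub]
  rw [h, inner_neg_right, neg_nonpos]
  refine inner_mult_mult_nonneg (k := fun ξ => (1 + P.gen ξ)⁻¹ * (1 - (1 + P.gen ξ)⁻¹))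
    (fun ξ => ?_) (fun ξ => ?_) g
  · have := P.gen_pos ξ
    have h2 : (1 + P.gen ξ)⁻¹ ≤ 1 := inv_le_one_of_one_le₀ (by linarith)
    exact mul_nonneg (by positivity) (by linarith)
  · rw [Symbol.sub_apply, Symbol.one_apply, res_apply, Complex.conj_ofReal]
    push_cast; ring

/-- Linear uniqueness for a merely integrable `D`. One application of the resolvent gives a
continuous representative `Z` of `(1 + A)⁻¹ D`. A second gives a differentiable `Y = (1 + A)⁻¹ Z`
with `Y' = Y - Z`, so `‖Y‖²` cannot increase from its initial value `0`. -/
theorem ae_eq_zero_of_res {D : ℝ → L2} {T : ℝ} (hT : 0 < T) (hD : IntervalIntegrable D volume 0 T)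
    (h : ∀ᵐ t ∂volume.restrict (Ioc 0 T),
      mult P.res (D t) = ∫ s in (0 : ℝ)..t, (mult P.res (D s) - D s)) :
    ∀ᵐ t ∂volume.restrict (Ioc 0 T), D t = 0 := by
  have hJD : IntervalIntegrable (fun s => mult P.res (D s) - D s) volume 0 T :=
    IntervalIntegrable.sub ⟨(mult P.res).integrable_comp hD.1, (mult P.res).integrable_comp hD.2⟩ hD
  set Z₀ : ℝ → L2 := fun t => ∫ s in (0 : ℝ)..t, (mult P.res (D s) - D s)
  have hZ₀ : ContinuousOn Z₀ (Icc 0 T) := by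
    have := intervalIntegral.continuousOn_primitive_interval' hJD left_mem_uIcc
    rwa [uIcc_of_le hT.le] at this
  -- Projecting the time onto `[0, T]` extends `Z₀` to a function continuous on the whole line.
  set Z : ℝ → L2 := fun t => Z₀ (projIcc 0 T hT.le t)
  have hZ : Continuous Z :=
    (continuousOn_iff_continuous_domRestrict.mp hZ₀).comp continuous_projIcc
  have hZe : ∀ t ∈ Icc 0 T, Z t = Z₀ t := fun t ht => by
    simp only [Z, projIcc_of_mem hT.le ht]
  have hY : ∀ t ∈ Icc 0 T, mult P.res (Z t) = ∫ s in (0 : ℝ)..t, (mult P.res (Z s) - Z s) := by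
    intro t ht
    have hsub : IntervalIntegrable (fun s => mult P.res (D s) - D s) volume 0 t :=
      hJD.mono_set (by rw [uIcc_of_le ht.1, uIcc_of_le hT.le]; exact Icc_subset_Icc_right ht.2)
    rw [hZe t ht, ← ContinuousLinearMap.intervalIntegral_comp_comm _ hsub]
    rw [intervalIntegral.integral_of_le ht.1, intervalIntegral.integral_of_le ht.1]
    apply integral_congr_ae
    filter_upwards [ae_restrict_of_ae_restrict_of_subset (Ioc_subset_Ioc_right ht.2) h,
      ae_restrict_mem measurableSet_Ioc] with s hs hs2
    rw [map_sub, hs, hZe s ⟨hs2.1.le, hs2.2.trans ht.2⟩]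
  have hd : ∀ t ∈ Ioo 0 T, HasDerivAt (fun t => mult P.res (Z t)) (mult P.res (Z t) - Z t) t := by
    intro t ht
    refine hasDerivAt_of_integral_eq (x₀ := (0 : L2)) (T := T)
      (f := fun s => mult P.res (Z s) - Z s) (fun s hs => ?_) (by fun_prop) ht
    rw [zero_add]
    exact hY s ⟨hs.1.le, hs.2.le⟩
  have hanti : AntitoneOn (fun t : ℝ => (‖mult P.res (Z t)‖ ^ 2 : ℝ)) (Icc 0 T) := by
    refine antitoneOn_of_deriv_nonpos (convex_Icc 0 T) (by fun_prop) ?_ ?_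
    · rw [interior_Icc]
      exact fun t ht => (hd t ht).norm_sq.differentiableAt.differentiableWithinAt
    · rw [interior_Icc]
      intro t ht
      rw [(hd t ht).norm_sq.deriv]
      linarith [P.inner_res_le (Z t)]
  have hZ0 : ∀ t ∈ Icc 0 T, Z t = 0 := by
    intro t ht
    have h0 : mult P.res (Z 0) = 0 := by
      rw [hY 0 (left_mem_Icc.mpr hT.le), intervalIntegral.integral_same]
    have h1 := hanti (left_mem_Icc.mpr hT.le) ht ht.1
    simp only [h0, norm_zero] at h1
    have h2 : mult P.res (Z t) = 0 := by
      rw [← norm_eq_zero]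
      have := norm_nonneg (mult P.res (Z t))
      nlinarith
    exact P.res_injective (by rw [h2, map_zero])
  filter_upwards [h, ae_restrict_mem measurableSet_Ioc] with t ht ht2
  have h3 := hZ0 t ⟨ht2.1.le, ht2.2⟩
  rw [hZe t ⟨ht2.1.le, ht2.2⟩] at h3
  exact P.res_injective (by rw [ht, map_zero]; exact h3)

/-! ### Regularisation by resolvents and the energy equality. -/

/-- The bounded approximations `A (1 + A / (n + 1))⁻¹` of `A`. -/
def genN (n : ℕ) : Symbol :=
  Symbol.ofEven (fun ξ => P.gen ξ * (1 + P.gen ξ / (n + 1))⁻¹)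
    (P.continuous_gen.measurable.mul ((P.continuous_gen.measurable.div_const _).const_add 1).inv)
    ⟨n + 1, fun ξ => by
      have := P.gen_pos ξ
      rw [abs_of_pos (by positivity), ← div_eq_mul_inv, div_le_iff₀ (by positivity)]
      field_simp
      linarith⟩
    (by simp)

@[simp] theorem genN_apply (n : ℕ) (ξ : Space) :
    P.genN n ξ = ((P.gen ξ * (1 + P.gen ξ / (n + 1))⁻¹ : ℝ) : ℂ) := rfl

/-- `resN + genN` has symbol `(1 + A)(1 + A/(n+1))⁻¹`. Applied to the resolvent form of the
equation, it replaces the smoothing `(1 + A)⁻¹` by the weaker one `(1 + A/(n+1))⁻¹`. -/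
theorem resN_add_genN_mul_res (n : ℕ) : (P.resN n + P.genN n) * P.res = P.resN n := by
  ext ξ
  have := P.gen_pos ξ
  simp only [Symbol.mul_apply, Symbol.add_apply, resN_apply, genN_apply, res_apply]
  norm_cast
  field_simp

/-- The quadratic form of `A`. -/
def genSq (g : L2) : ℝ≥0∞ := ∫⁻ ξ : Space, ENNReal.ofReal (P.gen ξ) * ‖fourierL2 g ξ‖ₑ ^ 2

/-- The approximate quadratic form of `A`. -/
def genSqN (n : ℕ) (g : L2) : ℝ := inner ℝ (mult (P.resN n) g) (mult (P.genN n) g)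

theorem ofReal_genSqN (n : ℕ) (g : L2) : ENNReal.ofReal (P.genSqN n g) =
    ∫⁻ ξ : Space, ENNReal.ofReal (P.gen ξ * (1 + P.gen ξ / (n + 1))⁻¹ ^ 2)
      * ‖fourierL2 g ξ‖ₑ ^ 2 := by
  refine ofReal_inner_mult_mult (fun ξ => ?_) (fun ξ => ?_) g
  · have := P.gen_pos ξ; positivity
  · rw [resN_apply, genN_apply, Complex.conj_ofReal]
    push_cast; ring

theorem genSqN_nonneg (n : ℕ) (g : L2) : 0 ≤ P.genSqN n g := by
  refine inner_mult_mult_nonneg (k := fun ξ => P.gen ξ * (1 + P.gen ξ / (n + 1))⁻¹ ^ 2)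
    (fun ξ => ?_) (fun ξ => ?_) g
  · have := P.gen_pos ξ; positivity
  · rw [resN_apply, genN_apply, Complex.conj_ofReal]
    push_cast; ring

theorem continuous_genSqN (n : ℕ) : Continuous (P.genSqN n) := by
  unfold genSqN; fun_prop

theorem monotone_ofReal_genSqN (g : L2) : Monotone fun n => ENNReal.ofReal (P.genSqN n g) := by
  intro n m hnm
  beta_reduce
  rw [ofReal_genSqN, ofReal_genSqN]
  refine lintegral_mono fun ξ => ?_
  have := P.gen_pos ξ
  gcongr

theorem tendsto_genSqN (g : L2) :
    Tendsto (fun n => ENNReal.ofReal (P.genSqN n g)) atTop (nhds (P.genSq g)) := by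
  simp only [ofReal_genSqN]
  refine lintegral_tendsto_of_tendsto_of_monotone (fun n => ?_) (.of_forall fun ξ => ?_)
    (.of_forall fun ξ => ?_)
  · have := P.continuous_gen
    refine AEMeasurable.mul ?_ ((Lp.stronglyMeasurable _).measurable.enorm.pow_const 2).aemeasurable
    exact ((P.continuous_gen.measurable.mul (((P.continuous_gen.measurable.div_const
      _).const_add 1).inv.pow_const 2)).ennreal_ofReal).aemeasurable
  · intro n m hnm
    have := P.gen_pos ξ
    beta_reduce
    gcongr
  · refine ENNReal.Tendsto.mul_const (ENNReal.tendsto_ofReal ?_) (Or.inr (by simp))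
    have h1 : Tendsto (fun n : ℕ => P.gen ξ / ((n : ℝ) + 1)) atTop (nhds 0) :=
      tendsto_const_nhds.div_atTop (tendsto_natCast_atTop_atTop.atTop_add tendsto_const_nhds)
    have h2 := (((h1.const_add 1).inv₀ (by simp)).pow 2).const_mul (P.gen ξ)
    simpa using h2

theorem tendsto_resN (g : L2) : Tendsto (fun n => mult (P.resN n) g) atTop (nhds g) := by
  have h := tendsto_mult (m := P.resN) (n := 1) (C := 1) (l := atTop) P.norm_resN_le
    (fun ξ => ?_) g
  · rwa [mult_one_apply] at h
  · have h1 : Tendsto (fun n : ℕ => P.gen ξ / ((n : ℝ) + 1)) atTop (nhds 0) :=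
      tendsto_const_nhds.div_atTop (tendsto_natCast_atTop_atTop.atTop_add tendsto_const_nhds)
    have h2 := (h1.const_add 1).inv₀ (by simp)
    simp only [add_zero, inv_one] at h2
    have h3 := (Complex.continuous_ofReal.tendsto 1).comp h2
    simpa [Function.comp_def] using h3

/-- The regularised function solves an equation with bounded operators and continuous right-hand
side, so its squared norm is differentiable in the classical sense. -/
theorem energy_resN {U g : ℝ → L2} (hU : Continuous U) (hg : Continuous g)
    (h : ∀ t, 0 ≤ t → mult P.res (U t) = mult P.res (U 0) +
      ∫ s in (0 : ℝ)..t, (mult P.res (U s) - U s + mult P.res (g s))) {t : ℝ} (ht : 0 ≤ t) (n : ℕ) :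
    2 * ∫ s in (0 : ℝ)..t, P.genSqN n (U s) = ‖mult (P.resN n) (U 0)‖ ^ 2
      - ‖mult (P.resN n) (U t)‖ ^ 2
      + 2 * ∫ s in (0 : ℝ)..t, inner ℝ (mult (P.resN n) (U s)) (mult (P.resN n) (g s)) := by
  have heq : ∀ s ∈ Ioo 0 (t + 1), mult (P.resN n) (U s) = mult (P.resN n) (U 0) +
      ∫ r in (0 : ℝ)..s, (-(mult (P.genN n) (U r)) + mult (P.resN n) (g r)) := by
    intro s hs
    have h1 := congrArg (mult (P.resN n + P.genN n)) (h s hs.1.le)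
    rw [ContinuousLinearMap.map_add, ← mult_mul_apply, ← mult_mul_apply, resN_add_genN_mul_res,
      ← ContinuousLinearMap.intervalIntegral_comp_comm _
        (by apply Continuous.intervalIntegrable; fun_prop)] at h1
    rw [h1]
    congr 2
    ext1 r
    rw [ContinuousLinearMap.map_add, ContinuousLinearMap.map_sub, ← mult_mul_apply,
      ← mult_mul_apply, resN_add_genN_mul_res, mult_add_apply]
    abel
  have hd : ∀ s ∈ Ioo 0 t, HasDerivAt (fun s => ‖mult (P.resN n) (U s)‖ ^ 2)
      (2 * inner ℝ (mult (P.resN n) (U s))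
        (-(mult (P.genN n) (U s)) + mult (P.resN n) (g s))) s := fun s hs =>
    (hasDerivAt_of_integral_eq heq (by fun_prop) ⟨hs.1, hs.2.trans (by linarith)⟩).norm_sq
  have h2 := intervalIntegral.integral_eq_sub_of_hasDerivAt_of_le ht (by fun_prop) hd
    (by apply Continuous.intervalIntegrable; fun_prop)
  simp only [inner_add_right, inner_neg_right, mul_add, mul_neg] at h2
  have hc : Continuous fun s => P.genSqN n (U s) := (P.continuous_genSqN n).comp hU
  have e1 : ∀ s, inner ℝ (mult (P.resN n) (U s)) (mult (P.genN n) (U s)) = P.genSqN n (U s) :=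
    fun _ => rfl
  simp only [e1] at h2
  have hc2 : Continuous fun s => -(2 * P.genSqN n (U s)) := by fun_prop
  rw [intervalIntegral.integral_add (hc2.intervalIntegrable _ _)
    (by apply Continuous.intervalIntegrable; fun_prop), intervalIntegral.integral_neg,
    intervalIntegral.integral_const_mul, intervalIntegral.integral_const_mul] at h2
  linarith

/-- In `energy_resN` the right side converges by dominated convergence and the dissipation by
monotone convergence, so the finiteness of the dissipation is a conclusion. The sign in the first
claim ensures that `ENNReal.ofReal` truncates nothing. -/
theorem energy_equality {U g : ℝ → L2} (hU : Continuous U) (hg : Continuous g)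
    (h : ∀ t, 0 ≤ t → mult P.res (U t) = mult P.res (U 0) +
      ∫ s in (0 : ℝ)..t, (mult P.res (U s) - U s + mult P.res (g s))) {t : ℝ} (ht : 0 ≤ t) :
    0 ≤ ‖U 0‖ ^ 2 - ‖U t‖ ^ 2 + 2 * ∫ s in (0 : ℝ)..t, inner ℝ (U s) (g s) ∧
    2 * ∫⁻ s in Ioc 0 t, P.genSq (U s) =
      ENNReal.ofReal (‖U 0‖ ^ 2 - ‖U t‖ ^ 2 + 2 * ∫ s in (0 : ℝ)..t, inner ℝ (U s) (g s)) := by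
  have hR : Tendsto (fun n => ‖mult (P.resN n) (U 0)‖ ^ 2 - ‖mult (P.resN n) (U t)‖ ^ 2
      + 2 * ∫ s in (0 : ℝ)..t, inner ℝ (mult (P.resN n) (U s)) (mult (P.resN n) (g s))) atTop
      (nhds (‖U 0‖ ^ 2 - ‖U t‖ ^ 2 + 2 * ∫ s in (0 : ℝ)..t, inner ℝ (U s) (g s))) := by
    refine (((P.tendsto_resN _).norm.pow 2).sub ((P.tendsto_resN _).norm.pow 2)).add
      (Tendsto.const_mul 2 ?_)
    refine intervalIntegral.tendsto_integral_filter_of_dominated_convergence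
      (fun s => ‖U s‖ * ‖g s‖) ?_ ?_ ?_ ?_
    · exact .of_forall fun n => by
        apply Continuous.aestronglyMeasurable; fun_prop
    · refine .of_forall fun n => .of_forall fun s _ => (norm_inner_le_norm _ _).trans ?_
      exact mul_le_mul (P.norm_resN_apply_le _ _) (P.norm_resN_apply_le _ _) (norm_nonneg _)
        (norm_nonneg _)
    · apply Continuous.intervalIntegrable; fun_prop
    · exact .of_forall fun s _ => (P.tendsto_resN _).inner (P.tendsto_resN _)
  simp only [← P.energy_resN hU hg h ht] at hR
  constructor
  · refine ge_of_tendsto' hR fun n => ?_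
    have := intervalIntegral.integral_nonneg (μ := volume) ht
      (fun s _ => P.genSqN_nonneg n (U s))
    linarith
  · have h1 : Tendsto (fun n => 2 * ∫⁻ s in Ioc 0 t, ENNReal.ofReal (P.genSqN n (U s))) atTop
        (nhds (2 * ∫⁻ s in Ioc 0 t, P.genSq (U s))) := by
      refine ENNReal.Tendsto.const_mul ?_ (Or.inr (by simp))
      refine lintegral_tendsto_of_tendsto_of_monotone (fun n => ?_)
        (.of_forall fun s => P.monotone_ofReal_genSqN _) (.of_forall fun s => P.tendsto_genSqN _)
      exact ((P.continuous_genSqN n).comp hU).measurable.ennreal_ofReal.aemeasurable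
    refine tendsto_nhds_unique h1 ((ENNReal.tendsto_ofReal hR).congr fun n => ?_)
    have hc : Continuous fun s => P.genSqN n (U s) := (P.continuous_genSqN n).comp hU
    rw [ENNReal.ofReal_mul (by norm_num), intervalIntegral.integral_of_le ht,
      ofReal_integral_eq_lintegral_ofReal
        ((intervalIntegrable_iff_integrableOn_Ioc_of_le ht).mp (hc.intervalIntegrable 0 t))
        (.of_forall fun s => P.genSqN_nonneg n (U s))]
    simp

theorem measurable_genSq {X : Type*} [TopologicalSpace X] [MeasurableSpace X] [BorelSpace X]
    {U : X → L2} (hU : Continuous U) : Measurable fun s => P.genSq (U s) := by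
  refine measurable_of_tendsto_metrizable
    (f := fun n s => ENNReal.ofReal (P.genSqN n (U s)))
    (fun n => ((P.continuous_genSqN n).comp hU).measurable.ennreal_ofReal) ?_
  rw [tendsto_pi_nhds]
  exact fun s => P.tendsto_genSqN (U s)

end Params

/-! ### The nonlinearity -/

/-- A barrier argument: after the last time before `t` at which `y ≤ M`, the rate `w` is
nonpositive, so `y` cannot have climbed above `M`. -/
theorem le_of_antitone_energy {y w : ℝ → ℝ} {M : ℝ} (hy : Continuous y)
    (h : ∀ s t, 0 ≤ s → s ≤ t → y t ≤ y s + ∫ r in s..t, w r)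
    (hw : ∀ s, M ≤ y s → w s ≤ 0) (h0 : y 0 ≤ M) {t : ℝ} (ht : 0 ≤ t) : y t ≤ M := by
  by_contra! hlt
  set S : Set ℝ := Icc 0 t ∩ {s | y s ≤ M}
  have hS : IsCompact S := isCompact_Icc.inter_right (isClosed_le hy continuous_const)
  have h0S : (0 : ℝ) ∈ S := ⟨left_mem_Icc.mpr ht, h0⟩
  obtain ⟨⟨hs0, hst⟩, hsM⟩ := hS.sSup_mem ⟨0, h0S⟩
  have hgt : ∀ r ∈ Ioc (sSup S) t, M < y r := by
    intro r hr
    by_contra! hle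
    exact absurd (le_csSup hS.bddAbove ⟨⟨hs0.trans hr.1.le, hr.2⟩, hle⟩) (not_le.mpr hr.1)
  have h1 := h _ _ hs0 hst
  have h2 : ∫ r in (sSup S)..t, w r ≤ 0 := by
    rw [intervalIntegral.integral_of_le hst]
    exact setIntegral_nonpos measurableSet_Ioc fun r hr => hw r (hgt r hr).le
  have h3 : y (sSup S) ≤ M := hsM
  linarith

/-- The radial retraction onto the ball of radius `R`. -/
def retract {E : Type*} [NormedAddCommGroup E] [NormedSpace ℝ E] (R : ℝ) (x : E) : E :=
  (R / max R ‖x‖) • x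

section

variable {E : Type*} [NormedAddCommGroup E] [NormedSpace ℝ E] {R : ℝ}

theorem norm_retract_le (hR : 0 < R) (x : E) : ‖retract R x‖ ≤ R := by
  have h : 0 < max R ‖x‖ := lt_max_of_lt_left hR
  rw [retract, norm_smul, Real.norm_of_nonneg (by positivity), div_mul_eq_mul_div, div_le_iff₀ h]
  gcongr
  exact le_max_right _ _

theorem retract_eq_self (hR : 0 < R) {x : E} (hx : ‖x‖ ≤ R) : retract R x = x := by
  rw [retract, max_eq_left hx, div_self hR.ne', one_smul]

/-- The constant `2` is valid in every normed space; this is convenient since `VecL2` carries the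
maximum norm of its components, which is not Hilbertian. -/
theorem norm_retract_sub_le (hR : 0 < R) (x y : E) :
    ‖retract R x - retract R y‖ ≤ 2 * ‖x - y‖ := by
  have ha : 0 < max R ‖x‖ := lt_max_of_lt_left hR
  have hb : 0 < max R ‖y‖ := lt_max_of_lt_left hR
  have h1 : retract R x - retract R y = (R / max R ‖x‖) • (x - y)
      + (R / max R ‖x‖ - R / max R ‖y‖) • y := by
    simp only [retract, smul_sub, sub_smul]; abel
  have h2 : |max R ‖y‖ - max R ‖x‖| ≤ ‖x - y‖ := by
    refine (abs_max_sub_max_le_max R ‖y‖ R ‖x‖).trans ?_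
    rw [sub_self, abs_zero, max_eq_right (abs_nonneg _), norm_sub_rev]
    exact abs_norm_sub_norm_le y x
  have h3 : ‖(R / max R ‖x‖) • (x - y)‖ ≤ ‖x - y‖ := by
    rw [norm_smul, Real.norm_of_nonneg (by positivity)]
    exact mul_le_of_le_one_left (norm_nonneg _) ((div_le_one ha).mpr (le_max_left _ _))
  have h4 : ‖(R / max R ‖x‖ - R / max R ‖y‖) • y‖ ≤ ‖x - y‖ := by
    have : R / max R ‖x‖ - R / max R ‖y‖
        = (R / max R ‖x‖) * ((max R ‖y‖ - max R ‖x‖) / max R ‖y‖) := by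
      field_simp
    rw [norm_smul, this, norm_mul, Real.norm_of_nonneg (r := R / _) (by positivity), norm_div,
      Real.norm_of_nonneg hb.le, Real.norm_eq_abs]
    calc R / max R ‖x‖ * (|max R ‖y‖ - max R ‖x‖| / max R ‖y‖) * ‖y‖
        ≤ 1 * (‖x - y‖ / max R ‖y‖) * max R ‖y‖ := by
          gcongr
          · exact (div_le_one ha).mpr (le_max_left _ _)
          · exact le_max_right _ _
      _ = ‖x - y‖ := by field_simp
  rw [h1, two_mul]
  exact (norm_add_le _ _).trans (add_le_add h3 h4)

end

namespace Params

variable (P : Params)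

/-- The divergence of `Λ⁻¹ U`. -/
def dvg (U : VecL2) : L2 := ∑ i, mult (P.dLamInv i) (U i)

/-- The bilinear form with `Λ²p = P(U, U)`. -/
def presB : VecL2 →L[ℝ] VecL2 →L[ℝ] L2 :=
  ∑ j, ∑ k, (ContinuousLinearMap.compL ℝ VecL2 L2 L2 (mult (riesz j k))).comp
    (P.Q.bilinearComp (ContinuousLinearMap.proj j) (ContinuousLinearMap.proj k))

theorem presB_apply (U V : VecL2) :
    P.presB U V = ∑ j, ∑ k, mult (riesz j k) (P.Q (U j) (V k)) := by
  simp [presB]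

/-- The `i`-th component of the bilinear form `Λ (div ((u ⊗ v)_α) + ∇p)`. -/
def nlB (i : Fin 3) : VecL2 →L[ℝ] VecL2 →L[ℝ] L2 :=
  ∑ j, (ContinuousLinearMap.compL ℝ VecL2 L2 L2 (mult (P.dLamInv j))).comp
    (P.Q.bilinearComp (ContinuousLinearMap.proj i) (ContinuousLinearMap.proj j))
  + (ContinuousLinearMap.compL ℝ VecL2 L2 L2 (mult (P.dLamInv i))).comp P.presB

theorem nlB_apply (i : Fin 3) (U V : VecL2) :
    P.nlB i U V = ∑ j, mult (P.dLamInv j) (P.Q (U i) (V j)) + mult (P.dLamInv i) (P.presB U V) := by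
  simp [nlB]

theorem nlB_smul_smul (i : Fin 3) (c : ℝ) (U : VecL2) :
    P.nlB i (c • U) (c • U) = c ^ 2 • P.nlB i U U := by
  rw [map_smul, map_smul, smul_apply, smul_smul, sq]

/-- A bound for the nonlinearity. -/
def nlConst : ℝ := ∑ i, ‖P.nlB i‖

theorem nlConst_nonneg : 0 ≤ P.nlConst :=
  Finset.sum_nonneg fun i _ => ContinuousLinearMap.opNorm_nonneg (P.nlB i)

theorem norm_nlB_apply_le (i : Fin 3) (U V : VecL2) :
    ‖P.nlB i U V‖ ≤ P.nlConst * ‖U‖ * ‖V‖ := by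
  refine (ContinuousLinearMap.le_opNorm₂ _ _ _).trans ?_
  gcongr
  exact Finset.single_le_sum (f := fun i => ‖P.nlB i‖)
    (fun i _ => ContinuousLinearMap.opNorm_nonneg (P.nlB i))
    (Finset.mem_univ i)

theorem norm_nlB_sub_le (i : Fin 3) (U V : VecL2) :
    ‖P.nlB i U U - P.nlB i V V‖ ≤ P.nlConst * (‖U‖ + ‖V‖) * ‖U - V‖ := by
  have h : P.nlB i U U - P.nlB i V V = P.nlB i U (U - V) + P.nlB i (U - V) V := by
    simp only [map_sub, sub_apply]; abel
  rw [h]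
  refine (norm_add_le _ _).trans ((add_le_add (P.norm_nlB_apply_le i _ _)
    (P.norm_nlB_apply_le i _ _)).trans (le_of_eq ?_))
  ring

/-- The pressure term is designed for this: by `sum_dLamInv_sq_mul_riesz` its divergence cancels
that of the convective term, for every `U`. Hence the evolution preserves the divergence-free
condition. -/
theorem dvg_nlB (U : VecL2) : P.dvg (fun i => P.nlB i U U) = 0 := by
  have h1 : ∀ j k, ∑ i, mult (P.dLamInv i) (mult (P.dLamInv i) (mult (riesz j k)
      (P.Q (U j) (U k)))) = -mult (P.dLamInv j) (mult (P.dLamInv k) (P.Q (U j) (U k))) := by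
    intro j k
    have := congrArg (fun m => mult m (P.Q (U j) (U k))) (P.sum_dLamInv_sq_mul_riesz j k)
    simpa only [mult_mul_apply, mult_sum_apply, mult_neg_apply] using this
  have h2 : ∑ i, mult (P.dLamInv i) (mult (P.dLamInv i) (P.presB U U))
      = -∑ j, ∑ k, mult (P.dLamInv j) (mult (P.dLamInv k) (P.Q (U j) (U k))) := by
    simp only [presB_apply, map_sum]
    rw [Finset.sum_comm, ← Finset.sum_neg_distrib]
    refine Finset.sum_congr rfl fun j _ => ?_
    rw [Finset.sum_comm, ← Finset.sum_neg_distrib]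
    exact Finset.sum_congr rfl fun k _ => h1 j k
  simp only [dvg, nlB_apply, map_add, map_sum, Finset.sum_add_distrib]
  rw [h2, add_neg_cancel]

theorem inner_dLamInv_left (j : Fin 3) (g h : L2) :
    inner ℝ (mult (P.dLamInv j) g) h = -inner ℝ g (mult (P.dLamInv j) h) := by
  have : (P.dLamInv j).conj = -P.dLamInv j := by
    ext ξ
    change starRingEnd ℂ (P.dLamInv j ξ) = _
    rw [Symbol.neg_apply, dLamInv_apply, map_mul, Complex.conj_I, Complex.conj_ofReal, neg_mul]
  rw [inner_mult_left, this, mult_neg_apply, inner_neg_right]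

/-- By the cyclic identity with `A = B = Uᵢ` and `C = Uⱼ`, twice the convective term is `∫ uᵢ²
∂ⱼuⱼ`, which vanishes after summing over `j`. The gradient term pairs the pressure with the
divergence of `u`. -/
theorem sum_inner_nlB {U : VecL2} (hU : P.dvg U = 0) : ∑ i, inner ℝ (U i) (P.nlB i U U) = 0 := by
  have h1 : ∀ i, ∑ j, inner ℝ (U i) (mult (P.dLamInv j) (P.Q (U i) (U j))) = 0 := by
    intro i
    have h2 : ∀ j, 2 * inner ℝ (U i) (mult (P.dLamInv j) (P.Q (U i) (U j)))
        = inner ℝ (P.Q (U i) (U i)) (mult (P.dLamInv j) (U j)) := by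
      intro j
      have h3 := P.inner_Q_cyclic j (U i) (U i) (U j)
      have h4 := P.inner_dLamInv_left j (U i) (P.Q (U i) (U j))
      rw [real_inner_comm] at h4
      rw [P.Q_comm (U j) (U i)] at h3
      linarith
    have h5 : 2 * ∑ j, inner ℝ (U i) (mult (P.dLamInv j) (P.Q (U i) (U j))) = 0 := by
      rw [Finset.mul_sum]
      simp only [h2]
      rw [← inner_sum]
      change inner ℝ _ (P.dvg U) = _
      rw [hU, inner_zero_right]
    linarith
  have h6 : ∑ i, inner ℝ (U i) (mult (P.dLamInv i) (P.presB U U)) = 0 := by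
    have h7 : ∀ i, inner ℝ (U i) (mult (P.dLamInv i) (P.presB U U))
        = -inner ℝ (mult (P.dLamInv i) (U i)) (P.presB U U) := fun i => by
      rw [inner_dLamInv_left, neg_neg]
    simp only [h7, Finset.sum_neg_distrib]
    rw [← sum_inner]
    change -inner ℝ (P.dvg U) _ = _
    rw [hU, inner_zero_left, neg_zero]
  simp only [nlB_apply, inner_add_right, inner_sum, Finset.sum_add_distrib, h1, h6]
  simp

theorem ofReal_mul_norm_sq_le_genSq (g : L2) : ENNReal.ofReal (P.β * ‖g‖ ^ 2) ≤ P.genSq g := by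
  have hβ := P.hβ
  rw [ENNReal.ofReal_mul hβ.le, ← lintegral_enorm_sq_fourierL2, genSq, ← lintegral_const_mul' _ _ (by simp)]
  exact lintegral_mono fun ξ => by gcongr; exact P.beta_le_gen ξ

/-- The difference of the energy equalities at times `s` and `t`, where only the part `β` of `A` is
kept. -/
theorem energy_inequality {U g : ℝ → L2} (hU : Continuous U) (hg : Continuous g)
    (h : ∀ t, 0 ≤ t → mult P.res (U t) = mult P.res (U 0) +
      ∫ s in (0 : ℝ)..t, (mult P.res (U s) - U s + mult P.res (g s))) {s t : ℝ} (hs : 0 ≤ s)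
    (hst : s ≤ t) :
    ‖U t‖ ^ 2 ≤ ‖U s‖ ^ 2 + ∫ r in s..t, (2 * inner ℝ (U r) (g r) - 2 * (P.β * ‖U r‖ ^ 2)) := by
  obtain ⟨ht0, ht⟩ := P.energy_equality hU hg h (hs.trans hst)
  obtain ⟨hs0, hs'⟩ := P.energy_equality hU hg h hs
  have hβ := P.hβ
  have hi : Continuous fun r => inner ℝ (U r) (g r) := hU.inner hg
  have hn : Continuous fun r => P.β * ‖U r‖ ^ 2 := by fun_prop
  have h1 : ENNReal.ofReal (∫ r in s..t, P.β * ‖U r‖ ^ 2) ≤ ∫⁻ r in Ioc s t, P.genSq (U r) := by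
    rw [intervalIntegral.integral_of_le hst, ofReal_integral_eq_lintegral_ofReal
      ((intervalIntegrable_iff_integrableOn_Ioc_of_le hst).mp (hn.intervalIntegrable _ _))
      (.of_forall fun r => by positivity)]
    exact lintegral_mono fun r => P.ofReal_mul_norm_sq_le_genSq _
  have h2 : ∫⁻ r in Ioc 0 t, P.genSq (U r)
      = (∫⁻ r in Ioc 0 s, P.genSq (U r)) + ∫⁻ r in Ioc s t, P.genSq (U r) := by
    rw [← Ioc_union_Ioc_eq_Ioc hs hst, lintegral_union measurableSet_Ioc
      (Ioc_disjoint_Ioc_of_le le_rfl)]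
  have h3 : 0 ≤ ∫ r in s..t, P.β * ‖U r‖ ^ 2 :=
    intervalIntegral.integral_nonneg hst fun r _ => by positivity
  have h4 : ENNReal.ofReal ((‖U 0‖ ^ 2 - ‖U s‖ ^ 2 + 2 * ∫ r in (0 : ℝ)..s, inner ℝ (U r) (g r))
      + 2 * ∫ r in s..t, P.β * ‖U r‖ ^ 2)
      ≤ ENNReal.ofReal (‖U 0‖ ^ 2 - ‖U t‖ ^ 2 + 2 * ∫ r in (0 : ℝ)..t, inner ℝ (U r) (g r)) := by
    rw [ENNReal.ofReal_add hs0 (by positivity), ← ht, ← hs', h2, mul_add,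
      ENNReal.ofReal_mul (by norm_num), ENNReal.ofReal_ofNat]
    gcongr
  rw [ENNReal.ofReal_le_ofReal_iff ht0] at h4
  have h5 := intervalIntegral.integral_add_adjacent_intervals (hi.intervalIntegrable 0 s (μ := volume))
    (hi.intervalIntegrable s t)
  have hi2 : Continuous fun r => 2 * inner ℝ (U r) (g r) := by fun_prop
  have hn2 : Continuous fun r => 2 * (P.β * ‖U r‖ ^ 2) := by fun_prop
  rw [intervalIntegral.integral_sub (hi2.intervalIntegrable _ _) (hn2.intervalIntegrable _ _),
    intervalIntegral.integral_const_mul, intervalIntegral.integral_const_mul]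
  linarith

theorem res_eq_of_mild {U g : ℝ → L2} {x₀ : L2} (hg : Continuous g)
    (h : ∀ t, 0 ≤ t → U t = P.mild x₀ g t) {t : ℝ} (ht : 0 ≤ t) :
    mult P.res (U t) = mult P.res (U 0) +
      ∫ s in (0 : ℝ)..t, (mult P.res (U s) - U s + mult P.res (g s)) := by
  obtain ⟨C, hC⟩ := (isCompact_Icc (a := (0 : ℝ)) (b := t)).exists_bound_of_continuousOn
    hg.continuousOn
  have h0 : U 0 = x₀ := by
    rw [h 0 le_rfl, mild, sgp_zero, mult_one_apply, intervalIntegral.integral_same, add_zero]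
  rw [h t ht, (P.mild_res hg.stronglyMeasurable ht hC).2, h0]
  congr 1
  refine intervalIntegral.integral_congr fun s hs => ?_
  rw [uIcc_of_le ht] at hs
  beta_reduce
  rw [h s hs.1]

/-- The divergence is a Fourier multiplier and commutes with the semigroup. -/
theorem dvg_mild {x₀ : VecL2} {g : ℝ → VecL2} (hg : Continuous g) (hx : P.dvg x₀ = 0)
    (hgd : ∀ s, 0 ≤ s → P.dvg (g s) = 0) {t : ℝ} (ht : 0 ≤ t) :
    P.dvg (fun i => P.mild (x₀ i) (fun s => g s i) t) = 0 := by
  have hc : ∀ i, Continuous fun s => mult (P.sgp (t - s)) (g s i) := fun i =>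
    P.continuous_sgp.comp (f := fun s => (t - s, g s i)) (by fun_prop)
  have h1 : ∀ i, mult (P.dLamInv i) (P.mild (x₀ i) (fun s => g s i) t)
      = mult (P.sgp t) (mult (P.dLamInv i) (x₀ i))
        + ∫ s in (0 : ℝ)..t, mult (P.sgp (t - s)) (mult (P.dLamInv i) (g s i)) := by
    intro i
    rw [mild, map_add, mult_comm, ← ContinuousLinearMap.intervalIntegral_comp_comm _
      ((hc i).intervalIntegrable _ _)]
    simp only [mult_comm (P.dLamInv i)]
  have hc2 : ∀ i, Continuous fun s => mult (P.sgp (t - s)) (mult (P.dLamInv i) (g s i)) :=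
    fun i => P.continuous_sgp.comp (f := fun s => (t - s, mult (P.dLamInv i) (g s i)))
      (by fun_prop)
  simp only [dvg, h1, Finset.sum_add_distrib]
  rw [← map_sum, ← intervalIntegral.integral_finsetSum fun i _ =>
    (hc2 i).intervalIntegrable _ _]
  simp only [← map_sum]
  change mult (P.sgp t) (P.dvg x₀) + ∫ s in (0 : ℝ)..t, mult (P.sgp (t - s)) (P.dvg (g s)) = 0
  rw [hx, map_zero, zero_add]
  refine (intervalIntegral.integral_congr (g := fun _ => 0) fun s hs => ?_).trans (by simp)
  rw [uIcc_of_le ht] at hs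
  beta_reduce
  rw [hgd s hs.1, map_zero]

/-! ### The cut-off problem and the global solution. -/

/-- The forcing of the evolution equation for `U = Λ u`. -/
def forcing (F U : VecL2) : VecL2 := fun i => F i - P.nlB i U U

theorem continuous_forcing (F : VecL2) : Continuous (P.forcing F) := by
  unfold forcing
  refine continuous_pi fun i => ?_
  have h : Continuous fun U : VecL2 => P.nlB i U U :=
    (P.nlB i).continuous.clm_apply continuous_id
  exact continuous_const.sub h

theorem dvg_forcing {F : VecL2} (hF : P.dvg F = 0) (U : VecL2) : P.dvg (P.forcing F U) = 0 := by
  have h := P.dvg_nlB U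
  simp only [dvg] at h hF
  simp only [dvg, forcing, map_sub, Finset.sum_sub_distrib, h, hF, sub_self]

theorem lipschitz_forcing_retract (F : VecL2) {R : ℝ} (hR : 0 < R) :
    LipschitzWith (P.nlConst * (R + R) * 2).toNNReal fun U => P.forcing F (retract R U) := by
  have hC := P.nlConst_nonneg
  refine LipschitzWith.of_dist_le_mul fun U V => ?_
  rw [Real.coe_toNNReal _ (by positivity), dist_pi_le_iff (by positivity)]
  intro i
  rw [dist_eq_norm, dist_eq_norm, forcing, forcing, sub_sub_sub_cancel_left, norm_sub_rev]
  refine (P.norm_nlB_sub_le i _ _).trans ?_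
  rw [mul_assoc (P.nlConst * (R + R))]
  gcongr
  · exact norm_retract_le hR U
  · exact norm_retract_le hR V
  · exact norm_retract_sub_le hR U V

/-- The retraction multiplies `U` by a scalar `c`, so the nonlinearity becomes `c²` times the
original one and remains orthogonal to `U`. -/
theorem sum_inner_forcing_retract {U F : VecL2} (hU : P.dvg U = 0) (R : ℝ) :
    ∑ i, inner ℝ (U i) (P.forcing F (retract R U) i) = ∑ i, inner ℝ (U i) (F i) := by
  simp only [forcing, retract, nlB_smul_smul, inner_sub_right, inner_smul_right,
    Finset.sum_sub_distrib, ← Finset.mul_sum, P.sum_inner_nlB hU, mul_zero, sub_zero]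

theorem mild_zero (x₀ : L2) (g : ℝ → L2) : P.mild x₀ g 0 = x₀ := by
  rw [mild, sgp_zero, mult_one_apply, intervalIntegral.integral_same, add_zero]

theorem mild_congr {x₀ : L2} {g h : ℝ → L2} {t : ℝ} (ht : 0 ≤ t)
    (hgh : ∀ s ∈ Icc 0 t, g s = h s) : P.mild x₀ g t = P.mild x₀ h t :=
  congrArg (mult (P.sgp t) x₀ + ·) <| intervalIntegral.integral_congr fun s hs => by
    rw [uIcc_of_le ht] at hs
    beta_reduce
    rw [hgh s hs]

/-- The semigroup acting on each component. -/
def vecSgp (t : ℝ) : VecL2 →L[ℝ] VecL2 := ContinuousLinearMap.pi fun i =>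
  (mult (P.sgp t)).comp (ContinuousLinearMap.proj i)

theorem norm_vecSgp_apply_le (t : ℝ) (x : VecL2) : ‖P.vecSgp t x‖ ≤ ‖x‖ :=
  (pi_norm_le_iff_of_nonneg (norm_nonneg _)).mpr fun i =>
    (P.norm_sgp_apply_le t _).trans (norm_le_pi_norm x i)

theorem continuous_vecSgp : Continuous fun p : ℝ × VecL2 => P.vecSgp p.1 p.2 :=
  continuous_pi fun i => P.continuous_sgp.comp (f := fun p : ℝ × VecL2 => (p.1, p.2 i))
    (by fun_prop)

theorem exists_mild_vec {G : VecL2 → VecL2} {K : NNReal} (hG : LipschitzWith K G) (x₀ : VecL2) :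
    ∃ U : ℝ → VecL2, Continuous U ∧
      ∀ t, 0 ≤ t → ∀ i, U t i = P.mild (x₀ i) (fun s => G (U s) i) t := by
  obtain ⟨U, hUc, hU⟩ := exists_mild P.vecSgp P.norm_vecSgp_apply_le P.continuous_vecSgp hG x₀
  refine ⟨U, hUc, fun t ht i => ?_⟩
  have hint : IntervalIntegrable (fun s => P.vecSgp (t - s) (G (U s))) volume 0 t := by
    apply Continuous.intervalIntegrable
    exact P.continuous_vecSgp.comp (f := fun s => (t - s, G (U s)))
      ((continuous_const.sub continuous_id).prodMk (hG.continuous.comp hUc))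
  have h1 := congrArg (ContinuousLinearMap.proj (R := ℝ) (φ := fun _ : Fin 3 => L2) i) (hU t ht)
  rw [ContinuousLinearMap.map_add,
    ← ContinuousLinearMap.intervalIntegral_comp_comm _ hint] at h1
  exact h1

theorem young_sq (g h : L2) : 2 * inner ℝ g h - 2 * (P.β * ‖g‖ ^ 2)
    ≤ ‖h‖ ^ 2 / P.β - P.β * ‖g‖ ^ 2 := by
  have hβ := P.hβ
  have h2 := real_inner_le_norm g h
  have h4 : ‖h‖ ^ 2 / P.β + P.β * ‖g‖ ^ 2 - 2 * (‖g‖ * ‖h‖) = (‖h‖ - P.β * ‖g‖) ^ 2 / P.β := by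
    field_simp; ring
  have h5 : 0 ≤ (‖h‖ - P.β * ‖g‖) ^ 2 / P.β := by positivity
  linarith

/-- By Young's inequality the energy grows at a rate at most `∑ ‖Fᵢ‖² / β - β ∑ ‖Uᵢ‖²`, which is
nonpositive as soon as the energy reaches `M`. So `M` is a barrier. -/
theorem sum_norm_sq_le {U g : ℝ → VecL2} {U₀ F : VecL2} {M : ℝ} (hUc : Continuous U)
    (hg : Continuous g) (hU : ∀ t, 0 ≤ t → ∀ i, U t i = P.mild (U₀ i) (fun s => g s i) t)
    (hgF : ∀ t, 0 ≤ t → ∑ i, inner ℝ (U t i) (g t i) = ∑ i, inner ℝ (U t i) (F i))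
    (hU₀ : ∑ i, ‖U₀ i‖ ^ 2 ≤ M) (hF : (∑ i, ‖F i‖ ^ 2) / P.β ^ 2 ≤ M) {t : ℝ} (ht : 0 ≤ t) :
    ∑ i, ‖U t i‖ ^ 2 ≤ M := by
  have hβ := P.hβ
  refine le_of_antitone_energy (y := fun t => ∑ i, ‖U t i‖ ^ 2) (M := M)
    (w := fun r => ∑ i, (2 * inner ℝ (U r i) (F i) - 2 * (P.β * ‖U r i‖ ^ 2)))
    (by fun_prop) (fun s t hs hst => ?_) (fun s hs => ?_) ?_ ht
  · have h1 : ∀ i, ‖U t i‖ ^ 2 ≤ ‖U s i‖ ^ 2 +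
        ∫ r in s..t, (2 * inner ℝ (U r i) (g r i) - 2 * (P.β * ‖U r i‖ ^ 2)) := fun i =>
      P.energy_inequality (U := fun t => U t i) (g := fun t => g t i) (by fun_prop) (by fun_prop)
        (fun t ht => P.res_eq_of_mild (by fun_prop) (fun t ht => hU t ht i) ht) hs hst
    have h2 := Finset.sum_le_sum fun i (_ : i ∈ Finset.univ) => h1 i
    rw [Finset.sum_add_distrib, ← intervalIntegral.integral_finsetSum fun i _ => by
      apply Continuous.intervalIntegrable; fun_prop] at h2
    refine h2.trans_eq ?_
    beta_reduce
    congr 1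
    refine intervalIntegral.integral_congr fun r hr => ?_
    rw [uIcc_of_le hst] at hr
    simp only [Finset.sum_sub_distrib, ← Finset.mul_sum]
    rw [hgF r (hs.trans hr.1)]
  · refine (Finset.sum_le_sum fun i _ => P.young_sq (U s i) (F i)).trans ?_
    rw [Finset.sum_sub_distrib, ← Finset.sum_div, ← Finset.mul_sum]
    have h7 := mul_le_mul_of_nonneg_left (hF.trans hs) hβ.le
    have h8 : P.β * ((∑ i, ‖F i‖ ^ 2) / P.β ^ 2) = (∑ i, ‖F i‖ ^ 2) / P.β := by
      field_simp
    linarith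
  · have h0 : U 0 = U₀ := funext fun i => by rw [hU 0 le_rfl, mild_zero]
    beta_reduce
    rwa [h0]

/-- Thanks to `1 ≤ M`, the bound on squares also bounds the norm, so one number serves both as
energy level and as radius of the cut-off. -/
theorem norm_le_of_sum_norm_sq_le {U : VecL2} {M : ℝ} (hM : 1 ≤ M) (h : ∑ i, ‖U i‖ ^ 2 ≤ M) :
    ‖U‖ ≤ M := by
  refine (pi_norm_le_iff_of_nonneg (by linarith)).mpr fun i => ?_
  have h2 := (Finset.single_le_sum (f := fun i => ‖U i‖ ^ 2) (fun _ _ => by positivity)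
    (Finset.mem_univ i)).trans h
  beta_reduce at h2
  nlinarith [norm_nonneg (U i)]

/-- The energy level of the cut-off problem depends on the data only and not on the radius. Taking
it as the radius makes the retraction act as the identity along the solution. -/
theorem exists_solution {U₀ F : VecL2} (hU₀ : P.dvg U₀ = 0) (hF : P.dvg F = 0) :
    ∃ U : ℝ → VecL2, Continuous U ∧ U 0 = U₀ ∧
      (∃ M : ℝ, ∀ t, 0 ≤ t → ∑ i, ‖U t i‖ ^ 2 ≤ M) ∧ (∀ t, 0 ≤ t → P.dvg (U t) = 0) ∧
      ∀ t, 0 ≤ t → ∀ i, U t i = P.mild (U₀ i) (fun s => P.forcing F (U s) i) t := by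
  obtain ⟨M, hM1, hM2, hM3⟩ : ∃ M : ℝ, 1 ≤ M ∧ ∑ i, ‖U₀ i‖ ^ 2 ≤ M ∧
      (∑ i, ‖F i‖ ^ 2) / P.β ^ 2 ≤ M :=
    ⟨max 1 (max _ _), le_max_left _ _, (le_max_left _ _).trans (le_max_right _ _),
      (le_max_right _ _).trans (le_max_right _ _)⟩
  have hM : 0 < M := by linarith
  have hlip := P.lipschitz_forcing_retract F hM
  obtain ⟨U, hUc, hU⟩ := P.exists_mild_vec hlip U₀
  have hg : Continuous fun s => P.forcing F (retract M (U s)) := hlip.continuous.comp hUc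
  have hU0 : U 0 = U₀ := funext fun i => by rw [hU 0 le_rfl, mild_zero]
  have hdiv : ∀ t, 0 ≤ t → P.dvg (U t) = 0 := fun t ht => by
    rw [show U t = fun i => P.mild (U₀ i) (fun s => P.forcing F (retract M (U s)) i) t from
      funext fun i => hU t ht i]
    exact P.dvg_mild hg hU₀ (fun s _ => P.dvg_forcing hF _) ht
  have hbound : ∀ t, 0 ≤ t → ∑ i, ‖U t i‖ ^ 2 ≤ M := fun t ht =>
    P.sum_norm_sq_le hUc hg hU (fun t ht => P.sum_inner_forcing_retract (hdiv t ht) M) hM2 hM3 ht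
  refine ⟨U, hUc, hU0, ⟨M, hbound⟩, hdiv, fun t ht i => ?_⟩
  rw [hU t ht i]
  exact P.mild_congr ht fun s hs => by
    rw [retract_eq_self hM (norm_le_of_sum_norm_sq_le hM1 (hbound s hs.1))]

end Params

/-! ### Sobolev norms of `u = Λ⁻¹ U` -/

theorem toTemperedDistribution_apply_fourier (A : CL2) (ψ : 𝓢(Space, ℂ)) :
    Lp.toTemperedDistribution A ψ = ∫ ξ : Space, (𝓕⁻ ψ) ξ * (𝓕 A : CL2) ξ := by
  have h2 : Lp.toTemperedDistribution A ψ = (𝓕 (Lp.toTemperedDistribution A)) (𝓕⁻ ψ) := by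
    rw [TemperedDistribution.fourier_apply, FourierTransform.fourier_fourierInv_eq]
  rw [h2, Lp.fourier_toTemperedDistribution_eq A, Lp.toTemperedDistribution_apply]
  rfl

theorem toTemperedDistribution_injective {A B : CL2}
    (h : Lp.toTemperedDistribution A = Lp.toTemperedDistribution B) : A = B :=
  LinearMap.ker_eq_bot.mp
    (Lp.ker_toTemperedDistributionCLM_eq_bot (E := Space) (F := ℂ) (μ := volume) (p := 2)) h

theorem measurable_one_add_norm_sq_rpow (r : ℝ) :
    Measurable fun ξ : Space => (1 + ‖ξ‖ ^ 2) ^ r := by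
  fun_prop

/-- The symbol `(1 + ‖ξ‖²)^{-1/2}`. -/
def besselInv : Symbol :=
  Symbol.ofEven (fun ξ => (1 + ‖ξ‖ ^ 2) ^ (-1 / 2 : ℝ))
    (measurable_one_add_norm_sq_rpow _)
    ⟨1, fun ξ => by
      rw [abs_of_nonneg (by positivity)]
      exact Real.rpow_le_one_of_one_le_of_nonpos (by nlinarith [sq_nonneg ‖ξ‖]) (by norm_num)⟩
    (by simp)

theorem besselInv_apply (ξ : Space) :
    besselInv ξ = (((1 + ‖ξ‖ ^ 2) ^ (-1 / 2 : ℝ) : ℝ) : ℂ) := rfl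

open TemperedDistribution in
theorem exists_fourierL2_eq_of_memH_one {g : L2} (hg : MemH 1 g) :
    ∃ A : CL2, fourierL2 g =ᵐ[volume] fun ξ => besselInv ξ * A ξ := by
  obtain ⟨A, hA⟩ := hg
  have hA := (besselPotential_neg_apply_eq_iff _ _ _).mpr hA
  refine ⟨𝓕 A, ?_⟩
  have h1 : toCL2 g = cmult besselInv A := by
    apply toTemperedDistribution_injective
    change toDist g = _
    rw [← hA]
    ext ψ
    have ht : (fun ξ : Space => (((1 + ‖ξ‖ ^ 2) ^ (-((1 : ℕ) : ℝ) / 2) : ℝ) : ℂ)).HasTemperateGrowth := by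
      fun_prop
    rw [besselPotential, fourierMultiplierCLM_apply_apply, toTemperedDistribution_apply_fourier,
      toTemperedDistribution_apply_fourier, FourierTransform.fourierInv_fourier_eq, fourier_cmult]
    apply integral_congr_ae
    filter_upwards [coeFn_pmul besselInv (𝓕 A)] with ξ a
    rw [a, SchwartzMap.smulLeftCLM_apply_apply ht, smul_eq_mul, besselInv_apply]
    push_cast
    ring
  rw [fourierL2_eq, h1, fourier_cmult]
  exact coeFn_pmul _ _

namespace Params

variable (P : Params)

/-- `G` is the inverse transform of `lam` times the transform of `g`. Its real part may be taken
because real parts commute with the multiplier. -/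
theorem exists_lamInv_eq {g : L2}
    (hg : ∫⁻ ξ : Space, ENNReal.ofReal (P.lam ξ ^ 2) * ‖fourierL2 g ξ‖ₑ ^ 2 ≠ ⊤) :
    ∃ G : L2, g = mult P.lamInv G := by
  have hmem : MemLp (fun ξ => (P.lam ξ : ℂ) * fourierL2 g ξ) 2 volume := by
    refine ⟨(Complex.continuous_ofReal.comp P.continuous_lam).aestronglyMeasurable.mul
      (Lp.aestronglyMeasurable _), ?_⟩
    rw [eLpNorm_lt_top_iff_lintegral_rpow_enorm_lt_top (by norm_num) (by norm_num)]
    refine lt_of_eq_of_lt (lintegral_congr fun ξ => ?_) (lt_top_iff_ne_top.mpr hg)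
    rw [ENNReal.toReal_ofNat, ENNReal.rpow_ofNat, enorm_mul, mul_pow,
      ENNReal.ofReal_pow (P.lam_pos ξ).le, ← ofReal_norm (P.lam ξ : ℂ), Complex.norm_real,
      Real.norm_of_nonneg (P.lam_pos ξ).le]
  have h : pmul P.lamInv hmem.toLp = 𝓕 (toCL2 g) := by
    apply Lp.ext
    filter_upwards [coeFn_pmul P.lamInv hmem.toLp, hmem.coeFn_toLp] with ξ a b
    rw [a, b, lamInv_apply, Complex.ofReal_inv, ← mul_assoc, inv_mul_cancel₀, one_mul]
    · rfl
    · exact_mod_cast P.lam_ne ξ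
  refine ⟨reL2 (𝓕⁻ hmem.toLp), ?_⟩
  have h2 : mult P.lamInv (reL2 (𝓕⁻ hmem.toLp)) = g := by
    rw [← reL2_cmult, cmult, FourierTransform.fourier_fourierInv_eq, h,
      FourierTransform.fourierInv_fourier_eq, reL2_toCL2]
  exact h2.symm

theorem exists_lamInv_eq_of_memH_one {g : L2} (hg : MemH 1 g) : ∃ G : L2, g = mult P.lamInv G := by
  obtain ⟨A, hA⟩ := exists_fourierL2_eq_of_memH_one hg
  apply P.exists_lamInv_eq
  have hA2 : ∫⁻ ξ : Space, ‖A ξ‖ₑ ^ 2 ≠ ⊤ := by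
    have := (eLpNorm_lt_top_iff_lintegral_rpow_enorm_lt_top (by norm_num) (by norm_num)).mp
      (Lp.memLp A).2
    simpa using this.ne
  -- The Bessel potential is normalised with `‖ξ‖` and `lam` with `α * (2π‖ξ‖)`; the weights are
  -- only comparable.
  have hC : ∀ ξ : Space, P.lam ξ ^ 2 * ((1 + ‖ξ‖ ^ 2) ^ (-1 / 2 : ℝ)) ^ 2
      ≤ 1 + (P.α * (2 * Real.pi)) ^ 2 := by
    intro ξ
    have h0 : 0 < 1 + ‖ξ‖ ^ 2 := by positivity
    have h1 : ((1 + ‖ξ‖ ^ 2) ^ (-1 / 2 : ℝ)) ^ 2 = (1 + ‖ξ‖ ^ 2)⁻¹ := by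
      rw [← Real.rpow_natCast, ← Real.rpow_mul h0.le, ← Real.rpow_neg_one]
      norm_num
    rw [h1, ← div_eq_mul_inv, div_le_iff₀ h0, lam_sq, eta]
    nlinarith [sq_nonneg ‖ξ‖, sq_nonneg (P.α * (2 * Real.pi))]
  refine ne_top_of_le_ne_top (ENNReal.mul_ne_top (ENNReal.ofReal_ne_top
    (r := 1 + (P.α * (2 * Real.pi)) ^ 2)) hA2) ?_
  rw [← lintegral_const_mul' _ _ ENNReal.ofReal_ne_top]
  refine lintegral_mono_ae ?_
  filter_upwards [hA] with ξ a
  rw [a, enorm_mul, mul_pow, ← mul_assoc, besselInv_apply, ← ofReal_norm (Complex.ofReal _),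
    Complex.norm_real, Real.norm_of_nonneg (by positivity), ← ENNReal.ofReal_pow (by positivity),
    ← ENNReal.ofReal_mul (by positivity)]
  gcongr
  exact hC ξ

open TemperedDistribution in
theorem memH_one_lamInv (G : L2) : MemH 1 (mult P.lamInv G) := by
  have ht : (fun ξ : Space => (((1 + ‖ξ‖ ^ 2) ^ (((1 : ℕ) : ℝ) / 2) : ℝ) : ℂ)).HasTemperateGrowth := by
    fun_prop
  let m : Symbol := Symbol.ofEven (fun ξ => (1 + ‖ξ‖ ^ 2) ^ (((1 : ℕ) : ℝ) / 2) * (P.lam ξ)⁻¹)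
    ((measurable_one_add_norm_sq_rpow _).mul P.continuous_lam.measurable.inv)
    ⟨1 + P.α⁻¹, fun ξ => by
      have hα := P.hα
      rw [abs_of_nonneg (mul_nonneg (by positivity) (inv_pos.mpr (P.lam_pos ξ)).le),
        ← div_eq_mul_inv, div_le_iff₀ (P.lam_pos ξ), Nat.cast_one, ← Real.sqrt_eq_rpow]
      have h1 : √(1 + ‖ξ‖ ^ 2) ≤ 1 + ‖ξ‖ := by
        rw [Real.sqrt_le_left (by positivity)]
        nlinarith [norm_nonneg ξ]
      have h2 : ‖ξ‖ ≤ eta ξ := by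
        unfold eta
        nlinarith [norm_nonneg ξ, Real.pi_gt_three]
      have h3 : eta ξ ≤ P.α⁻¹ * P.lam ξ := by
        rw [inv_mul_eq_div, le_div_iff₀ hα, mul_comm]
        exact P.alpha_eta_le_lam ξ
      nlinarith [P.one_le_lam ξ]⟩
    (by simp)
  refine ⟨toCL2 (mult m G), ?_⟩
  refine fourierMultiplier_toDist_mult ht (m₁ := P.lamInv) (m₂ := m) (fun ξ => ?_) G
  rw [lamInv_apply, Symbol.ofEven_apply]
  push_cast
  rfl

/-- Weighted square integrals of `Λ⁻¹ G`. -/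
theorem lintegral_mul_enorm_sq_lamInv (w : Space → ℝ≥0∞) (G : L2) :
    ∫⁻ ξ : Space, w ξ * ‖fourierL2 (mult P.lamInv G) ξ‖ₑ ^ 2
      = ∫⁻ ξ : Space, w ξ * ENNReal.ofReal ((P.lam ξ ^ 2)⁻¹) * ‖fourierL2 G ξ‖ₑ ^ 2 := by
  apply lintegral_congr_ae
  filter_upwards [fourierL2_mult P.lamInv G] with ξ a
  have := P.lam_pos ξ
  rw [a, enorm_mul, mul_pow, ← mul_assoc, lamInv_apply, ← ofReal_norm (Complex.ofReal _),
    Complex.norm_real, Real.norm_of_nonneg (by positivity), ← ENNReal.ofReal_pow (by positivity),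
    inv_pow]

theorem measurable_ofReal_mul_enorm_sq {w : Space → ℝ} (hw : Measurable w) (G : L2) :
    Measurable fun ξ : Space => ENNReal.ofReal (w ξ) * ‖fourierL2 G ξ‖ₑ ^ 2 :=
  hw.ennreal_ofReal.mul ((Lp.stronglyMeasurable _).measurable.enorm.pow_const 2)

theorem homSobolevSq_lamInv (k : ℕ) (G : L2) : homSobolevSq k (mult P.lamInv G)
    = ∫⁻ ξ : Space, ENNReal.ofReal (eta ξ ^ (2 * k) * (P.lam ξ ^ 2)⁻¹) * ‖fourierL2 G ξ‖ₑ ^ 2 := by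
  rw [homSobolevSq, lintegral_mul_enorm_sq_lamInv]
  refine lintegral_congr fun ξ => ?_
  rw [ENNReal.ofReal_mul (pow_nonneg (eta_nonneg ξ) _)]
  rfl

theorem measurable_eta_pow_mul (k : ℕ) :
    Measurable fun ξ : Space => eta ξ ^ (2 * k) * (P.lam ξ ^ 2)⁻¹ :=
  (continuous_eta.measurable.pow_const _).mul (P.continuous_lam.measurable.pow_const _).inv

/-- The integrated form of `lam⁻² (1 + α² eta²) = 1`: the filtered energy of `u = Λ⁻¹ G` is the `L²`
norm of `G`. -/
theorem norm_sq_add_homSobolevSq_one (G : L2) :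
    ENNReal.ofReal (‖mult P.lamInv G‖ ^ 2)
      + ENNReal.ofReal (P.α ^ 2) * homSobolevSq 1 (mult P.lamInv G) = ENNReal.ofReal (‖G‖ ^ 2) := by
  have h := P.lintegral_mul_enorm_sq_lamInv 1 G
  have hm : Measurable fun ξ => (P.lam ξ ^ 2)⁻¹ := (P.continuous_lam.measurable.pow_const 2).inv
  simp only [Pi.one_apply, one_mul] at h
  rw [← lintegral_enorm_sq_fourierL2, h, homSobolevSq_lamInv, ← lintegral_const_mul' _ _
    ENNReal.ofReal_ne_top, ← lintegral_add_left
    (measurable_ofReal_mul_enorm_sq hm G),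
    ← lintegral_enorm_sq_fourierL2]
  refine lintegral_congr fun ξ => ?_
  have := P.lam_pos ξ
  have h0 := eta_nonneg ξ
  rw [← mul_assoc, ← add_mul, ← ENNReal.ofReal_mul (by positivity),
    ← ENNReal.ofReal_add (by positivity) (by positivity)]
  have h1 : (P.lam ξ ^ 2)⁻¹ + P.α ^ 2 * (eta ξ ^ (2 * 1) * (P.lam ξ ^ 2)⁻¹) = 1 := by
    field_simp
    rw [lam_sq]
  rw [h1, ENNReal.ofReal_one, one_mul]

/-- Since `lam² = 1 + α² eta²`, one has `β + ν eta² = β + ν eta² lam⁻² + ν α² eta⁴ lam⁻²`. Finite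
dissipation for `U` is therefore `Ḣ²` regularity for `u`. -/
theorem genSq_eq (G : L2) : P.genSq G = ENNReal.ofReal P.ν * homSobolevSq 1 (mult P.lamInv G)
    + ENNReal.ofReal (P.ν * P.α ^ 2) * homSobolevSq 2 (mult P.lamInv G)
    + ENNReal.ofReal (P.β * ‖G‖ ^ 2) := by
  have hν := P.hν
  have hβ := P.hβ
  rw [ENNReal.ofReal_mul hβ.le, ← lintegral_enorm_sq_fourierL2, homSobolevSq_lamInv,
    homSobolevSq_lamInv, ← lintegral_const_mul' _ _ ENNReal.ofReal_ne_top,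
    ← lintegral_const_mul' _ _ ENNReal.ofReal_ne_top,
    ← lintegral_const_mul' _ _ ENNReal.ofReal_ne_top,
    ← lintegral_add_left ((measurable_ofReal_mul_enorm_sq
      (P.measurable_eta_pow_mul 1) G).const_mul _),
    ← lintegral_add_right _ (measurable_ofReal_mul_enorm_sq (w := fun _ => P.β) measurable_const G),
    genSq]
  refine lintegral_congr fun ξ => ?_
  have := P.lam_pos ξ
  have h0 := eta_nonneg ξ
  rw [← mul_assoc, ← mul_assoc, ← add_mul, ← add_mul, ← ENNReal.ofReal_mul (by positivity),
    ← ENNReal.ofReal_mul (by positivity), ← ENNReal.ofReal_add (by positivity) (by positivity),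
    ← ENNReal.ofReal_add (by positivity) (by positivity)]
  congr 2
  rw [gen]
  field_simp
  rw [lam_sq]; ring

theorem one_add_eta_sq_le (ξ : Space) : 1 + eta ξ ^ 2 ≤ (1 + P.α⁻¹ ^ 2) * P.lam ξ ^ 2 := by
  have hα := P.hα
  rw [lam_sq]
  have : P.α⁻¹ ^ 2 * (P.α ^ 2 * eta ξ ^ 2) = eta ξ ^ 2 := by field_simp
  nlinarith [sq_nonneg (P.α * eta ξ), sq_nonneg P.α⁻¹]

theorem sobolevSq_one_lamInv_le (G : L2) :
    sobolevSq 1 (mult P.lamInv G) ≤ ENNReal.ofReal ((1 + P.α⁻¹ ^ 2) * ‖G‖ ^ 2) := by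
  rw [sobolevSq, lintegral_mul_enorm_sq_lamInv, ENNReal.ofReal_mul (by positivity),
    ← lintegral_enorm_sq_fourierL2, ← lintegral_const_mul' _ _ ENNReal.ofReal_ne_top]
  refine lintegral_mono fun ξ => ?_
  have := P.lam_pos ξ
  rw [← ENNReal.ofReal_mul (by positivity)]
  gcongr
  rw [pow_one, ← div_eq_mul_inv, div_le_iff₀ (by positivity)]
  exact P.one_add_eta_sq_le ξ

theorem lam_sq_le (ξ : Space) : P.lam ξ ^ 2 ≤ (1 + P.α ^ 2) * (1 + eta ξ ^ 2) := by
  rw [lam_sq]; nlinarith [sq_nonneg (eta ξ), sq_nonneg P.α]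

theorem lintegral_lam_sq_le (g : L2) :
    ∫⁻ ξ : Space, ENNReal.ofReal (P.lam ξ ^ 2) * ‖fourierL2 g ξ‖ₑ ^ 2
      ≤ ENNReal.ofReal (1 + P.α ^ 2) * sobolevSq 1 g := by
  rw [sobolevSq, ← lintegral_const_mul' _ _ ENNReal.ofReal_ne_top]
  refine lintegral_mono fun ξ => ?_
  rw [← mul_assoc, ← ENNReal.ofReal_mul (by positivity)]
  gcongr
  rw [pow_one]
  exact P.lam_sq_le ξ

theorem lintegral_lam_sq_lamInv (G : L2) :
    ∫⁻ ξ : Space, ENNReal.ofReal (P.lam ξ ^ 2) * ‖fourierL2 (mult P.lamInv G) ξ‖ₑ ^ 2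
      = ENNReal.ofReal (‖G‖ ^ 2) := by
  rw [lintegral_mul_enorm_sq_lamInv, ← lintegral_enorm_sq_fourierL2]
  refine lintegral_congr fun ξ => ?_
  have := P.lam_pos ξ
  rw [← ENNReal.ofReal_mul (by positivity), mul_inv_cancel₀ (by positivity), ENNReal.ofReal_one,
    one_mul]

theorem ofReal_norm_sq_le_sobolevSq_one (G : L2) :
    ENNReal.ofReal (‖G‖ ^ 2) ≤ ENNReal.ofReal (1 + P.α ^ 2) * sobolevSq 1 (mult P.lamInv G) :=
  (P.lintegral_lam_sq_lamInv G).symm.trans_le (P.lintegral_lam_sq_le _)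

end Params

theorem ofReal_norm_sq_le_sobolevSq (k : ℕ) (g : L2) : ENNReal.ofReal (‖g‖ ^ 2) ≤ sobolevSq k g := by
  rw [← lintegral_enorm_sq_fourierL2, sobolevSq]
  refine lintegral_mono fun ξ => ?_
  refine le_mul_of_one_le_left' (ENNReal.one_le_ofReal.mpr (one_le_pow₀ ?_))
  nlinarith [sq_nonneg (2 * Real.pi * ‖ξ‖)]

namespace Params

variable (P : Params)

/-! ### Derivatives of `u = Λ⁻¹ U` -/

theorem lineDeriv_lamInv (j : Fin 3) (G : L2) :
    ∂_{e j} (toDist (mult P.lamInv G)) = toDist (mult (P.dLamInv j) G) :=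
  lineDeriv_toDist_mult j (fun ξ => by
    rw [lamInv_apply, dLamInv_apply]; push_cast; ring) G

theorem weakPartial_lamInv (j : Fin 3) (G : L2) :
    weakPartial j (mult P.lamInv G) = mult (P.dLamInv j) G := by
  have h : ∃ g' : L2, toDist g' = ∂_{e j} (toDist (mult P.lamInv G)) :=
    ⟨_, (P.lineDeriv_lamInv j G).symm⟩
  rw [weakPartial, dif_pos h]
  exact toDist_injective (h.choose_spec.trans (P.lineDeriv_lamInv j G))

theorem divFree_lamInv_iff (V : VecL2) : DivFree (fun i => mult P.lamInv (V i)) ↔ P.dvg V = 0 := by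
  rw [DivFree]
  simp only [lineDeriv_lamInv]
  rw [← toDist_sum, ← toDist_zero]
  exact toDist_injective.eq_iff

/-- The polarised energy identity. The adjoint of `∂ⱼΛ⁻¹` is its negative, so everything reduces to
`Λ⁻² - α² ∑ (∂ⱼΛ⁻¹)² = 1`. -/
theorem inner_lamInv_add (F U : L2) : inner ℝ (mult P.lamInv F) (mult P.lamInv U)
    + P.α ^ 2 * ∑ j, inner ℝ (mult (P.dLamInv j) F) (mult (P.dLamInv j) U) = inner ℝ F U := by
  have hc : P.lamInv.conj = P.lamInv := by
    ext ξ; rw [Symbol.conj_apply, lamInv_apply, Complex.conj_ofReal]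
  have hs : P.lamInv * P.lamInv - P.α ^ 2 • ∑ j, P.dLamInv j * P.dLamInv j = 1 := by
    ext ξ
    have h := sum_coord_sq ξ
    have h2 := P.lam_sq ξ
    have h3 := P.lam_ne ξ
    simp only [Fin.sum_univ_three] at h ⊢
    simp only [Symbol.sub_apply, Symbol.mul_apply, Symbol.smul_apply, Symbol.add_apply,
      lamInv_apply, dLamInv_apply, Symbol.one_apply]
    have h4 : ((P.lam ξ)⁻¹ ^ 2 * (1 + P.α ^ 2 * ((2 * Real.pi * ξ 0) ^ 2 + (2 * Real.pi * ξ 1) ^ 2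
        + (2 * Real.pi * ξ 2) ^ 2)) : ℝ) = 1 := by
      rw [h, ← h2]; field_simp
    have h5 := congrArg (Complex.ofReal) h4
    push_cast at h5 ⊢
    rw [← h5]
    ring_nf
    rw [Complex.I_sq]
    ring
  have h1 : inner ℝ F U = inner ℝ F (mult (P.lamInv * P.lamInv
      - P.α ^ 2 • ∑ j, P.dLamInv j * P.dLamInv j) U) := by rw [hs, mult_one_apply]
  rw [h1, inner_mult_left, hc]
  simp only [inner_dLamInv_left]
  rw [mult_sub_apply, mult_smul_apply, mult_sum_apply, inner_sub_right, inner_smul_right, inner_sum,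
    Finset.sum_neg_distrib]
  simp only [mult_mul_apply]
  ring

theorem vecInner_add_gradInner (F U : VecL2) :
    vecInner (fun i => mult P.lamInv (F i)) (fun i => mult P.lamInv (U i))
      + P.α ^ 2 * gradInner (fun i => mult P.lamInv (F i)) (fun i => mult P.lamInv (U i))
      = ∑ i, inner ℝ (F i) (U i) := by
  simp only [vecInner, gradInner, weakPartial_lamInv]
  rw [Finset.mul_sum, ← Finset.sum_add_distrib]
  exact Finset.sum_congr rfl fun i _ => P.inner_lamInv_add _ _

end Params

/-! ### Regularity of the pressure -/

namespace Params

variable (P : Params)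

theorem inner_lamInv_left (g h : L2) :
    inner ℝ (mult P.lamInv g) h = inner ℝ g (mult P.lamInv h) := by
  have hc : P.lamInv.conj = P.lamInv := by
    ext ξ; rw [Symbol.conj_apply, lamInv_apply, Complex.conj_ofReal]
  rw [inner_mult_left, hc]

/-- Both sides are the integral of `(Λ⁻¹B)(Λ⁻¹C)(Λ⁻¹D)`. -/
theorem inner_Q_lamInv (B C D : L2) :
    inner ℝ (P.Q B C) (mult P.lamInv D) = inner ℝ (P.Q B D) (mult P.lamInv C) := by
  rw [L2.inner_def, L2.inner_def]
  apply integral_congr_ae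
  filter_upwards [P.coeFn_Q B C, P.coeFn_Q B D] with x a b
  simp only [a, b, RCLike.inner_apply, conj_trivial]
  ring

/-- The product rule for `∂ⱼ`, with `Λ⁻¹` applied to both sides so that only bounded operators
occur. It follows from the cyclic identity by duality against an arbitrary `C`. -/
theorem dLamInv_Q_lamInv (j : Fin 3) (a b : L2) :
    mult (P.dLamInv j) (P.Q (mult P.lamInv a) (mult P.lamInv b)) =
      mult P.lamInv (P.Q (mult P.lamInv b) (mult (P.dLamInv j) a)
        + P.Q (mult P.lamInv a) (mult (P.dLamInv j) b)) := by
  refine ext_inner_right ℝ fun C => ?_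
  have h := P.inner_Q_cyclic j (mult P.lamInv a) (mult P.lamInv b) C
  rw [inner_dLamInv_left, inner_lamInv_left, inner_add_left]
  rw [mult_comm (P.dLamInv j) P.lamInv a, mult_comm (P.dLamInv j) P.lamInv b,
    P.inner_Q_lamInv (mult P.lamInv b), P.Q_comm C, P.inner_Q_lamInv (mult P.lamInv a)] at h
  linarith

theorem dLamInv_presB (l : Fin 3) (W : VecL2) :
    mult (P.dLamInv l) (P.presB (fun i => mult P.lamInv (W i)) (fun i => mult P.lamInv (W i))) =
      mult P.lamInv (P.presB (fun i => mult (P.dLamInv l) (W i)) (fun i => mult P.lamInv (W i))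
        + P.presB (fun i => mult P.lamInv (W i)) (fun i => mult (P.dLamInv l) (W i))) := by
  simp only [presB_apply, ← Finset.sum_add_distrib, map_sum]
  refine Finset.sum_congr rfl fun j _ => Finset.sum_congr rfl fun k _ => ?_
  rw [mult_comm, dLamInv_Q_lamInv, mult_comm, ← map_add,
    P.Q_comm (mult P.lamInv (W k))]

/-- The hypothesis says that `∂ⱼ g = h j`, so `g ∈ H¹`, and `Λ⁻²` gains two further derivatives. -/
theorem sobolevSq_three_le {g : L2} {h : Fin 3 → L2}
    (hgh : ∀ j, mult (P.dLamInv j) g = mult P.lamInv (h j)) :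
    sobolevSq 3 (mult (P.lamInv * P.lamInv) g)
      ≤ ENNReal.ofReal ((1 + P.α⁻¹ ^ 2) ^ 2 * (‖g‖ ^ 2 + ∑ j, ‖h j‖ ^ 2)) := by
  rw [ENNReal.ofReal_mul (by positivity), ENNReal.ofReal_add (by positivity) (by positivity),
    ENNReal.ofReal_sum_of_nonneg fun _ _ => by positivity]
  simp only [← lintegral_enorm_sq_fourierL2]
  rw [← lintegral_finsetSum _ fun j _ =>
      (Lp.stronglyMeasurable _).measurable.enorm.pow_const 2,
    ← lintegral_add_left ((Lp.stronglyMeasurable _).measurable.enorm.pow_const 2),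
    ← lintegral_const_mul' _ _ ENNReal.ofReal_ne_top, sobolevSq]
  refine lintegral_mono_ae ?_
  have h1 : ∀ᵐ ξ : Space, ∀ j, Complex.I * ((2 * Real.pi * ξ j : ℝ) : ℂ) * fourierL2 g ξ
      = fourierL2 (h j) ξ := by
    rw [ae_all_iff]
    intro j
    have h2 := fourierL2_mult (P.dLamInv j) g
    rw [hgh j] at h2
    filter_upwards [h2, fourierL2_mult P.lamInv (h j)] with ξ a b
    rw [b, lamInv_apply, dLamInv_apply] at a
    have h3 : (P.lam ξ : ℂ) ≠ 0 := by exact_mod_cast P.lam_ne ξ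
    push_cast at a ⊢
    field_simp at a
    linear_combination -a
  filter_upwards [h1, fourierL2_mult (P.lamInv * P.lamInv) g] with ξ a b
  have hlam := P.lam_pos ξ
  have h4 : ∀ j, ‖fourierL2 (h j) ξ‖ₑ ^ 2
      = ENNReal.ofReal ((2 * Real.pi * ξ j) ^ 2) * ‖fourierL2 g ξ‖ₑ ^ 2 := by
    intro j
    rw [← a j, enorm_mul, enorm_mul, mul_pow, mul_pow, ← ofReal_norm Complex.I, Complex.norm_I,
      ← ofReal_norm (Complex.ofReal _), Complex.norm_real, ← ENNReal.ofReal_pow (norm_nonneg _),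
      Real.norm_eq_abs, sq_abs]
    simp
  simp only [h4]
  rw [← Finset.sum_mul, ← ENNReal.ofReal_sum_of_nonneg fun _ _ => by positivity, sum_coord_sq, b,
    Symbol.mul_apply, lamInv_apply, enorm_mul, enorm_mul, ← ofReal_norm (Complex.ofReal _),
    Complex.norm_real, Real.norm_of_nonneg (by positivity), ← one_add_mul, ← mul_assoc,
    ← ENNReal.ofReal_one, ← ENNReal.ofReal_add (by positivity) (by positivity),
    ← ENNReal.ofReal_mul (by positivity), ← ENNReal.ofReal_mul (by positivity),
    mul_pow (ENNReal.ofReal _),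
    ← ENNReal.ofReal_pow (by positivity), ← mul_assoc, ← ENNReal.ofReal_mul (by positivity)]
  refine mul_le_mul_left (ENNReal.ofReal_le_ofReal ?_) _
  have h5 := P.one_add_eta_sq_le ξ
  have h6 : (1 + eta ξ ^ 2) * (P.lam ξ ^ 2)⁻¹ ≤ 1 + P.α⁻¹ ^ 2 := by
    rwa [← div_eq_mul_inv, div_le_iff₀ (by positivity)]
  calc (1 + eta ξ ^ 2) ^ 3 * ((P.lam ξ)⁻¹ * (P.lam ξ)⁻¹) ^ 2
      = ((1 + eta ξ ^ 2) * (P.lam ξ ^ 2)⁻¹) ^ 2 * (1 + eta ξ ^ 2) := by field_simp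
    _ ≤ (1 + P.α⁻¹ ^ 2) ^ 2 * (1 + eta ξ ^ 2) := by gcongr

theorem lam_sq_le_gen (ξ : Space) :
    P.lam ξ ^ 2 ≤ (P.β⁻¹ + P.α ^ 2 * P.ν⁻¹) * P.gen ξ := by
  have hβ := P.hβ
  have hν := P.hν
  rw [lam_sq, gen]
  have h : (P.β⁻¹ + P.α ^ 2 * P.ν⁻¹) * (P.β + P.ν * eta ξ ^ 2)
      = 1 + P.α ^ 2 * eta ξ ^ 2 + P.β⁻¹ * P.ν * eta ξ ^ 2 + P.α ^ 2 * P.ν⁻¹ * P.β := by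
    field_simp; ring
  rw [h]
  have : 0 ≤ P.β⁻¹ * P.ν * eta ξ ^ 2 := by positivity
  have : 0 ≤ P.α ^ 2 * P.ν⁻¹ * P.β := by positivity
  linarith

theorem exists_lamInv_eq_of_genSq {U : L2} (hU : P.genSq U ≠ ⊤) : ∃ W : L2, U = mult P.lamInv W ∧
    ENNReal.ofReal (‖W‖ ^ 2) ≤ ENNReal.ofReal (P.β⁻¹ + P.α ^ 2 * P.ν⁻¹) * P.genSq U := by
  have hβ := P.hβ
  have hν := P.hν
  have h : ∫⁻ ξ : Space, ENNReal.ofReal (P.lam ξ ^ 2) * ‖fourierL2 U ξ‖ₑ ^ 2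
      ≤ ENNReal.ofReal (P.β⁻¹ + P.α ^ 2 * P.ν⁻¹) * P.genSq U := by
    rw [genSq, ← lintegral_const_mul' _ _ ENNReal.ofReal_ne_top]
    refine lintegral_mono fun ξ => ?_
    rw [← mul_assoc, ← ENNReal.ofReal_mul (by positivity)]
    gcongr
    exact P.lam_sq_le_gen ξ
  obtain ⟨W, rfl⟩ := P.exists_lamInv_eq
    (ne_top_of_le_ne_top (ENNReal.mul_ne_top ENNReal.ofReal_ne_top hU) h)
  exact ⟨W, rfl, (P.lintegral_lam_sq_lamInv W).symm.trans_le h⟩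

theorem norm_lamInv_apply_le (g : L2) : ‖mult P.lamInv g‖ ≤ ‖g‖ := by
  refine (norm_mult_apply_le P.lamInv (C := 1) (fun ξ => ?_) g).trans_eq (one_mul _)
  have := P.lam_pos ξ
  rw [lamInv_apply, Complex.norm_real, Real.norm_of_nonneg (by positivity)]
  exact inv_le_one_of_one_le₀ (P.one_le_lam ξ)

theorem norm_dLamInv_apply_le (j : Fin 3) (g : L2) : ‖mult (P.dLamInv j) g‖ ≤ P.α⁻¹ * ‖g‖ := by
  refine norm_mult_apply_le _ (fun ξ => ?_) g
  rw [dLamInv_apply, norm_mul, Complex.norm_I, one_mul, Complex.norm_real, Real.norm_eq_abs,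
    abs_mul, abs_of_pos (inv_pos.mpr (P.lam_pos ξ)), ← div_eq_mul_inv,
    div_le_iff₀ (P.lam_pos ξ), inv_mul_eq_div, le_div_iff₀ P.hα, mul_comm]
  exact (mul_le_mul_of_nonneg_left (abs_coord_le_eta ξ j) P.hα.le).trans (P.alpha_eta_le_lam ξ)

/-- The pressure associated with `U = Λ u`. -/
def pres (U : VecL2) : L2 := mult (P.lamInv * P.lamInv) (P.presB U U)

theorem norm_presB_apply_le (U V : VecL2) : ‖P.presB U V‖ ≤ ‖P.presB‖ * ‖U‖ * ‖V‖ :=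
  ContinuousLinearMap.le_opNorm₂ _ _ _

theorem continuous_pres : Continuous P.pres := by
  have h : Continuous fun U => P.presB U U := P.presB.continuous.clm_apply continuous_id
  exact (mult _).continuous.comp h

theorem sobolevSq_pres_lamInv_le (W : VecL2) :
    sobolevSq 3 (P.pres (fun i => mult P.lamInv (W i))) ≤
      ENNReal.ofReal ((1 + P.α⁻¹ ^ 2) ^ 2 * (‖P.presB‖ ^ 2 * (1 + 12 * P.α⁻¹ ^ 2))
        * ‖(fun i => mult P.lamInv (W i) : VecL2)‖ ^ 2 * ‖W‖ ^ 2) := by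
  have hK : 0 ≤ ‖P.presB‖ := ContinuousLinearMap.opNorm_nonneg P.presB
  have hα := P.hα
  refine (P.sobolevSq_three_le fun j => P.dLamInv_presB j W).trans (ENNReal.ofReal_le_ofReal ?_)
  set U : VecL2 := fun i => mult P.lamInv (W i)
  have hUW : ‖U‖ ≤ ‖W‖ := (pi_norm_le_iff_of_nonneg (norm_nonneg _)).mpr fun i =>
    (P.norm_lamInv_apply_le _).trans (norm_le_pi_norm W i)
  have hTW : ∀ j, ‖(fun i => mult (P.dLamInv j) (W i) : VecL2)‖ ≤ P.α⁻¹ * ‖W‖ := fun j =>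
    (pi_norm_le_iff_of_nonneg (by positivity)).mpr fun i =>
      (P.norm_dLamInv_apply_le j _).trans
        (mul_le_mul_of_nonneg_left (norm_le_pi_norm W i) (by positivity))
  have h1 : ‖P.presB U U‖ ≤ ‖P.presB‖ * ‖U‖ * ‖W‖ :=
    (P.norm_presB_apply_le U U).trans (by gcongr)
  have h2 : ∀ j, ‖P.presB (fun i => mult (P.dLamInv j) (W i)) U
      + P.presB U (fun i => mult (P.dLamInv j) (W i))‖
      ≤ 2 * P.α⁻¹ * (‖P.presB‖ * ‖U‖ * ‖W‖) := by
    intro j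
    refine (norm_add_le_of_le (P.norm_presB_apply_le _ _) (P.norm_presB_apply_le _ _)).trans ?_
    have h3 := mul_le_mul_of_nonneg_left (hTW j) (mul_nonneg hK (norm_nonneg U))
    linarith
  -- The constant `12 = 3 · 2²` comes from three derivatives, each a sum of two terms by the product
  -- rule.
  calc _ ≤ (1 + P.α⁻¹ ^ 2) ^ 2 * ((‖P.presB‖ * ‖U‖ * ‖W‖) ^ 2
        + ∑ _j : Fin 3, (2 * P.α⁻¹ * (‖P.presB‖ * ‖U‖ * ‖W‖)) ^ 2) := by
        gcongr with j _
        exact h2 j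
    _ = _ := by
      rw [Finset.sum_const, Finset.card_univ, Fintype.card_fin, nsmul_eq_mul]
      push_cast; ring

/-- One factor of the quadratic pressure is measured by `‖U‖`, bounded in time, and the other by the
dissipation, integrable in time. Together they give `p ∈ L²_loc H³`. -/
theorem exists_sobolevSq_pres_le : ∃ C : ℝ, 0 ≤ C ∧ ∀ U : VecL2, (∀ i, P.genSq (U i) ≠ ⊤) →
    sobolevSq 3 (P.pres U) ≤ ENNReal.ofReal (C * ‖U‖ ^ 2) * ∑ i, P.genSq (U i) := by
  have hβ := P.hβ
  have hν := P.hν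
  refine ⟨(1 + P.α⁻¹ ^ 2) ^ 2 * (‖P.presB‖ ^ 2 * (1 + 12 * P.α⁻¹ ^ 2))
    * (P.β⁻¹ + P.α ^ 2 * P.ν⁻¹), ?_, fun U hU => ?_⟩
  · have := sq_nonneg ‖P.presB‖
    positivity
  choose W hW hWU using fun i => P.exists_lamInv_eq_of_genSq (hU i)
  obtain rfl : U = fun i => mult P.lamInv (W i) := funext hW
  have h1 : ENNReal.ofReal (‖W‖ ^ 2) ≤ ENNReal.ofReal (P.β⁻¹ + P.α ^ 2 * P.ν⁻¹)
      * ∑ i, P.genSq (mult P.lamInv (W i)) := by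
    have h2 : ‖W‖ ^ 2 ≤ ∑ i, ‖W i‖ ^ 2 := by
      have h3 : ‖W‖ ≤ √(∑ i, ‖W i‖ ^ 2) := (pi_norm_le_iff_of_nonneg (Real.sqrt_nonneg _)).mpr
        fun i => Real.le_sqrt_of_sq_le
          (Finset.single_le_sum (f := fun i => ‖W i‖ ^ 2) (fun _ _ => by positivity)
            (Finset.mem_univ i))
      calc ‖W‖ ^ 2 ≤ √(∑ i, ‖W i‖ ^ 2) ^ 2 := by gcongr
        _ = _ := Real.sq_sqrt (by positivity)
    refine (ENNReal.ofReal_le_ofReal h2).trans ?_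
    rw [ENNReal.ofReal_sum_of_nonneg fun _ _ => by positivity, Finset.mul_sum]
    exact Finset.sum_le_sum fun i _ => hWU i
  refine (P.sobolevSq_pres_lamInv_le W).trans ?_
  have hK : 0 ≤ ‖P.presB‖ ^ 2 := sq_nonneg _
  rw [ENNReal.ofReal_mul (by positivity)]
  refine (mul_le_mul_right h1 _).trans_eq ?_
  rw [← mul_assoc, ← ENNReal.ofReal_mul (by positivity)]
  congr 2
  ring

end Params

/-! ### The equation tested with lifted functions -/

namespace Params

variable (P : Params)

/-- The symbol of `Λ (1 + A)⁻¹`. -/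
def liftSym (ξ : Space) : ℝ := P.lam ξ * (1 + P.gen ξ)⁻¹

theorem one_add_gen_eq (ξ : Space) : 1 + P.gen ξ = (1 + P.β) + P.ν * eta ξ ^ 2 := by
  rw [gen]; ring

theorem hasTemperateGrowth_liftSym :
    (fun ξ => (P.liftSym ξ : ℂ)).HasTemperateGrowth := by
  have hα := P.hα
  have hβ := P.hβ
  apply hasTemperateGrowth_ofReal_comp
  have h1 := hasTemperateGrowth_quadratic_sqrt one_pos (pow_pos hα 2)
  have h2 := hasTemperateGrowth_quadratic_inv (add_pos one_pos hβ) P.hν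
  simp only [← one_add_gen_eq] at h2
  exact h1.mul h2

theorem hasTemperateGrowth_liftSym_inv :
    (fun ξ => (((P.liftSym ξ)⁻¹ : ℝ) : ℂ)).HasTemperateGrowth := by
  have hα := P.hα
  have hβ := P.hβ
  apply hasTemperateGrowth_ofReal_comp
  have h1 := hasTemperateGrowth_quadratic_sqrt_inv one_pos (pow_pos hα 2)
  have h2 := hasTemperateGrowth_quadratic (add_pos one_pos hβ) P.hν
  simp only [← one_add_gen_eq] at h2
  have h3 := h1.mul h2
  refine (congrArg _ (funext fun ξ => ?_)).mp h3
  rw [liftSym, mul_inv, inv_inv]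
  rfl

theorem liftSym_ne (ξ : Space) : P.liftSym ξ ≠ 0 := by
  have := P.gen_pos ξ
  exact mul_ne_zero (P.lam_ne ξ) (by positivity)

/-- The action of `Λ (1 + A)⁻¹` on test functions. -/
def lift (ψ : 𝓢(Space, ℂ)) : 𝓢(Space, ℂ) :=
  𝓕 (SchwartzMap.smulLeftCLM ℂ (fun ξ => (P.liftSym ξ : ℂ)) (𝓕⁻ ψ))

theorem fourierInv_lift (ψ : 𝓢(Space, ℂ)) (ξ : Space) :
    (𝓕⁻ (P.lift ψ) : 𝓢(Space, ℂ)) ξ = (P.liftSym ξ : ℂ) * (𝓕⁻ ψ : 𝓢(Space, ℂ)) ξ := by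
  rw [lift, FourierTransform.fourierInv_fourier_eq,
    SchwartzMap.smulLeftCLM_apply_apply P.hasTemperateGrowth_liftSym, smul_eq_mul]

/-- The symbol and its inverse both have temperate growth. Hence testing with lifted functions loses
no information. -/
theorem lift_surjective : Function.Surjective P.lift := by
  intro ψ
  refine ⟨𝓕 (SchwartzMap.smulLeftCLM ℂ (fun ξ => (((P.liftSym ξ)⁻¹ : ℝ) : ℂ)) (𝓕⁻ ψ)), ?_⟩
  rw [lift, FourierTransform.fourierInv_fourier_eq]
  have h : SchwartzMap.smulLeftCLM ℂ (fun ξ => (P.liftSym ξ : ℂ))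
      (SchwartzMap.smulLeftCLM ℂ (fun ξ => (((P.liftSym ξ)⁻¹ : ℝ) : ℂ)) (𝓕⁻ ψ)) = 𝓕⁻ ψ := by
    ext ξ
    rw [SchwartzMap.smulLeftCLM_apply_apply P.hasTemperateGrowth_liftSym,
      SchwartzMap.smulLeftCLM_apply_apply P.hasTemperateGrowth_liftSym_inv, smul_smul,
      ← Complex.ofReal_mul, mul_inv_cancel₀ (P.liftSym_ne ξ), Complex.ofReal_one, one_smul]
  rw [h, FourierTransform.fourier_fourierInv_eq]

theorem toDist_lift {m₁ m₂ : Symbol} (h : ∀ ξ, (P.liftSym ξ : ℂ) * m₁ ξ = m₂ ξ) (g : L2)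
    (ψ : 𝓢(Space, ℂ)) : toDist (mult m₁ g) (P.lift ψ) = distL ψ (mult m₂ g) := by
  rw [distL_apply, toDist_apply, toDist_apply]
  apply integral_congr_ae
  filter_upwards [fourierL2_mult m₁ g, fourierL2_mult m₂ g] with ξ a b
  rw [a, b, fourierInv_lift, ← h]
  ring

theorem lineDeriv_lift (j : Fin 3) {m₁ m₂ : Symbol}
    (h : ∀ ξ, Complex.I * ((2 * Real.pi * ξ j : ℝ) : ℂ) * ((P.liftSym ξ : ℂ) * m₁ ξ) = m₂ ξ)
    (g : L2) (ψ : 𝓢(Space, ℂ)) :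
    (∂_{e j} (toDist (mult m₁ g))) (P.lift ψ) = distL ψ (mult m₂ g) := by
  rw [TemperedDistribution.lineDeriv_eq_fourierMultiplierCLM]
  have hc : (fun ξ : Space => ((inner ℝ ξ (e j) : ℝ) : ℂ)).HasTemperateGrowth := by fun_prop
  rw [smul_apply, TemperedDistribution.fourierMultiplierCLM_apply_apply, distL_apply, toDist_apply,
    toDist_apply, FourierTransform.fourierInv_fourier_eq, smul_eq_mul, ← integral_const_mul]
  apply integral_congr_ae
  filter_upwards [fourierL2_mult m₁ g, fourierL2_mult m₂ g] with ξ a b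
  rw [a, b, SchwartzMap.smulLeftCLM_apply_apply hc, smul_eq_mul, ← h, inner_e, fourierInv_lift]
  push_cast
  ring

theorem laplacian_lift {m₁ m₂ : Symbol}
    (h : ∀ ξ, -((eta ξ : ℂ) ^ 2) * ((P.liftSym ξ : ℂ) * m₁ ξ) = m₂ ξ)
    (g : L2) (ψ : 𝓢(Space, ℂ)) :
    (Δ (toDist (mult m₁ g))) (P.lift ψ) = distL ψ (mult m₂ g) := by
  rw [TemperedDistribution.laplacian_eq_fourierMultiplierCLM]
  have hc : (fun ξ : Space => Complex.ofReal (‖ξ‖ ^ 2)).HasTemperateGrowth := by fun_prop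
  rw [smul_apply, TemperedDistribution.fourierMultiplierCLM_apply_apply, distL_apply, toDist_apply,
    toDist_apply, FourierTransform.fourierInv_fourier_eq, Complex.real_smul, ← integral_const_mul]
  apply integral_congr_ae
  filter_upwards [fourierL2_mult m₁ g, fourierL2_mult m₂ g] with ξ a b
  rw [a, b, SchwartzMap.smulLeftCLM_apply_apply hc, smul_eq_mul, ← h, fourierInv_lift, eta]
  push_cast
  ring

theorem filtering_toDist (g : L2) :
    filtering P.α (toDist g) = toDist (mult (P.lamInv * P.lamInv) g) := by
  have hα := P.hα
  have h := hasTemperateGrowth_quadratic_inv one_pos (pow_pos hα 2)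
  refine fourierMultiplier_toDist ?_ (fun ξ => ?_) g
  · refine hasTemperateGrowth_ofReal_comp ((congrArg _ (funext fun ξ => ?_)).mp h)
    rw [add_comm]; rfl
  · rw [Symbol.mul_apply, lamInv_apply, ← Complex.ofReal_mul, ← mul_inv, ← sq, lam_sq, add_comm]
    rfl

theorem liftSym_mul_lamInv (ξ : Space) : (P.liftSym ξ : ℂ) * P.lamInv ξ = P.res ξ := by
  have := P.lam_ne ξ
  rw [lamInv_apply, res_apply, ← Complex.ofReal_mul, liftSym]
  congr 1
  field_simp

/-- The resolvent of the right-hand side of the evolution equation for `V = Λ v` with a general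
pressure `q`. -/
def rhsRes (F V : VecL2) (q : L2) (i : Fin 3) : L2 :=
  mult P.res (V i) - V i + mult P.res (F i)
    - ∑ j, mult P.res (mult (P.dLamInv j) (P.Q (V i) (V j))) - mult (P.dLamRes i) q

/-- Multiplication by the symbol of `Λ (1 + A)⁻¹` makes every term of the right-hand side a bounded
operator on `L²`. -/
theorem rhs_lift (F V : VecL2) (q : L2) (i : Fin 3) (ψ : 𝓢(Space, ℂ)) :
    rhs P.ν P.α P.β (fun i => mult P.lamInv (F i)) (fun i => mult P.lamInv (V i)) q i (P.lift ψ)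
      = distL ψ (P.rhsRes F V q i) := by
  have hν := P.hν.ne'
  -- From `ν eta² = (1 + gen) - (1 + β)`; together with the damping term this will combine into `(1
  -- + A)⁻¹ - 1`.
  have h1 : (Δ (toDist (mult P.lamInv (V i)))) (P.lift ψ)
      = distL ψ (mult (P.ν⁻¹ • ((1 + P.β) • P.res - 1)) (V i)) := by
    refine P.laplacian_lift (fun ξ => ?_) _ ψ
    have hg := P.gen_pos ξ
    have h2 : ((-(eta ξ ^ 2) * (1 + P.gen ξ)⁻¹ : ℝ) : ℂ)
        = ((P.ν⁻¹ * ((1 + P.β) * (1 + P.gen ξ)⁻¹ - 1) : ℝ) : ℂ) := by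
      congr 1
      field_simp
      rw [gen]; ring
    rw [liftSym_mul_lamInv, Symbol.smul_apply, Symbol.sub_apply, Symbol.smul_apply,
      Symbol.one_apply, res_apply]
    push_cast at h2 ⊢
    exact h2
  have h3 := P.toDist_lift P.liftSym_mul_lamInv (F i) ψ
  have h4 := P.toDist_lift P.liftSym_mul_lamInv (V i) ψ
  have h5 : (∂_{e i} (toDist q)) (P.lift ψ) = distL ψ (mult (P.dLamRes i) q) := by
    have := P.lineDeriv_lift i (m₁ := 1) (m₂ := P.dLamRes i) (fun ξ => by
      rw [dLamRes_apply, Symbol.one_apply, liftSym]; push_cast; ring) q ψ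
    rwa [mult_one_apply] at this
  have h6 : ∀ j, (∂_{e j} (filtering P.α
      (toDist (mulL1 (mult P.lamInv (V i)) (mult P.lamInv (V j)))))) (P.lift ψ)
      = distL ψ (mult P.res (mult (P.dLamInv j) (P.Q (V i) (V j)))) := by
    intro j
    rw [toDist_mulL1_mult_lamInv, filtering_toDist, ← mult_mul_apply]
    refine P.lineDeriv_lift j (fun ξ => ?_) _ ψ
    rw [Symbol.mul_apply, ← mul_assoc (P.liftSym ξ : ℂ), liftSym_mul_lamInv, Symbol.mul_apply,
      dLamInv_apply, lamInv_apply]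
    push_cast
    ring
  have h7 : rhs P.ν P.α P.β (fun i => mult P.lamInv (F i)) (fun i => mult P.lamInv (V i)) q i
      (P.lift ψ) = (P.ν : ℂ) * (Δ (toDist (mult P.lamInv (V i)))) (P.lift ψ)
      + toDist (mult P.lamInv (F i)) (P.lift ψ)
      - (P.β : ℂ) * toDist (mult P.lamInv (V i)) (P.lift ψ) - (∂_{e i} (toDist q)) (P.lift ψ)
      - ∑ j, (∂_{e j} (filtering P.α
      (toDist (mulL1 (mult P.lamInv (V i)) (mult P.lamInv (V j)))))) (P.lift ψ) := by
    rw [rhs, sub_apply, sub_apply, sub_apply, add_apply, sum_apply]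
    rfl
  rw [h7, h1, h3, h4, h5]
  simp only [h6]
  rw [← map_sum, mult_smul_apply, mult_sub_apply, mult_smul_apply, mult_one_apply, rhsRes]
  simp only [map_sub, map_add, map_smul, Complex.real_smul]
  have hνc : (P.ν : ℂ) ≠ 0 := by exact_mod_cast hν
  push_cast
  field_simp
  ring

theorem rhsRes_pres (F V : VecL2) (i : Fin 3) :
    P.rhsRes F V (P.pres V) i
      = mult P.res (V i) - V i + mult P.res (P.forcing F V i) := by
  have h1 : mult (P.dLamRes i) (P.pres V) = mult P.res (mult (P.dLamInv i) (P.presB V V)) := by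
    rw [pres, ← mult_mul_apply, ← mult_mul_apply, res_mul_dLamInv, mul_comm]
  rw [rhsRes, h1, forcing, nlB_apply, map_sub, map_add, map_sum]
  abel

/-- The weak form of the equation, tested with lifted functions. -/
theorem isWeakSolution_iff {F V₀ : VecL2} {v V : ℝ → VecL2} {q : ℝ → L2}
    (hv : ∀ᵐ t ∂volume.restrict (Ici (0 : ℝ)), v t = fun i => mult P.lamInv (V t i)) :
    IsWeakSolution P.ν P.α P.β (fun i => mult P.lamInv (F i)) (fun i => mult P.lamInv (V₀ i)) v q ↔
      (∀ᵐ t ∂volume.restrict (Ici (0 : ℝ)), P.dvg (V t) = 0) ∧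
      ∀ (i : Fin 3) (ψ : 𝓢(Space, ℂ)) (θ : ℝ → ℝ), ContDiff ℝ ∞ θ → HasCompactSupport θ →
        -(∫ t in Ioi (0 : ℝ), ((deriv θ t : ℝ) : ℂ) * distL ψ (mult P.res (V t i)))
            - ((θ 0 : ℝ) : ℂ) * distL ψ (mult P.res (V₀ i))
          = ∫ t in Ioi (0 : ℝ), ((θ t : ℝ) : ℂ) * distL ψ (P.rhsRes F (V t) (q t) i) := by
  have hv' : ∀ᵐ t ∂volume.restrict (Ioi (0 : ℝ)), v t = fun i => mult P.lamInv (V t i) :=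
    ae_restrict_of_ae_restrict_of_subset Ioi_subset_Ici_self hv
  rw [IsWeakSolution]
  refine and_congr ?_ (forall_congr' fun i => ?_)
  · refine eventually_congr ?_
    filter_upwards [hv] with t ht
    rw [ht, divFree_lamInv_iff]
  · rw [P.lift_surjective.forall]
    refine forall_congr' fun ψ => forall_congr' fun θ => forall_congr' fun _ =>
      forall_congr' fun _ => ?_
    rw [P.toDist_lift P.liftSym_mul_lamInv (V₀ i) ψ]
    have h1 : ∫ t in Ioi (0 : ℝ), ((deriv θ t : ℝ) : ℂ) * toDist (v t i) (P.lift ψ)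
        = ∫ t in Ioi (0 : ℝ), ((deriv θ t : ℝ) : ℂ) * distL ψ (mult P.res (V t i)) := by
      apply integral_congr_ae
      filter_upwards [hv'] with t ht
      rw [ht, P.toDist_lift P.liftSym_mul_lamInv (V t i) ψ]
    have h2 : ∫ t in Ioi (0 : ℝ), ((θ t : ℝ) : ℂ) * rhs P.ν P.α P.β
        (fun i => mult P.lamInv (F i)) (v t) (q t) i (P.lift ψ)
        = ∫ t in Ioi (0 : ℝ), ((θ t : ℝ) : ℂ) * distL ψ (P.rhsRes F (V t) (q t) i) := by
      apply integral_congr_ae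
      filter_upwards [hv'] with t ht
      rw [ht, rhs_lift]
    rw [h1, h2]

end Params

/-! ### Existence and the energy equality -/

/-- The derivative of `θ y` is integrated over the half-line: compact support removes the endpoint
at infinity, and the endpoint `0` gives the initial datum. -/
theorem integral_test_of_integral_eq {y r : ℝ → ℂ} (hy : Continuous y) (hr : Continuous r)
    (h : ∀ t, 0 ≤ t → y t = y 0 + ∫ s in (0 : ℝ)..t, r s) {θ : ℝ → ℝ} (hθ : ContDiff ℝ ∞ θ)
    (hθc : HasCompactSupport θ) :
    -(∫ t in Ioi (0 : ℝ), ((deriv θ t : ℝ) : ℂ) * y t) - ((θ 0 : ℝ) : ℂ) * y 0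
      = ∫ t in Ioi (0 : ℝ), ((θ t : ℝ) : ℂ) * r t := by
  have hθd : Continuous (deriv θ) := hθ.continuous_deriv (by simp)
  have hc1 : HasCompactSupport fun t => ((deriv θ t : ℝ) : ℂ) * y t :=
    (hθc.deriv.comp_left (g := Complex.ofReal) Complex.ofReal_zero).mul_right
  have hc2 : HasCompactSupport fun t => ((θ t : ℝ) : ℂ) * r t :=
    (hθc.comp_left (g := Complex.ofReal) Complex.ofReal_zero).mul_right
  have hc3 : HasCompactSupport fun t => ((θ t : ℝ) : ℂ) * y t :=
    (hθc.comp_left (g := Complex.ofReal) Complex.ofReal_zero).mul_right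
  have hθ0 := hθ.continuous
  have hi1 : Integrable fun t => ((deriv θ t : ℝ) : ℂ) * y t :=
    Continuous.integrable_of_hasCompactSupport (by fun_prop) hc1
  have hi2 : Integrable fun t => ((θ t : ℝ) : ℂ) * r t :=
    Continuous.integrable_of_hasCompactSupport (by fun_prop) hc2
  have hd : ∀ t ∈ Ioi (0 : ℝ), HasDerivAt (fun t => ((θ t : ℝ) : ℂ) * y t)
      (((deriv θ t : ℝ) : ℂ) * y t + ((θ t : ℝ) : ℂ) * r t) t := by
    intro t ht
    have h1 : HasDerivAt y (r t) t := hasDerivAt_of_integral_eq (T := t + 1)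
      (fun s hs => h s hs.1.le) hr ⟨ht, by linarith⟩
    exact ((hθ.differentiable (by simp)) t).hasDerivAt.ofReal_comp.mul h1
  have h0 := integral_Ioi_of_hasDerivAt_of_tendsto (a := 0) (m := 0)
    (f := fun t => ((θ t : ℝ) : ℂ) * y t)
    (by apply Continuous.continuousWithinAt; fun_prop) hd (hi1.add hi2).integrableOn
    (hc3.is_zero_at_infty.mono_left atTop_le_cocompact)
  rw [integral_add hi1.integrableOn hi2.integrableOn] at h0
  linear_combination -h0

namespace Params

variable (P : Params)

theorem isWeakSolution_of_mild {F U₀ : VecL2} {U : ℝ → VecL2} (hU : Continuous U)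
    (hU0 : U 0 = U₀) (hdiv : ∀ t, 0 ≤ t → P.dvg (U t) = 0)
    (h : ∀ t, 0 ≤ t → ∀ i, U t i = P.mild (U₀ i) (fun s => P.forcing F (U s) i) t) :
    IsWeakSolution P.ν P.α P.β (fun i => mult P.lamInv (F i)) (fun i => mult P.lamInv (U₀ i))
      (fun t i => mult P.lamInv (U t i)) (fun t => P.pres (U t)) := by
  rw [P.isWeakSolution_iff (V := U) (.of_forall fun t => rfl)]
  refine ⟨(ae_restrict_mem measurableSet_Ici).mono fun t ht => hdiv t ht, fun i ψ θ hθ hθc => ?_⟩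
  simp only [rhsRes_pres]
  have hF := P.continuous_forcing F
  have hr : Continuous fun s => mult P.res (U s i) - U s i + mult P.res (P.forcing F (U s) i) := by
    have : Continuous fun s => P.forcing F (U s) i := (continuous_apply i).comp (hF.comp hU)
    fun_prop
  rw [← hU0]
  refine integral_test_of_integral_eq (y := fun t => distL ψ (mult P.res (U t i)))
    (r := fun s => distL ψ (mult P.res (U s i) - U s i + mult P.res (P.forcing F (U s) i)))
    (by fun_prop) ((distL ψ).continuous.comp hr) (fun t ht => ?_) hθ hθc
  have h1 := P.res_eq_of_mild (U := fun t => U t i) (g := fun s => P.forcing F (U s) i)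
    ((continuous_apply i).comp (hF.comp hU)) (fun t ht => h t ht i) ht
  rw [h1, map_add, ← ContinuousLinearMap.intervalIntegral_comp_comm _ (hr.intervalIntegrable _ _)]

theorem homSobolevSq_one_ne_top (G : L2) : homSobolevSq 1 (mult P.lamInv G) ≠ ⊤ := by
  have hα := P.hα
  intro h
  have := P.norm_sq_add_homSobolevSq_one G
  rw [h, ENNReal.mul_top (by simp [hα.ne']), add_top] at this
  exact ENNReal.ofReal_ne_top this.symm

theorem norm_sq_add_toReal (G : L2) : ‖mult P.lamInv G‖ ^ 2
    + P.α ^ 2 * (homSobolevSq 1 (mult P.lamInv G)).toReal = ‖G‖ ^ 2 := by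
  have h := congrArg ENNReal.toReal (P.norm_sq_add_homSobolevSq_one G)
  rwa [ENNReal.toReal_add ENNReal.ofReal_ne_top
    (ENNReal.mul_ne_top ENNReal.ofReal_ne_top (P.homSobolevSq_one_ne_top G)), ENNReal.toReal_mul,
    ENNReal.toReal_ofReal (by positivity), ENNReal.toReal_ofReal (by positivity),
    ENNReal.toReal_ofReal (by positivity)] at h

/-- By `norm_sq_add_toReal` the `Ḣ¹` norm is a multiple of a difference of continuous squared norms.
-/
theorem continuous_homSobolevSq_one {U : ℝ → L2} (hU : Continuous U) :
    Continuous fun s => (homSobolevSq 1 (mult P.lamInv (U s))).toReal := by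
  have hα := P.hα
  have h : ∀ s, (homSobolevSq 1 (mult P.lamInv (U s))).toReal
      = (P.α ^ 2)⁻¹ * (‖U s‖ ^ 2 - ‖mult P.lamInv (U s)‖ ^ 2) := by
    intro s
    rw [← P.norm_sq_add_toReal (U s)]
    field_simp
    ring
  simp only [h]
  fun_prop

theorem homSobolevSq_two_ne_top {G : L2} (hG : P.genSq G ≠ ⊤) :
    homSobolevSq 2 (mult P.lamInv G) ≠ ⊤ := by
  have hα := P.hα
  have hν := P.hν
  intro h
  rw [genSq_eq, h, ENNReal.mul_top (by simp; positivity), add_top, top_add] at hG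
  exact hG rfl

theorem toReal_genSq {G : L2} (hG : P.genSq G ≠ ⊤) : (P.genSq G).toReal
    = P.ν * (homSobolevSq 1 (mult P.lamInv G)).toReal
      + P.ν * P.α ^ 2 * (homSobolevSq 2 (mult P.lamInv G)).toReal + P.β * ‖G‖ ^ 2 := by
  have hν := P.hν
  have hβ := P.hβ
  have h1 := ENNReal.mul_ne_top (ENNReal.ofReal_ne_top (r := P.ν)) (P.homSobolevSq_one_ne_top G)
  have h2 := ENNReal.mul_ne_top (ENNReal.ofReal_ne_top (r := P.ν * P.α ^ 2))
    (P.homSobolevSq_two_ne_top hG)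
  rw [genSq_eq, ENNReal.toReal_add (ENNReal.add_ne_top.mpr ⟨h1, h2⟩) ENNReal.ofReal_ne_top,
    ENNReal.toReal_add h1 h2, ENNReal.toReal_mul, ENNReal.toReal_mul,
    ENNReal.toReal_ofReal hν.le, ENNReal.toReal_ofReal (by positivity),
    ENNReal.toReal_ofReal (by positivity)]

theorem lintegral_genSq_ne_top {U g : ℝ → L2} (hU : Continuous U) (hg : Continuous g)
    (h : ∀ t, 0 ≤ t → mult P.res (U t) = mult P.res (U 0) +
      ∫ s in (0 : ℝ)..t, (mult P.res (U s) - U s + mult P.res (g s))) {t : ℝ} (ht : 0 ≤ t) :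
    ∫⁻ s in Ioc 0 t, P.genSq (U s) ≠ ⊤ := by
  intro htop
  have h1 := (P.energy_equality hU hg h ht).2
  rw [htop, ENNReal.mul_top (by norm_num)] at h1
  exact ENNReal.ofReal_ne_top h1.symm

/-- The `Ḣ²` norm is recovered almost everywhere from the dissipation by `toReal_genSq`, and
inherits its integrability in time from the other terms. -/
theorem energy_equality_toReal {U g : ℝ → L2} (hU : Continuous U) (hg : Continuous g)
    (h : ∀ t, 0 ≤ t → mult P.res (U t) = mult P.res (U 0) +
      ∫ s in (0 : ℝ)..t, (mult P.res (U s) - U s + mult P.res (g s))) {t : ℝ} (ht : 0 ≤ t) :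
    (∀ᵐ s ∂volume.restrict (Ioc 0 t), P.genSq (U s) ≠ ⊤) ∧
    IntervalIntegrable (fun s => (homSobolevSq 2 (mult P.lamInv (U s))).toReal) volume 0 t ∧
    ‖U t‖ ^ 2 + 2 * P.ν * (∫ s in (0 : ℝ)..t, (homSobolevSq 1 (mult P.lamInv (U s))).toReal)
      + 2 * P.ν * P.α ^ 2 * (∫ s in (0 : ℝ)..t, (homSobolevSq 2 (mult P.lamInv (U s))).toReal)
      = ‖U 0‖ ^ 2 + 2 * (∫ s in (0 : ℝ)..t, inner ℝ (U s) (g s))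
        - 2 * P.β * ∫ s in (0 : ℝ)..t, ‖U s‖ ^ 2 := by
  have hα := P.hα
  have hν := P.hν
  obtain ⟨hX, hE⟩ := P.energy_equality hU hg h ht
  have hm := P.measurable_genSq hU
  have htop := P.lintegral_genSq_ne_top hU hg h ht
  have hae : ∀ᵐ s ∂volume.restrict (Ioc 0 t), P.genSq (U s) < ⊤ := ae_lt_top hm htop
  have hint : IntervalIntegrable (fun s => (P.genSq (U s)).toReal) volume 0 t :=
    (intervalIntegrable_iff_integrableOn_Ioc_of_le ht).mpr
      (integrable_toReal_of_lintegral_ne_top hm.aemeasurable htop)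
  have hc1 := P.continuous_homSobolevSq_one hU
  have hi1 : IntervalIntegrable (fun s => P.ν * (homSobolevSq 1 (mult P.lamInv (U s))).toReal)
    volume 0 t := (continuous_const.mul hc1).intervalIntegrable _ _
  have hi3 : IntervalIntegrable (fun s => P.β * ‖U s‖ ^ 2) volume 0 t := by
    apply Continuous.intervalIntegrable; fun_prop
  have heq : (fun s => (P.ν * P.α ^ 2)⁻¹ * ((P.genSq (U s)).toReal
      - P.ν * (homSobolevSq 1 (mult P.lamInv (U s))).toReal - P.β * ‖U s‖ ^ 2))
      =ᵐ[volume.restrict (Ioc 0 t)] fun s => (homSobolevSq 2 (mult P.lamInv (U s))).toReal := by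
    filter_upwards [hae] with s hs
    rw [P.toReal_genSq hs.ne]
    field_simp
    ring
  refine ⟨hae.mono fun s hs => hs.ne, ?_, ?_⟩
  · rw [intervalIntegrable_iff_integrableOn_Ioc_of_le ht]
    exact Integrable.congr ((intervalIntegrable_iff_integrableOn_Ioc_of_le ht).mp
      (((hint.sub hi1).sub hi3).const_mul _)) heq
  · have h2 : ∫ s in (0 : ℝ)..t, (homSobolevSq 2 (mult P.lamInv (U s))).toReal
        = (P.ν * P.α ^ 2)⁻¹ * ((∫ s in (0 : ℝ)..t, (P.genSq (U s)).toReal)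
          - P.ν * (∫ s in (0 : ℝ)..t, (homSobolevSq 1 (mult P.lamInv (U s))).toReal)
          - P.β * ∫ s in (0 : ℝ)..t, ‖U s‖ ^ 2) := by
      rw [← intervalIntegral.integral_const_mul P.ν, ← intervalIntegral.integral_const_mul P.β,
        ← intervalIntegral.integral_sub hint hi1,
        ← intervalIntegral.integral_sub (hint.sub hi1) hi3,
        ← intervalIntegral.integral_const_mul, intervalIntegral.integral_of_le ht,
        intervalIntegral.integral_of_le ht]
      exact (integral_congr_ae heq).symm
    have h3 : 2 * ∫ s in (0 : ℝ)..t, (P.genSq (U s)).toReal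
        = ‖U 0‖ ^ 2 - ‖U t‖ ^ 2 + 2 * ∫ s in (0 : ℝ)..t, inner ℝ (U s) (g s) := by
      rw [intervalIntegral.integral_of_le ht, integral_toReal hm.aemeasurable hae]
      have := congrArg ENNReal.toReal hE
      rwa [ENNReal.toReal_mul, ENNReal.toReal_ofReal hX, ENNReal.toReal_ofNat] at this
    rw [h2]
    field_simp
    linarith

theorem sum_inner_forcing {U F : VecL2} (hU : P.dvg U = 0) :
    ∑ i, inner ℝ (U i) (P.forcing F U i) = ∑ i, inner ℝ (U i) (F i) := by
  simp only [forcing, inner_sub_right, Finset.sum_sub_distrib, P.sum_inner_nlB hU, sub_zero]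

theorem vecL2Sq_add_vecHomSq_one (U : VecL2) : vecL2Sq (fun i => mult P.lamInv (U i))
    + P.α ^ 2 * vecHomSq 1 (fun i => mult P.lamInv (U i)) = ∑ i, ‖U i‖ ^ 2 := by
  rw [vecL2Sq, vecHomSq, ENNReal.toReal_sum fun i _ => P.homSobolevSq_one_ne_top (U i),
    Finset.mul_sum, ← Finset.sum_add_distrib]
  exact Finset.sum_congr rfl fun i _ => P.norm_sq_add_toReal (U i)

theorem energyEquality_of_mild {F U₀ : VecL2} {U : ℝ → VecL2} (hU : Continuous U)
    (hU0 : U 0 = U₀) (hdiv : ∀ t, 0 ≤ t → P.dvg (U t) = 0)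
    (h : ∀ t, 0 ≤ t → ∀ i, U t i = P.mild (U₀ i) (fun s => P.forcing F (U s) i) t)
    {t : ℝ} (ht : 0 ≤ t) :
    EnergyEquality P.ν P.α P.β (fun i => mult P.lamInv (F i)) (fun i => mult P.lamInv (U₀ i))
      (fun t i => mult P.lamInv (U t i)) t := by
  have hUi : ∀ i, Continuous fun s => U s i := fun i => (continuous_apply i).comp hU
  have hg : ∀ i, Continuous fun s => P.forcing F (U s) i := fun i =>
    (continuous_apply i).comp ((P.continuous_forcing F).comp hU)
  have hE := fun i => P.energy_equality_toReal (hUi i) (hg i)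
    (fun t ht => P.res_eq_of_mild (hg i) (fun t ht => h t ht i) ht) ht
  have h1 : ∫ s in (0 : ℝ)..t, vecHomSq 1 (fun i => mult P.lamInv (U s i))
      = ∑ i, ∫ s in (0 : ℝ)..t, (homSobolevSq 1 (mult P.lamInv (U s i))).toReal := by
    rw [← intervalIntegral.integral_finsetSum fun i _ =>
      (P.continuous_homSobolevSq_one (hUi i)).intervalIntegrable _ _]
    refine intervalIntegral.integral_congr fun s _ => ?_
    exact ENNReal.toReal_sum fun i _ => P.homSobolevSq_one_ne_top (U s i)
  have h2 : ∫ s in (0 : ℝ)..t, vecHomSq 2 (fun i => mult P.lamInv (U s i))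
      = ∑ i, ∫ s in (0 : ℝ)..t, (homSobolevSq 2 (mult P.lamInv (U s i))).toReal := by
    rw [← intervalIntegral.integral_finsetSum fun i _ => (hE i).2.1,
      intervalIntegral.integral_of_le ht, intervalIntegral.integral_of_le ht]
    apply integral_congr_ae
    filter_upwards [ae_all_iff.mpr fun i => (hE i).1] with s hs
    exact ENNReal.toReal_sum fun i _ => P.homSobolevSq_two_ne_top (hs i)
  have h3 : ∫ s in (0 : ℝ)..t, (vecInner (fun i => mult P.lamInv (F i))
      (fun i => mult P.lamInv (U s i)) + P.α ^ 2 * gradInner (fun i => mult P.lamInv (F i))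
      (fun i => mult P.lamInv (U s i)))
      = ∑ i, ∫ s in (0 : ℝ)..t, inner ℝ (U s i) (P.forcing F (U s) i) := by
    rw [← intervalIntegral.integral_finsetSum fun i _ =>
      ((hUi i).inner (hg i)).intervalIntegrable _ _]
    refine intervalIntegral.integral_congr fun s hs => ?_
    rw [uIcc_of_le ht] at hs
    beta_reduce
    -- The nonlinear contribution vanishes only in the sum over the components.
    rw [vecInner_add_gradInner, P.sum_inner_forcing (hdiv s hs.1)]
    exact Finset.sum_congr rfl fun i _ => real_inner_comm _ _
  have h4 : ∫ s in (0 : ℝ)..t, (vecL2Sq (fun i => mult P.lamInv (U s i))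
      + P.α ^ 2 * vecHomSq 1 (fun i => mult P.lamInv (U s i)))
      = ∑ i, ∫ s in (0 : ℝ)..t, ‖U s i‖ ^ 2 := by
    rw [← intervalIntegral.integral_finsetSum fun i _ => by
      apply Continuous.intervalIntegrable; fun_prop]
    exact intervalIntegral.integral_congr fun s _ => P.vecL2Sq_add_vecHomSq_one (U s)
  rw [EnergyEquality, h1, h2, h3, h4, vecL2Sq_add_vecHomSq_one, vecL2Sq_add_vecHomSq_one, ← hU0]
  have h5 := Finset.sum_congr rfl fun i (_ : i ∈ Finset.univ) => (hE i).2.2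
  simp only [Finset.sum_add_distrib, Finset.sum_sub_distrib, ← Finset.mul_sum] at h5
  exact h5

theorem memLinftyH1_lamInv {U : ℝ → VecL2} (hU : Continuous U) {M : ℝ}
    (hM : ∀ t, 0 ≤ t → ∑ i, ‖U t i‖ ^ 2 ≤ M) : MemLinftyH1 fun t i => mult P.lamInv (U t i) := by
  refine ⟨?_, (1 + P.α⁻¹ ^ 2) * M, (ae_restrict_mem measurableSet_Ici).mono fun t ht => ?_⟩
  · apply Continuous.aestronglyMeasurable
    fun_prop
  · refine (Finset.sum_le_sum fun i _ => P.sobolevSq_one_lamInv_le (U t i)).trans ?_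
    rw [← ENNReal.ofReal_sum_of_nonneg fun i _ => by positivity, ← Finset.mul_sum]
    have := hM t ht
    gcongr

theorem homSobolevSq_two_lamInv_le (G : L2) :
    homSobolevSq 2 (mult P.lamInv G) ≤ (ENNReal.ofReal (P.ν * P.α ^ 2))⁻¹ * P.genSq G := by
  have hα := P.hα
  have hν := P.hν
  rw [mul_comm, ← div_eq_mul_inv, ENNReal.le_div_iff_mul_le (Or.inl (by simp; positivity))
    (Or.inl ENNReal.ofReal_ne_top), genSq_eq, mul_comm]
  exact le_add_right le_add_self

theorem memL2LocHom2_lamInv {U : ℝ → VecL2} (hU : Continuous U)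
    (h : ∀ t, 0 ≤ t → ∀ i, ∫⁻ s in Ioc 0 t, P.genSq (U s i) ≠ ⊤) :
    MemL2LocHom2 fun t i => mult P.lamInv (U t i) := by
  have hα := P.hα
  have hν := P.hν
  refine ⟨?_, fun T hT => ?_⟩
  · apply Continuous.aestronglyMeasurable
    fun_prop
  · have hm : ∀ i, Measurable fun s => P.genSq (U s i) := fun i =>
      P.measurable_genSq ((continuous_apply i).comp hU)
    rw [← restrict_Ioc_eq_restrict_Icc]
    refine lt_of_le_of_lt (lintegral_mono fun t => Finset.sum_le_sum fun i _ =>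
      P.homSobolevSq_two_lamInv_le (U t i)) ?_
    simp only [← Finset.mul_sum]
    have hne : (ENNReal.ofReal (P.ν * P.α ^ 2))⁻¹ ≠ ⊤ := by
      rw [ENNReal.inv_ne_top]; simp; positivity
    rw [lintegral_const_mul' _ _ hne, lintegral_finsetSum _ fun i _ => hm i]
    exact ENNReal.mul_lt_top (lt_top_iff_ne_top.mpr hne)
      (ENNReal.sum_lt_top.mpr fun i _ => lt_top_iff_ne_top.mpr (h T hT.le i))

theorem memL2LocH3_pres {U : ℝ → VecL2} (hU : Continuous U) {M : ℝ}
    (hM : ∀ t, 0 ≤ t → ∑ i, ‖U t i‖ ^ 2 ≤ M)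
    (h : ∀ t, 0 ≤ t → ∀ i, ∫⁻ s in Ioc 0 t, P.genSq (U s i) ≠ ⊤) :
    MemL2LocH3 fun t => P.pres (U t) := by
  obtain ⟨C, hC, hp⟩ := P.exists_sobolevSq_pres_le
  refine ⟨(P.continuous_pres.comp hU).aestronglyMeasurable, fun T hT => ?_⟩
  have hm : ∀ i, Measurable fun s => P.genSq (U s i) := fun i =>
    P.measurable_genSq ((continuous_apply i).comp hU)
  rw [← restrict_Ioc_eq_restrict_Icc]
  have hae : ∀ᵐ s ∂volume.restrict (Ioc 0 T), ∀ i, P.genSq (U s i) < ⊤ :=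
    ae_all_iff.mpr fun i => ae_lt_top (hm i) (h T hT.le i)
  have hle : ∀ᵐ s ∂volume.restrict (Ioc 0 T), sobolevSq 3 (P.pres (U s))
      ≤ ENNReal.ofReal (C * (max M 1) ^ 2) * ∑ i, P.genSq (U s i) := by
    filter_upwards [hae, ae_restrict_mem measurableSet_Ioc] with s hs hs2
    refine (hp (U s) fun i => (hs i).ne).trans ?_
    have : ‖U s‖ ≤ max M 1 := norm_le_of_sum_norm_sq_le (le_max_right _ _)
      ((hM s hs2.1.le).trans (le_max_left _ _))
    gcongr
  refine (lintegral_mono_ae hle).trans_lt ?_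
  rw [lintegral_const_mul' _ _ ENNReal.ofReal_ne_top, lintegral_finsetSum _ fun i _ => hm i]
  exact ENNReal.mul_lt_top ENNReal.ofReal_lt_top
    (ENNReal.sum_lt_top.mpr fun i _ => lt_top_iff_ne_top.mpr (h T hT.le i))

end Params

/-! ### Weak derivatives in time and a Gronwall lemma -/

/-- `θ` is the primitive of `η` vanishing at `T`, cut off at negative times only. Its value at `0`
need not vanish, and this is how the initial datum enters. -/
theorem exists_primitive_test {η : ℝ → ℝ} {T : ℝ} (hT : 0 < T) (hη : ContDiff ℝ ∞ η)
    (hηc : HasCompactSupport η) (hηs : tsupport η ⊆ Ioo 0 T) :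
    ∃ θ : ℝ → ℝ, ContDiff ℝ ∞ θ ∧ HasCompactSupport θ ∧ tsupport θ ⊆ Iio T ∧
      (∀ t, 0 ≤ t → deriv θ t = η t) ∧ ∀ t, 0 ≤ t → θ t = -∫ s in t..T, η s := by
  have hη0 := hη.continuous
  -- `η` already vanishes from a time `b < T` on, which keeps the closed support of `θ` strictly
  -- before `T`.
  obtain ⟨b, hb0, hbT, hb⟩ : ∃ b, 0 ≤ b ∧ b < T ∧ ∀ t, b ≤ t → η t = 0 := by
    rcases (tsupport η).eq_empty_or_nonempty with h | h
    · refine ⟨0, le_rfl, hT, fun t _ => image_eq_zero_of_notMem_tsupport (by rw [h]; simp)⟩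
    · have hm := hηc.isCompact.sSup_mem h
      refine ⟨(sSup (tsupport η) + T) / 2, ?_, ?_, fun t ht =>
        image_eq_zero_of_notMem_tsupport fun hmem => ?_⟩
      · linarith [(hηs hm).1]
      · linarith [(hηs hm).2]
      · linarith [le_csSup hηc.isCompact.bddAbove hmem, (hηs hm).2]
  set H : ℝ → ℝ := fun t => ∫ s in T..t, η s
  have hHd : ∀ t, HasDerivAt H (η t) t := fun t =>
    intervalIntegral.integral_hasDerivAt_right (hη0.intervalIntegrable _ _)
      (hη0.stronglyMeasurableAtFilter _ _) hη0.continuousAt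
  have hHs : ContDiff ℝ ∞ H := by
    rw [contDiff_infty_iff_deriv]
    exact ⟨fun t => (hHd t).differentiableAt, by
      rwa [show deriv H = η from funext fun t => (hHd t).deriv]⟩
  set χ : ℝ → ℝ := fun t => Real.smoothTransition (t + 2)
  have hχs : ContDiff ℝ ∞ χ := Real.smoothTransition.contDiff.comp (contDiff_id.add contDiff_const)
  have hχ1 : ∀ t, -1 ≤ t → χ t = 1 := fun t ht =>
    Real.smoothTransition.one_of_one_le (by linarith)
  have hsupp : Function.support (fun t => χ t * H t) ⊆ Icc (-2) b := by
    intro t ht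
    rw [Function.mem_support] at ht
    constructor
    · by_contra! hlt
      exact ht (by rw [show χ t = 0 from Real.smoothTransition.zero_of_nonpos (by linarith),
        zero_mul])
    · by_contra! hlt
      refine ht (mul_eq_zero_of_right _ ?_)
      refine (intervalIntegral.integral_congr (g := fun _ => 0) fun s hs => ?_).trans (by simp)
      exact hb s ((le_min hbT.le hlt.le).trans hs.1)
  have htsupp : tsupport (fun t => χ t * H t) ⊆ Icc (-2) b :=
    closure_minimal hsupp isClosed_Icc
  refine ⟨fun t => χ t * H t, hχs.mul hHs,
    HasCompactSupport.of_support_subset_isCompact isCompact_Icc hsupp,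
    fun t ht => (htsupp ht).2.trans_lt hbT, fun t ht => ?_, fun t ht => ?_⟩
  · have : (fun t => χ t * H t) =ᶠ[nhds t] H := by
      filter_upwards [Ioi_mem_nhds (show (-1 : ℝ) < t by linarith)] with s hs
      rw [hχ1 s (le_of_lt hs), one_mul]
    rw [this.deriv_eq, (hHd t).deriv]
  · beta_reduce
    rw [hχ1 t (by linarith), one_mul]
    exact intervalIntegral.integral_symm _ _

theorem intervalIntegrable_of_stronglyMeasurable_bounded {E : Type*}
    [NormedAddCommGroup E] {R : ℝ → E} {C : ℝ} (hR : StronglyMeasurable R) (hC : ∀ t, ‖R t‖ ≤ C) (a b : ℝ) :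
    IntervalIntegrable R volume a b :=
  (continuous_const (y := C)).intervalIntegrable a b |>.mono_fun
    hR.aestronglyMeasurable (.of_forall fun t => (hC t).trans (le_abs_self C))

section

variable {E : Type*} [NormedAddCommGroup E] [NormedSpace ℝ E] [CompleteSpace E]

theorem integral_smul_primitive {η : ℝ → ℝ} (hη : Continuous η) {R : ℝ → E} {C T : ℝ}
    (hT : 0 < T) (hR : StronglyMeasurable R) (hC : ∀ t, ‖R t‖ ≤ C) :
    ∫ s in (0 : ℝ)..T, η s • ∫ r in (0 : ℝ)..s, R r
      = ∫ r in (0 : ℝ)..T, (∫ s in r..T, η s) • R r := by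
  obtain ⟨D, hD⟩ := (isCompact_Icc (a := (0 : ℝ)) (b := T)).exists_bound_of_continuousOn
    hη.continuousOn
  have h := (integral_triangle_swap (f := fun s r => η s • R r) (C := D * C)
    ((hη.stronglyMeasurable.comp_measurable measurable_fst).smul
      (hR.comp_measurable measurable_snd)) hT.le fun s r h0 hr hs => by
        rw [norm_smul]
        have h1 := hD s ⟨h0.le.trans hr, hs⟩
        exact mul_le_mul h1 (hC r) (norm_nonneg _) ((norm_nonneg _).trans h1)).2
  simpa only [intervalIntegral.integral_smul, intervalIntegral.integral_smul_const] using h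

/-- Du Bois-Reymond's argument: testing with the primitive of an arbitrary `η` and exchanging
integrals gives `∫ η (Y - y₀ - ∫ R) = 0`. The datum `y₀` appears because `θ 0 = -∫ η`. -/
theorem ae_eq_of_weak_derivative {Y R : ℝ → E} {y₀ : E} {C T : ℝ} (hT : 0 < T)
    (hY : IntervalIntegrable Y volume 0 T) (hR : StronglyMeasurable R) (hC : ∀ t, ‖R t‖ ≤ C)
    (h : ∀ θ : ℝ → ℝ, ContDiff ℝ ∞ θ → HasCompactSupport θ → tsupport θ ⊆ Iio T →
      -(∫ t in (0 : ℝ)..T, deriv θ t • Y t) - θ 0 • y₀ = ∫ t in (0 : ℝ)..T, θ t • R t) :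
    ∀ᵐ t ∂volume.restrict (Ioc 0 T), Y t = y₀ + ∫ s in (0 : ℝ)..t, R s := by
  have hRi := intervalIntegrable_of_stronglyMeasurable_bounded hR hC
  have hprim : Continuous fun t => ∫ s in (0 : ℝ)..t, R s :=
    intervalIntegral.continuous_primitive (fun a b => hRi a b) 0
  have hcont : Continuous fun t => y₀ + ∫ s in (0 : ℝ)..t, R s := by fun_prop
  have hZ : IntervalIntegrable (fun t => Y t - (y₀ + ∫ s in (0 : ℝ)..t, R s)) volume 0 T :=
    hY.sub (hcont.intervalIntegrable _ _)
  have hZ' := (intervalIntegrable_iff_integrableOn_Ioc_of_le hT.le).mp hZ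
  have key := isOpen_Ioo.ae_eq_zero_of_integral_contDiff_smul_eq_zero (U := Ioo (0 : ℝ) T)
    (μ := volume) ((hZ'.mono_set Ioo_subset_Ioc_self).locallyIntegrableOn)
    (fun η hη hηc hηs => ?_)
  · rw [← restrict_Ioo_eq_restrict_Ioc, ae_restrict_iff' measurableSet_Ioo]
    filter_upwards [key] with t ht hmem
    exact sub_eq_zero.mp (ht hmem)
  · obtain ⟨θ, hθ, hθc, hθs, hθd, hθ0⟩ := exists_primitive_test hT hη hηc hηs
    have hη0 := hη.continuous
    have h1 := h θ hθ hθc hθs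
    have e1 : ∫ t in (0 : ℝ)..T, deriv θ t • Y t = ∫ t in (0 : ℝ)..T, η t • Y t :=
      intervalIntegral.integral_congr fun t ht => by
        rw [uIcc_of_le hT.le] at ht
        rw [hθd t ht.1]
    have e2 : ∫ t in (0 : ℝ)..T, θ t • R t = -∫ t in (0 : ℝ)..T, (∫ s in t..T, η s) • R t := by
      rw [← intervalIntegral.integral_neg]
      refine intervalIntegral.integral_congr fun t ht => ?_
      rw [uIcc_of_le hT.le] at ht
      rw [hθ0 t ht.1, neg_smul]
    have e3 : ∫ t, η t • (Y t - (y₀ + ∫ s in (0 : ℝ)..t, R s))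
        = ∫ t in (0 : ℝ)..T, η t • (Y t - (y₀ + ∫ s in (0 : ℝ)..t, R s)) := by
      rw [intervalIntegral.integral_of_le hT.le]
      refine (setIntegral_eq_integral_of_forall_compl_eq_zero fun t ht => ?_).symm
      rw [image_eq_zero_of_notMem_tsupport fun hm => ht (Ioo_subset_Ioc_self (hηs hm)), zero_smul]
    have hηY : IntervalIntegrable (fun t => η t • Y t) volume 0 T :=
      hY.continuousOn_smul hη0.continuousOn
    rw [e1, e2, hθ0 0 le_rfl, ← integral_smul_primitive hη0 hT hR hC] at h1
    rw [e3]
    simp only [smul_sub, smul_add]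
    rw [intervalIntegral.integral_sub hηY (by apply Continuous.intervalIntegrable; fun_prop),
      intervalIntegral.integral_add (by apply Continuous.intervalIntegrable; fun_prop)
        (by apply Continuous.intervalIntegrable; fun_prop),
      intervalIntegral.integral_smul_const]
    rw [neg_smul, sub_neg_eq_add] at h1
    rw [sub_add_eq_sub_sub, sub_eq_zero, ← neg_inj, neg_sub, sub_eq_add_neg, add_comm, h1]

end

/-- Iterating the inequality gives the bound `B (L t)ⁿ / n!`, which tends to zero. Iteration suits
an inequality known only almost everywhere. -/
theorem ae_eq_zero_of_le_integral {d : ℝ → ℝ} {B L T : ℝ} (hL : 0 ≤ L)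
    (hd : ∀ t, 0 ≤ d t) (hB : ∀ᵐ t ∂volume.restrict (Ioc 0 T), d t ≤ B)
    (h : ∀ᵐ t ∂volume.restrict (Ioc 0 T), d t ≤ ∫ s in (0 : ℝ)..t, L * d s) :
    ∀ᵐ t ∂volume.restrict (Ioc 0 T), d t = 0 := by
  have hn : ∀ n : ℕ, ∀ᵐ t ∂volume.restrict (Ioc 0 T), d t ≤ B * ((L * t) ^ n / n.factorial) := by
    intro n
    induction n with
    | zero => simpa using hB
    | succ n ih =>
      filter_upwards [h, ae_restrict_mem measurableSet_Ioc] with t ht htm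
      have hi : IntegrableOn (fun s => L * (B * ((L * s) ^ n / n.factorial))) (Ioc 0 t) :=
        (Continuous.integrableOn_Icc (by fun_prop)).mono_set Ioc_subset_Icc_self
      refine ht.trans ?_
      calc ∫ s in (0 : ℝ)..t, L * d s ≤ ∫ s in (0 : ℝ)..t, L * (B * ((L * s) ^ n / n.factorial)) := by
            rw [intervalIntegral.integral_of_le htm.1.le, intervalIntegral.integral_of_le htm.1.le]
            refine integral_mono_of_nonneg (.of_forall fun s => mul_nonneg hL (hd s)) hi ?_
            filter_upwards [ae_restrict_of_ae_restrict_of_subset (Ioc_subset_Ioc_right htm.2) ih]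
              with s hs
            exact mul_le_mul_of_nonneg_left hs hL
        _ = B * ((L * t) ^ (n + 1) / (n + 1).factorial) := by
            have : ∀ s : ℝ, L * (B * ((L * s) ^ n / n.factorial))
                = L * B * L ^ n / n.factorial * s ^ n := fun s => by rw [mul_pow]; ring
            simp only [this]
            rw [intervalIntegral.integral_const_mul, integral_pow, Nat.factorial_succ]
            have : (n.factorial : ℝ) ≠ 0 := by positivity
            push_cast
            field_simp
            ring
  filter_upwards [ae_all_iff.mpr hn] with t ht
  refine le_antisymm (ge_of_tendsto' (x := atTop) ?_ ht) (hd t)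
  simpa using (FloorSemiring.tendsto_pow_div_factorial_atTop (L * t)).const_mul B

/-! ### Uniqueness -/

theorem ae_restrict_Ici_of_forall_Icc {p : ℝ → Prop}
    (h : ∀ T : ℝ, 0 < T → ∀ᵐ t ∂volume.restrict (Icc 0 T), p t) :
    ∀ᵐ t ∂volume.restrict (Ici (0 : ℝ)), p t := by
  have h1 : ∀ n : ℕ, ∀ᵐ t : ℝ, t ∈ Icc 0 ((n : ℝ) + 1) → p t := fun n =>
    (ae_restrict_iff' measurableSet_Icc).mp (h _ (by positivity))
  rw [ae_restrict_iff' measurableSet_Ici]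
  filter_upwards [ae_all_iff.mpr h1] with t ht h0
  obtain ⟨n, hn⟩ := exists_nat_ge t
  exact ht n ⟨h0, hn.trans (by linarith)⟩

/-- A representative bounded at every time spares exceptional sets in the estimates of the
nonlinearity. -/
theorem exists_stronglyMeasurable_bounded {E : Type*} [NormedAddCommGroup E] {V : ℝ → E}
    {μ : Measure ℝ} {C : ℝ} (hV : AEStronglyMeasurable V μ) (hC : ∀ᵐ t ∂μ, ‖V t‖ ≤ C)
    (hC0 : 0 ≤ C) : ∃ W : ℝ → E, StronglyMeasurable W ∧ (∀ t, ‖W t‖ ≤ C) ∧ V =ᵐ[μ] W := by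
  refine ⟨{t | ‖hV.mk V t‖ ≤ C}.indicator (hV.mk V), hV.stronglyMeasurable_mk.indicator
    (measurableSet_le hV.stronglyMeasurable_mk.norm.measurable measurable_const), fun t => ?_, ?_⟩
  · by_cases ht : t ∈ {t | ‖hV.mk V t‖ ≤ C}
    · rw [indicator_of_mem ht]; exact ht
    · rwa [indicator_of_notMem ht, norm_zero]
  · filter_upwards [hV.ae_eq_mk, hC] with t h1 h2
    rw [h1] at h2
    rw [indicator_of_mem (show t ∈ {t | ‖hV.mk V t‖ ≤ C} from h2), h1]

namespace Params

variable (P : Params)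

/-- Bounded approximations of the symbol of `Λ`. -/
def lamN (n : ℕ) : Symbol :=
  Symbol.ofEven (fun ξ => P.lam ξ * (1 + P.lam ξ / (n + 1))⁻¹)
    (P.continuous_lam.measurable.mul ((P.continuous_lam.measurable.div_const _).const_add 1).inv)
    ⟨n + 1, fun ξ => by
      have := P.lam_pos ξ
      rw [abs_of_pos (by positivity), ← div_eq_mul_inv, div_le_iff₀ (by positivity)]
      field_simp
      linarith⟩
    (by simp)

/-- Exhibits `Λ` as a strong limit of bounded operators, which makes `Λ v` measurable in time. -/
theorem tendsto_lamN (G : L2) :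
    Tendsto (fun n => mult (P.lamN n) (mult P.lamInv G)) atTop (nhds G) := by
  have hval : ∀ n ξ, (P.lamN n * P.lamInv) ξ = (((1 + P.lam ξ / ((n : ℝ) + 1))⁻¹ : ℝ) : ℂ) := by
    intro n ξ
    have h := P.lam_ne ξ
    have h2 : P.lamN n ξ = ((P.lam ξ * (1 + P.lam ξ / ((n : ℝ) + 1))⁻¹ : ℝ) : ℂ) := rfl
    rw [Symbol.mul_apply, h2, lamInv_apply, ← Complex.ofReal_mul]
    congr 1
    field_simp
  have h := tendsto_mult (m := fun n => P.lamN n * P.lamInv) (n := 1) (C := 1) (l := atTop)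
    (fun n ξ => ?_) (fun ξ => ?_) G
  · simpa only [mult_one_apply, mult_mul_apply] using h
  · have := P.lam_pos ξ
    rw [hval, Complex.norm_real, Real.norm_of_nonneg (by positivity)]
    exact inv_le_one_of_one_le₀ (le_add_of_nonneg_right (by positivity))
  · have h1 : Tendsto (fun n : ℕ => P.lam ξ / ((n : ℝ) + 1)) atTop (nhds 0) :=
      tendsto_const_nhds.div_atTop (tendsto_natCast_atTop_atTop.atTop_add tendsto_const_nhds)
    have h2 := (h1.const_add 1).inv₀ (by simp)
    simp only [add_zero, inv_one] at h2
    have h3 := (Complex.continuous_ofReal.tendsto 1).comp h2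
    simp only [hval]
    simpa [Function.comp_def] using h3

theorem exists_lamInv_eq_of_memLinftyLocH1 {v : ℝ → VecL2} (hv : MemLinftyLocH1 v) :
    ∃ V : ℝ → VecL2, AEStronglyMeasurable V (volume.restrict (Ici 0)) ∧
      (∀ᵐ t ∂volume.restrict (Ici (0 : ℝ)), v t = fun i => mult P.lamInv (V t i)) ∧
      ∀ T : ℝ, 0 < T → ∃ C : ℝ, 0 ≤ C ∧ ∀ᵐ t ∂volume.restrict (Icc 0 T), ‖V t‖ ≤ C := by
  classical
  obtain ⟨hvm, hvb⟩ := hv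
  have hex : ∀ᵐ t ∂volume.restrict (Ici (0 : ℝ)), ∀ i, ∃ G : L2, v t i = mult P.lamInv G := by
    refine ae_restrict_Ici_of_forall_Icc fun T hT => ?_
    obtain ⟨C, hC⟩ := hvb T hT
    filter_upwards [hC] with t ht i
    refine P.exists_lamInv_eq (ne_top_of_le_ne_top (ENNReal.mul_ne_top ENNReal.ofReal_ne_top ?_)
      (P.lintegral_lam_sq_le (v t i)))
    exact ne_top_of_le_ne_top ENNReal.ofReal_ne_top
      ((Finset.single_le_sum (f := fun i => sobolevSq 1 (v t i)) (fun _ _ => zero_le)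
        (Finset.mem_univ i)).trans ht)
  let V : ℝ → VecL2 := fun t i =>
    if h : ∃ G : L2, v t i = mult P.lamInv G then h.choose else 0
  have hV : ∀ᵐ t ∂volume.restrict (Ici (0 : ℝ)), v t = fun i => mult P.lamInv (V t i) := by
    filter_upwards [hex] with t ht
    ext1 i
    simp only [V, dif_pos (ht i)]
    exact (ht i).choose_spec
  refine ⟨V, ?_, hV, fun T hT => ?_⟩
  -- `V` was chosen separately at each time; it is measurable as an almost everywhere limit of
  -- bounded operators applied to `v`.
  · refine aestronglyMeasurable_of_tendsto_ae atTop
      (f := fun n t i => mult (P.lamN n) (v t i)) (fun n => ?_) ?_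
    · have hc : Continuous fun w : VecL2 => fun i => mult (P.lamN n) (w i) := by fun_prop
      exact hc.comp_aestronglyMeasurable hvm
    · filter_upwards [hV] with t ht
      rw [tendsto_pi_nhds]
      intro i
      rw [ht]
      exact P.tendsto_lamN (V t i)
  · obtain ⟨C, hC⟩ := hvb T hT
    -- The maximum with `1` lets the bound on the squared norm serve for the norm itself.
    refine ⟨max ((1 + P.α ^ 2) * max C 0) 1, by positivity, ?_⟩
    filter_upwards [hC, ae_restrict_of_ae_restrict_of_subset Icc_subset_Ici_self hV] with t h1 h2
    refine (pi_norm_le_iff_of_nonneg (by positivity)).mpr fun i => ?_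
    have h3 := P.ofReal_norm_sq_le_sobolevSq_one (V t i)
    have h4 : sobolevSq 1 (mult P.lamInv (V t i)) ≤ ENNReal.ofReal (max C 0) := by
      rw [h2] at h1
      exact ((Finset.single_le_sum (f := fun i => sobolevSq 1 (mult P.lamInv (V t i)))
        (fun _ _ => zero_le) (Finset.mem_univ i)).trans h1).trans
        (ENNReal.ofReal_le_ofReal (le_max_left _ _))
    have h5 := h3.trans (mul_le_mul_right h4 _)
    rw [← ENNReal.ofReal_mul (by positivity), ENNReal.ofReal_le_ofReal_iff (by positivity)] at h5
    have h6 : ‖V t i‖ ^ 2 ≤ max ((1 + P.α ^ 2) * max C 0) 1 := h5.trans (le_max_left _ _)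
    have h7 : (1 : ℝ) ≤ max ((1 + P.α ^ 2) * max C 0) 1 := le_max_right _ _
    nlinarith [norm_nonneg (V t i)]

section

variable {F V₀ : VecL2} {V : ℝ → VecL2} {q : ℝ → L2} {C T : ℝ}

theorem stronglyMeasurable_forcing (hV : StronglyMeasurable V) (i : Fin 3) :
    StronglyMeasurable fun t => P.forcing F (V t) i :=
  ((continuous_apply i).comp (P.continuous_forcing F)).comp_stronglyMeasurable hV

theorem norm_forcing_le (hC : ∀ t, ‖V t‖ ≤ C) (i : Fin 3) (t : ℝ) :
    ‖P.forcing F (V t) i‖ ≤ ‖F i‖ + P.nlConst * C * C := by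
  have hn := P.nlConst_nonneg
  have h0 := (norm_nonneg _).trans (hC t)
  refine (norm_sub_le _ _).trans (add_le_add le_rfl ((P.norm_nlB_apply_le i _ _).trans ?_))
  gcongr <;> exact hC t

/-- The right-hand side of the resolvent form of the evolution equation. -/
def evo (F V : VecL2) (i : Fin 3) : L2 :=
  mult P.res (V i) - V i + mult P.res (P.forcing F V i)

theorem rhsRes_eq (F V : VecL2) (q : L2) (i : Fin 3) :
    P.rhsRes F V q i = P.evo F V i + mult (P.dLamRes i) (P.pres V - q) := by
  rw [evo, ← rhsRes_pres, rhsRes, rhsRes, map_sub]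
  abel

theorem norm_mult_res_le (g : L2) : ‖mult P.res g‖ ≤ ‖g‖ :=
  (norm_mult_apply_le P.res P.norm_res_le g).trans_eq (one_mul _)

theorem stronglyMeasurable_evo (hV : StronglyMeasurable V) (i : Fin 3) :
    StronglyMeasurable fun t => P.evo F (V t) i := by
  have hVi : StronglyMeasurable fun t => V t i := (continuous_apply i).comp_stronglyMeasurable hV
  exact (((mult P.res).continuous.comp_stronglyMeasurable hVi).sub hVi).add
    ((mult P.res).continuous.comp_stronglyMeasurable (P.stronglyMeasurable_forcing hV i))

theorem norm_evo_le (hC : ∀ t, ‖V t‖ ≤ C) (i : Fin 3) (t : ℝ) :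
    ‖P.evo F (V t) i‖ ≤ C + C + (‖F i‖ + P.nlConst * C * C) := by
  have h1 := (norm_le_pi_norm (V t) i).trans (hC t)
  exact norm_add_le_of_le (norm_sub_le_of_le ((P.norm_mult_res_le _).trans h1) h1)
    ((P.norm_mult_res_le _).trans (P.norm_forcing_le hC i t))

theorem intervalIntegrable_pres (hV : StronglyMeasurable V) (hC : ∀ t, ‖V t‖ ≤ C) (a b : ℝ) :
    IntervalIntegrable (fun t => P.pres (V t)) volume a b := by
  refine intervalIntegrable_of_stronglyMeasurable_bounded
    (C := ‖mult (P.lamInv * P.lamInv)‖ * (‖P.presB‖ * C * C))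
    (P.continuous_pres.comp_stronglyMeasurable hV) (fun t => ?_) a b
  have hK : 0 ≤ ‖P.presB‖ := ContinuousLinearMap.opNorm_nonneg P.presB
  have h0 := (norm_nonneg _).trans (hC t)
  refine (ContinuousLinearMap.le_opNorm _ _).trans ?_
  refine mul_le_mul_of_nonneg_left ((P.norm_presB_apply_le _ _).trans ?_) (norm_nonneg _)
  gcongr <;> exact hC t

theorem intervalIntegrable_rhsRes (hV : StronglyMeasurable V) (hC : ∀ t, ‖V t‖ ≤ C)
    (hq : IntervalIntegrable q volume 0 T) (i : Fin 3) :
    IntervalIntegrable (fun t => P.rhsRes F (V t) (q t) i) volume 0 T := by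
  simp only [rhsRes_eq]
  have h2 := (P.intervalIntegrable_pres hV hC 0 T).sub hq
  exact (intervalIntegrable_of_stronglyMeasurable_bounded (P.stronglyMeasurable_evo hV i)
    (P.norm_evo_le hC i) 0 T).add
    ⟨(mult (P.dLamRes i)).integrable_comp h2.1, (mult (P.dLamRes i)).integrable_comp h2.2⟩

theorem intervalIntegrable_res (hV : StronglyMeasurable V) (hC : ∀ t, ‖V t‖ ≤ C) (i : Fin 3)
    (a b : ℝ) : IntervalIntegrable (fun t => mult P.res (V t i)) volume a b :=
  intervalIntegrable_of_stronglyMeasurable_bounded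
    ((mult P.res).continuous.comp_stronglyMeasurable
      ((continuous_apply i).comp_stronglyMeasurable hV))
    (fun t => (P.norm_mult_res_le _).trans ((norm_le_pi_norm (V t) i).trans (hC t))) a b

/-- Schwartz functions separate the elements of `L²`, so the scalar identities assemble into one
between Bochner integrals. -/
theorem weak_vec (hV : StronglyMeasurable V) (hC : ∀ t, ‖V t‖ ≤ C)
    (hq : IntervalIntegrable q volume 0 T) {i : Fin 3} {θ : ℝ → ℝ} (hθ : ContDiff ℝ ∞ θ)
    (h : ∀ ψ : 𝓢(Space, ℂ),
      -(∫ t in (0 : ℝ)..T, ((deriv θ t : ℝ) : ℂ) * distL ψ (mult P.res (V t i)))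
          - ((θ 0 : ℝ) : ℂ) * distL ψ (mult P.res (V₀ i))
        = ∫ t in (0 : ℝ)..T, ((θ t : ℝ) : ℂ) * distL ψ (P.rhsRes F (V t) (q t) i)) :
    -(∫ t in (0 : ℝ)..T, deriv θ t • mult P.res (V t i)) - θ 0 • mult P.res (V₀ i)
      = ∫ t in (0 : ℝ)..T, θ t • P.rhsRes F (V t) (q t) i := by
  have hθd : Continuous (deriv θ) := hθ.continuous_deriv (by simp)
  have h1 := (P.intervalIntegrable_res hV hC i 0 T).continuousOn_smul hθd.continuousOn
  have h2 := (P.intervalIntegrable_rhsRes hV hC hq i (F := F)).continuousOn_smul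
    hθ.continuous.continuousOn
  refine eq_of_distL_eq fun ψ => ?_
  rw [map_sub, map_neg, ← ContinuousLinearMap.intervalIntegral_comp_comm _ h1,
    ← ContinuousLinearMap.intervalIntegral_comp_comm _ h2]
  simp only [map_smul, Complex.real_smul]
  exact h ψ

/-- The symbol of the composition of the divergence and the gradient. -/
def divGrad : Symbol := ∑ i, P.dLamInv i * P.dLamRes i

/-- The symbol is `-eta² (1 + gen)⁻¹`, which vanishes only at the origin, a null set. -/
theorem divGrad_injective : Function.Injective (mult P.divGrad) := by
  apply mult_injective
  have h0 : ∀ᵐ ξ : Space, ξ ≠ 0 := by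
    rw [ae_iff]; simp
  filter_upwards [h0] with ξ hξ
  have hg := P.gen_pos ξ
  have h : P.divGrad ξ = ((-(eta ξ ^ 2 * (1 + P.gen ξ)⁻¹) : ℝ) : ℂ) := by
    have h2 := P.lam_ne ξ
    have h3 : (P.lam ξ : ℂ) ≠ 0 := by exact_mod_cast h2
    rw [← sum_coord_sq, divGrad]
    simp only [Fin.sum_univ_three, Symbol.add_apply, Symbol.mul_apply, dLamInv_apply,
      dLamRes_apply]
    push_cast
    field_simp
    rw [Complex.I_sq]
    ring
  rw [h, Complex.ofReal_ne_zero, neg_ne_zero]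
  have : 0 < eta ξ := by unfold eta; positivity
  positivity

theorem sum_dLamInv_rhsRes (hF : P.dvg F = 0) {V : VecL2} (hV : P.dvg V = 0) (q : L2) :
    ∑ i, mult (P.dLamInv i) (P.rhsRes F V q i) = mult P.divGrad (P.pres V - q) := by
  have h1 := P.dvg_forcing hF V
  rw [dvg] at h1 hV
  have h2 : ∀ i, mult (P.dLamInv i) (P.rhsRes F V q i) =
      mult P.res (mult (P.dLamInv i) (V i)) - mult (P.dLamInv i) (V i)
      + mult P.res (mult (P.dLamInv i) (P.forcing F V i))
      + mult (P.dLamInv i * P.dLamRes i) (P.pres V - q) := by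
    intro i
    rw [rhsRes_eq, evo, map_add, map_add, map_sub, mult_comm _ P.res, mult_comm _ P.res,
      mult_mul_apply]
  simp only [h2, Finset.sum_add_distrib, Finset.sum_sub_distrib, ← map_sum]
  rw [hV, h1, divGrad, mult_sum_apply, map_zero, sub_zero, add_zero, zero_add]

/-- The divergence of the weak equation annihilates the time derivative, the datum, the linear terms
and the forcing. Only the defect `pres V - q` under the injective operator `divGrad` remains, tested
against arbitrary `θ`. -/
theorem pres_ae_eq (hT : 0 < T) (hF : P.dvg F = 0) (hV₀ : P.dvg V₀ = 0)
    (hV : StronglyMeasurable V) (hC : ∀ t, ‖V t‖ ≤ C)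
    (hdiv : ∀ᵐ t ∂volume.restrict (Ioc 0 T), P.dvg (V t) = 0)
    (hq : IntervalIntegrable q volume 0 T)
    (h : ∀ (i : Fin 3) (θ : ℝ → ℝ), ContDiff ℝ ∞ θ → HasCompactSupport θ → tsupport θ ⊆ Iio T →
      -(∫ t in (0 : ℝ)..T, deriv θ t • mult P.res (V t i)) - θ 0 • mult P.res (V₀ i)
      = ∫ t in (0 : ℝ)..T, θ t • P.rhsRes F (V t) (q t) i) :
    ∀ᵐ t ∂volume.restrict (Ioc 0 T), q t = P.pres (V t) := by
  have hsub := (P.intervalIntegrable_pres hV hC 0 T).sub hq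
  have hf : IntervalIntegrable (fun t => mult P.divGrad (P.pres (V t) - q t)) volume 0 T :=
    ⟨(mult P.divGrad).integrable_comp hsub.1, (mult P.divGrad).integrable_comp hsub.2⟩
  have hf' := (intervalIntegrable_iff_integrableOn_Ioc_of_le hT.le).mp hf
  have key := isOpen_Ioo.ae_eq_zero_of_integral_contDiff_smul_eq_zero (U := Ioo (0 : ℝ) T)
    (μ := volume) ((hf'.mono_set Ioo_subset_Ioc_self).locallyIntegrableOn)
    (fun θ hθ hθc hθs => ?_)
  · rw [← restrict_Ioo_eq_restrict_Ioc, ae_restrict_iff' measurableSet_Ioo]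
    filter_upwards [key] with t ht hmem
    have := P.divGrad_injective ((ht hmem).trans (map_zero _).symm)
    exact (sub_eq_zero.mp this).symm
  · have hθd : Continuous (deriv θ) := hθ.continuous_deriv (by simp)
    have h1 := fun i => h i θ hθ hθc (hθs.trans fun t ht => ht.2)
    have hi1 := fun i => (P.intervalIntegrable_res hV hC i 0 T).continuousOn_smul hθd.continuousOn
    have hi2 := fun i => (P.intervalIntegrable_rhsRes hV hC hq i (F := F)).continuousOn_smul
      hθ.continuous.continuousOn
    have h2 : ∀ i, -(∫ t in (0 : ℝ)..T, deriv θ t • mult P.res (mult (P.dLamInv i) (V t i)))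
        - θ 0 • mult P.res (mult (P.dLamInv i) (V₀ i))
        = ∫ t in (0 : ℝ)..T, θ t • mult (P.dLamInv i) (P.rhsRes F (V t) (q t) i) := by
      intro i
      have h3 := congrArg (mult (P.dLamInv i)) (h1 i)
      rw [map_sub, map_neg, map_smul, ← ContinuousLinearMap.intervalIntegral_comp_comm _ (hi1 i),
        ← ContinuousLinearMap.intervalIntegral_comp_comm _ (hi2 i)] at h3
      simp only [map_smul] at h3
      simp only [mult_comm P.res (P.dLamInv i)]
      exact h3
    have hj1 : ∀ i, IntervalIntegrable
        (fun t => deriv θ t • mult P.res (mult (P.dLamInv i) (V t i))) volume 0 T := by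
      intro i
      have h3 : IntervalIntegrable (fun t => mult (P.dLamInv i) (mult P.res (V t i))) volume 0 T :=
        ⟨(mult (P.dLamInv i)).integrable_comp (P.intervalIntegrable_res hV hC i 0 T).1,
          (mult (P.dLamInv i)).integrable_comp (P.intervalIntegrable_res hV hC i 0 T).2⟩
      simp only [mult_comm P.res (P.dLamInv i)]
      exact h3.continuousOn_smul hθd.continuousOn
    have hj2 : ∀ i, IntervalIntegrable
        (fun t => θ t • mult (P.dLamInv i) (P.rhsRes F (V t) (q t) i)) volume 0 T := by
      intro i
      have h3 := P.intervalIntegrable_rhsRes hV hC hq i (F := F)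
      have h4 : IntervalIntegrable (fun t => mult (P.dLamInv i) (P.rhsRes F (V t) (q t) i))
          volume 0 T :=
        ⟨(mult (P.dLamInv i)).integrable_comp h3.1, (mult (P.dLamInv i)).integrable_comp h3.2⟩
      exact h4.continuousOn_smul hθ.continuous.continuousOn
    have h5 := Finset.sum_congr rfl fun i (_ : i ∈ Finset.univ) => h2 i
    rw [Finset.sum_sub_distrib, Finset.sum_neg_distrib,
      ← intervalIntegral.integral_finsetSum fun i _ => hj1 i,
      ← intervalIntegral.integral_finsetSum fun i _ => hj2 i] at h5
    simp only [← Finset.smul_sum, ← map_sum] at h5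
    have h6 : ∫ t in (0 : ℝ)..T, deriv θ t • mult P.res (∑ i, mult (P.dLamInv i) (V t i)) = 0 := by
      rw [intervalIntegral.integral_of_le hT.le]
      refine (integral_congr_ae ?_).trans (integral_zero _ _)
      filter_upwards [hdiv] with t ht
      rw [dvg] at ht
      rw [ht, map_zero, smul_zero]
    have h7 : ∑ i, mult (P.dLamInv i) (V₀ i) = 0 := hV₀
    rw [h6, h7, map_zero, smul_zero, neg_zero, sub_zero] at h5
    have h8 : ∫ t, θ t • mult P.divGrad (P.pres (V t) - q t)
        = ∫ t in (0 : ℝ)..T, θ t • ∑ i, mult (P.dLamInv i) (P.rhsRes F (V t) (q t) i) := by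
      rw [intervalIntegral.integral_of_le hT.le,
        ← setIntegral_eq_integral_of_forall_compl_eq_zero (s := Ioc 0 T) fun t ht => ?_]
      · apply integral_congr_ae
        filter_upwards [hdiv] with t ht
        rw [P.sum_dLamInv_rhsRes hF ht]
      · rw [image_eq_zero_of_notMem_tsupport fun hm => ht (Ioo_subset_Ioc_self (hθs hm)),
          zero_smul]
    rw [h8, ← h5]

/-- With the forcing along `V` frozen, `V` and the Duhamel solution satisfy the same linear
resolvent equation. Their difference falls under `ae_eq_zero_of_res`. -/
theorem ae_eq_mild_of_weak (hT : 0 < T) (hV : StronglyMeasurable V) (hC : ∀ t, ‖V t‖ ≤ C)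
    {i : Fin 3}
    (h : ∀ θ : ℝ → ℝ, ContDiff ℝ ∞ θ → HasCompactSupport θ → tsupport θ ⊆ Iio T →
      -(∫ t in (0 : ℝ)..T, deriv θ t • mult P.res (V t i)) - θ 0 • mult P.res (V₀ i)
      = ∫ t in (0 : ℝ)..T, θ t • P.evo F (V t) i) :
    ∀ᵐ t ∂volume.restrict (Ioc 0 T), V t i = P.mild (V₀ i) (fun s => P.forcing F (V s) i) t := by
  have h1 := ae_eq_of_weak_derivative hT (P.intervalIntegrable_res hV hC i 0 T)
    (P.stronglyMeasurable_evo hV i) (P.norm_evo_le hC i) h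
  set g : ℝ → L2 := fun s => P.forcing F (V s) i
  have hg : StronglyMeasurable g := P.stronglyMeasurable_forcing hV i
  have hm := fun t (ht : 0 ≤ t) => P.mild_res (x₀ := V₀ i) hg ht
    (fun s _ => P.norm_forcing_le hC i s)
  have hVi : ∀ b, IntervalIntegrable (fun t => V t i) volume 0 b := fun b =>
    intervalIntegrable_of_stronglyMeasurable_bounded ((continuous_apply i).comp_stronglyMeasurable hV)
      (fun t => (norm_le_pi_norm (V t) i).trans (hC t)) 0 b
  have hres : ∀ {f : ℝ → L2} {b : ℝ}, IntervalIntegrable f volume 0 b →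
      IntervalIntegrable (fun s => mult P.res (f s)) volume 0 b := fun hf =>
    ⟨(mult P.res).integrable_comp hf.1, (mult P.res).integrable_comp hf.2⟩
  have hgi : ∀ b, IntervalIntegrable g volume 0 b := fun b =>
    intervalIntegrable_of_stronglyMeasurable_bounded hg (P.norm_forcing_le hC i) 0 b
  have key := P.ae_eq_zero_of_res (D := fun t => V t i - P.mild (V₀ i) g t) hT
    ((hVi T).sub (hm T hT.le).1) ?_
  · filter_upwards [key] with t ht using sub_eq_zero.mp ht
  · filter_upwards [h1, ae_restrict_mem measurableSet_Ioc] with t ht htm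
    rw [map_sub, ht, (hm t htm.1.le).2, add_sub_add_left_eq_sub,
      ← intervalIntegral.integral_sub]
    · refine intervalIntegral.integral_congr fun s _ => ?_
      simp only [evo, map_sub, g]
      abel
    · exact ((hres (hVi t)).sub (hVi t)).add (hres (hgi t))
    · exact ((hres (hm t htm.1.le).1).sub (hm t htm.1.le).1).add (hres (hgi t))

/-- Both functions are bounded on `[0, T]`, where the forcing is Lipschitz, and the semigroup
contracts; `ae_eq_zero_of_le_integral` concludes. -/
theorem ae_eq_of_mild {U : ℝ → VecL2} (hT : 0 < T) (hV : StronglyMeasurable V)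
    (hC : ∀ t, ‖V t‖ ≤ C) (hU : Continuous U)
    (hUm : ∀ t, 0 ≤ t → ∀ i, U t i = P.mild (V₀ i) (fun s => P.forcing F (U s) i) t)
    (hVm : ∀ i, ∀ᵐ t ∂volume.restrict (Ioc 0 T),
      V t i = P.mild (V₀ i) (fun s => P.forcing F (V s) i) t) :
    ∀ᵐ t ∂volume.restrict (Ioc 0 T), V t = U t := by
  obtain ⟨D, hD⟩ := (isCompact_Icc (a := (0 : ℝ)) (b := T)).exists_bound_of_continuousOn
    hU.continuousOn
  have hn := P.nlConst_nonneg
  have hC0 : 0 ≤ C := (norm_nonneg _).trans (hC 0)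
  have hD0 : 0 ≤ D := (norm_nonneg _).trans (hD 0 (left_mem_Icc.mpr hT.le))
  have hL : 0 ≤ P.nlConst * (C + D) := by positivity
  have hlip : ∀ i, ∀ s ∈ Icc 0 T, ‖P.forcing F (V s) i - P.forcing F (U s) i‖
      ≤ P.nlConst * (C + D) * ‖V s - U s‖ := by
    intro i s hs
    rw [forcing, forcing, sub_sub_sub_cancel_left, norm_sub_rev]
    refine (P.norm_nlB_sub_le i _ _).trans ?_
    gcongr
    · exact hC s
    · exact hD s hs
  have hUb : ∀ i, ∀ s ∈ Icc 0 T, ‖P.forcing F (U s) i‖ ≤ ‖F i‖ + P.nlConst * D * D := by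
    intro i s hs
    refine (norm_sub_le _ _).trans (add_le_add le_rfl ((P.norm_nlB_apply_le i _ _).trans ?_))
    gcongr <;> exact hD s hs
  have key : ∀ᵐ t ∂volume.restrict (Ioc 0 T),
      ‖V t - U t‖ ≤ ∫ s in (0 : ℝ)..t, P.nlConst * (C + D) * ‖V s - U s‖ := by
    filter_upwards [ae_all_iff.mpr hVm, ae_restrict_mem measurableSet_Ioc] with t ht htm
    have hint : IntervalIntegrable (fun s => P.nlConst * (C + D) * ‖V s - U s‖) volume 0 t :=
      (((intervalIntegrable_of_stronglyMeasurable_bounded hV hC 0 t).sub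
        (hU.intervalIntegrable 0 t)).norm).const_mul _
    refine (pi_norm_le_iff_of_nonneg (intervalIntegral.integral_nonneg htm.1.le
      fun s _ => by positivity)).mpr fun i => ?_
    have h1 := P.intervalIntegrable_sgp (P.stronglyMeasurable_forcing (F := F) hV i) htm.1.le
      (fun s _ => P.norm_forcing_le hC i s)
    have h2 := P.intervalIntegrable_sgp
      (P.stronglyMeasurable_forcing (F := F) hU.stronglyMeasurable i) htm.1.le
      (fun s hs => hUb i s ⟨hs.1, hs.2.trans htm.2⟩)
    rw [Pi.sub_apply, ht i, hUm t htm.1.le i, mild, mild, add_sub_add_left_eq_sub,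
      ← intervalIntegral.integral_sub h1 h2]
    refine intervalIntegral.norm_integral_le_of_norm_le htm.1.le (.of_forall fun s hs => ?_) hint
    rw [← map_sub]
    exact (P.norm_sgp_apply_le _ _).trans (hlip i s ⟨hs.1.le, hs.2.trans htm.2⟩)
  have hB : ∀ᵐ t ∂volume.restrict (Ioc 0 T), ‖V t - U t‖ ≤ C + D := by
    filter_upwards [ae_restrict_mem measurableSet_Ioc] with t ht
    exact norm_sub_le_of_le (hC t) (hD t ⟨ht.1.le, ht.2⟩)
  filter_upwards [ae_eq_zero_of_le_integral hL (fun t => norm_nonneg _) hB key] with t ht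
  exact sub_eq_zero.mp (norm_eq_zero.mp ht)

end

end Params

theorem intervalIntegrable_of_memL2LocH3 {q : ℝ → L2} (hq : MemL2LocH3 q) {T : ℝ} (hT : 0 < T) :
    IntervalIntegrable q volume 0 T := by
  rw [intervalIntegrable_iff_integrableOn_Ioc_of_le hT.le]
  have hm : AEStronglyMeasurable q (volume.restrict (Ioc 0 T)) :=
    hq.1.mono_measure (Measure.restrict_mono (fun t ht => ht.1.le) le_rfl)
  have h2 : MemLp q 2 (volume.restrict (Ioc 0 T)) := by
    refine ⟨hm, ?_⟩
    rw [eLpNorm_lt_top_iff_lintegral_rpow_enorm_lt_top (by norm_num) (by norm_num)]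
    have h := hq.2 T hT
    rw [← restrict_Ioc_eq_restrict_Icc] at h
    refine (lintegral_mono fun t => ?_).trans_lt h
    rw [ENNReal.toReal_ofNat, ENNReal.rpow_ofNat, ← ofReal_norm,
      ← ENNReal.ofReal_pow (norm_nonneg _)]
    exact ofReal_norm_sq_le_sobolevSq 3 (q t)
  exact h2.integrable (by norm_num)

theorem setIntegral_Ioi_eq_of_tsupport_subset {θ : ℝ → ℝ} {T : ℝ} (hT : 0 < T)
    (hθ : tsupport θ ⊆ Iio T) (f : ℝ → ℂ) :
    ∫ t in Ioi (0 : ℝ), ((θ t : ℝ) : ℂ) * f t = ∫ t in (0 : ℝ)..T, ((θ t : ℝ) : ℂ) * f t := by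
  rw [intervalIntegral.integral_of_le hT.le]
  refine setIntegral_eq_of_subset_of_forall_sdiff_eq_zero measurableSet_Ioi (fun t ht => ht.1)
    fun t ht => ?_
  rw [image_eq_zero_of_notMem_tsupport fun hm => ht.2 ⟨ht.1, (hθ hm).le⟩, Complex.ofReal_zero,
    zero_mul]

namespace Params

variable (P : Params)

theorem ae_eq_of_isWeakSolution {F U₀ : VecL2} {U : ℝ → VecL2} (hF : P.dvg F = 0)
    (hU₀ : P.dvg U₀ = 0) (hU : Continuous U)
    (hUm : ∀ t, 0 ≤ t → ∀ i, U t i = P.mild (U₀ i) (fun s => P.forcing F (U s) i) t)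
    {v : ℝ → VecL2} {q : ℝ → L2} (hv : MemLinftyLocH1 v) (hq : MemL2LocH3 q)
    (h : IsWeakSolution P.ν P.α P.β (fun i => mult P.lamInv (F i)) (fun i => mult P.lamInv (U₀ i))
      v q) :
    ∀ᵐ t ∂volume.restrict (Ici (0 : ℝ)),
      (v t = fun i => mult P.lamInv (U t i)) ∧ q t = P.pres (U t) := by
  obtain ⟨V, hVm, hvV, hVb⟩ := P.exists_lamInv_eq_of_memLinftyLocH1 hv
  obtain ⟨hdiv, hw⟩ := (P.isWeakSolution_iff hvV).mp h
  refine ae_restrict_Ici_of_forall_Icc fun T hT => ?_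
  obtain ⟨C, hC0, hC⟩ := hVb T hT
  have hle : volume.restrict (Icc 0 T) ≤ volume.restrict (Ici (0 : ℝ)) :=
    Measure.restrict_mono Icc_subset_Ici_self le_rfl
  obtain ⟨W, hW, hWC, hVW⟩ := exists_stronglyMeasurable_bounded (hVm.mono_measure hle) hC hC0
  rw [← restrict_Ioc_eq_restrict_Icc] at hVW hle ⊢
  have hdivW : ∀ᵐ t ∂volume.restrict (Ioc 0 T), P.dvg (W t) = 0 := by
    filter_upwards [hVW, ae_mono hle hdiv] with t h1 h2
    rwa [← h1]
  have hqi := intervalIntegrable_of_memL2LocH3 hq hT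
  have hvec : ∀ (i : Fin 3) (θ : ℝ → ℝ), ContDiff ℝ ∞ θ → HasCompactSupport θ →
      tsupport θ ⊆ Iio T →
      -(∫ t in (0 : ℝ)..T, deriv θ t • mult P.res (W t i)) - θ 0 • mult P.res (U₀ i)
      = ∫ t in (0 : ℝ)..T, θ t • P.rhsRes F (W t) (q t) i := by
    intro i θ hθ hθc hθs
    refine P.weak_vec hW hWC hqi hθ fun ψ => ?_
    have h1 := hw i ψ θ hθ hθc
    rw [setIntegral_Ioi_eq_of_tsupport_subset hT (tsupport_deriv_subset.trans hθs),
      setIntegral_Ioi_eq_of_tsupport_subset hT hθs] at h1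
    have e1 : ∫ t in (0 : ℝ)..T, ((deriv θ t : ℝ) : ℂ) * distL ψ (mult P.res (V t i))
        = ∫ t in (0 : ℝ)..T, ((deriv θ t : ℝ) : ℂ) * distL ψ (mult P.res (W t i)) := by
      rw [intervalIntegral.integral_of_le hT.le, intervalIntegral.integral_of_le hT.le]
      apply integral_congr_ae
      filter_upwards [hVW] with t ht
      rw [ht]
    have e2 : ∫ t in (0 : ℝ)..T, ((θ t : ℝ) : ℂ) * distL ψ (P.rhsRes F (V t) (q t) i)
        = ∫ t in (0 : ℝ)..T, ((θ t : ℝ) : ℂ) * distL ψ (P.rhsRes F (W t) (q t) i) := by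
      rw [intervalIntegral.integral_of_le hT.le, intervalIntegral.integral_of_le hT.le]
      apply integral_congr_ae
      filter_upwards [hVW] with t ht
      rw [ht]
    rwa [e1, e2] at h1
  -- The pressure is identified first: only then does the right-hand side depend on `W` alone, as
  -- Duhamel's formula requires.
  have hp := P.pres_ae_eq hT hF hU₀ hW hWC hdivW hqi hvec
  have hWm : ∀ i, ∀ᵐ t ∂volume.restrict (Ioc 0 T),
      W t i = P.mild (U₀ i) (fun s => P.forcing F (W s) i) t := fun i => by
    refine P.ae_eq_mild_of_weak hT hW hWC fun θ hθ hθc hθs => ?_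
    rw [hvec i θ hθ hθc hθs, intervalIntegral.integral_of_le hT.le,
      intervalIntegral.integral_of_le hT.le]
    apply integral_congr_ae
    filter_upwards [hp] with t ht
    rw [ht, rhsRes_pres, evo]
  filter_upwards [P.ae_eq_of_mild hT hW hWC hU hUm hWm, hp, hVW, ae_mono hle hvV]
    with t h1 h2 h3 h4
  rw [h4, h2, h3, h1]
  exact ⟨rfl, rfl⟩

theorem memH_exists_vec {v : VecL2} (hv : ∀ i, MemH 1 (v i)) :
    ∃ V : VecL2, v = fun i => mult P.lamInv (V i) := by
  choose V hV using fun i => P.exists_lamInv_eq_of_memH_one (hv i)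
  exact ⟨V, funext hV⟩

end Params

end Bardina

end

/-! ### Return from `U` to `u = Λ⁻¹ U`. -/

theorem mainTheorem1 (ν : ℝ) (hν : 0 < ν) (u₀ f : Bardina.VecL2)
    (hu₀ : ∀ i, Bardina.MemH 1 (u₀ i)) (hu₀div : Bardina.DivFree u₀)
    (hf : ∀ i, Bardina.MemH 1 (f i)) (hfdiv : Bardina.DivFree f)
    (α β : ℝ) (hα : 0 < α) (hβ : 0 < β) :
    ∃ (u : ℝ → Bardina.VecL2) (p : ℝ → Bardina.L2),
      Bardina.MemLinftyH1 u ∧ Bardina.MemL2LocHom2 u ∧ Bardina.MemL2LocH3 p ∧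
      Bardina.IsWeakSolution ν α β f u₀ u p ∧
      (ContinuousOn u (Set.Ici 0) ∧ u 0 = u₀ ∧ ∀ t, 0 ≤ t → ∀ i, Bardina.MemH 1 (u t i)) ∧
      (∀ t, 0 ≤ t → Bardina.EnergyEquality ν α β f u₀ u t) ∧
      (∀ (v : ℝ → Bardina.VecL2) (q : ℝ → Bardina.L2),
        Bardina.MemLinftyLocH1 v → Bardina.MemL2LocHom2 v → Bardina.MemL2LocH3 q →
        Bardina.IsWeakSolution ν α β f u₀ v q →
        ∀ᵐ t ∂MeasureTheory.volume.restrict (Set.Ici (0 : ℝ)), v t = u t ∧ q t = p t) := by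
  let P : Bardina.Params := ⟨ν, α, β, hν, hα, hβ⟩
  -- Fields in `H¹` are images of `L²` fields under `Λ⁻¹`; from here on everything is expressed
  -- through `U₀` and `F`.
  obtain ⟨U₀, rfl⟩ := P.memH_exists_vec hu₀
  obtain ⟨F, rfl⟩ := P.memH_exists_vec hf
  have hU₀ := (P.divFree_lamInv_iff U₀).mp hu₀div
  have hF := (P.divFree_lamInv_iff F).mp hfdiv
  obtain ⟨U, hU, hU0, ⟨M, hM⟩, hdiv, hmild⟩ := P.exists_solution hU₀ hF
  have hg : ∀ t, 0 ≤ t → ∀ i, ∫⁻ s in Set.Ioc 0 t, P.genSq (U s i) ≠ ⊤ := fun t ht i =>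
    have hUi : Continuous fun s => U s i := (continuous_apply i).comp hU
    have hgi : Continuous fun s => P.forcing F (U s) i :=
      (continuous_apply i).comp ((P.continuous_forcing F).comp hU)
    P.lintegral_genSq_ne_top hUi hgi
      (fun t ht => P.res_eq_of_mild hgi (fun t ht => hmild t ht i) ht) ht
  refine ⟨fun t i => Bardina.mult P.lamInv (U t i), fun t => P.pres (U t),
    P.memLinftyH1_lamInv hU hM, P.memL2LocHom2_lamInv hU hg, P.memL2LocH3_pres hU hM hg,
    P.isWeakSolution_of_mild hU hU0 hdiv hmild, ⟨?_, ?_, fun t _ i => P.memH_one_lamInv _⟩,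
    fun t ht => P.energyEquality_of_mild hU hU0 hdiv hmild ht,
    fun v q hv _ hq h => P.ae_eq_of_isWeakSolution hF hU₀ hU hmild hv hq h⟩
  · apply Continuous.continuousOn
    fun_prop
  · beta_reduce
    rw [hU0]
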